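/- Let $d\in\mathbb N$, $T>0$, $\Lambda=(0,2\pi)^d$, $D_T=\Lambda\times(0,T)$; "periodic" means $2\pi$-periodic in each coordinate of $x\in\mathbb R^d$. Let $f=(f_1,\dots,f_d)$ with $f_j\in C^1(\mathbb R)$; let $\mu\ge 0$ be a Lévy measure on $\mathbb R^d\setminus\{0\}$, i.e. $\int_{|z|>0}|z|^2\wedge 1\,d\mu(z)<\infty$; let $u_0\in L^\infty(\Lambda)\cap BV(\Lambda)$ be periodic, where $|u_0|_{BV(\Lambda)}$ denotes the total variation of $u_0$ in $\Lambda$. Put $$\mathcal L^\mu[\phi](x)=\int_{|z|>0}\phi(x+z)-\phi(x)-z\cdot\partial_x\phi(x)\mathbf 1_{|z|<1}\,d\mu(z),\qquad \mathcal L^{\mu,r}[\phi](x)=\int_{|z|>r}\phi(x+z)-\phi(x)\,d\mu(z),$$ $$\mathcal L^{*,\mu}_r[\phi](x)=\int_{0<|z|\le r}\phi(x-z)-\phi(x)+z\cdot\partial_x\phi(x)\mathbf 1_{|z|<1}\,d\mu(z),\qquad \gamma^r_\mu=\int_{r<|z|<1}z\,d\mu(z),$$ and $\eta(u,k)=|u-k|$,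 $\eta'(u,k)=\mathrm{sgn}(u-k)$ (with $\mathrm{sgn}\,0=0$), $q_j(u,k)=\eta'(u,k)(f_j(u)-f_j(k))$. A periodic entropy solution of $$\partial_t u+\mathrm{div} f(u)=\mathcal L^\mu[u]\ \text{ in } D_T,\qquad u(\cdot,0)=u_0, \tag{1}$$ is a function $u$, periodic in $x$, with (i) $u$ measurable and bounded, uniformly in $t\in[0,T]$, and $u\in C([0,T];L^1(\Lambda))$; (ii) for all $k\in\mathbb R$, all $r>0$ and all nonnegative $\varphi\in C^\infty(\mathbb R^d\times(0,T))$ that are periodic in $x$ and compactly supported in $t\in(0,T)$, $$\iint_{D_T}\eta(u,k)\partial_t\varphi+q(u,k)\cdot\partial_x\varphi+\eta(u,k)\mathcal L^{*,\mu}_r[\varphi]+\eta'(u,k)\mathcal L^{\mu,r}[u]\,\varphi+\eta(u,k)\gamma^r_\mu\cdot\partial_x\varphi\,dx\,dt\ge 0;$$ (iii) $\operatorname{ess\,lim}_{t\to0^+}\|u(\cdot,t)-u_0\|_{L^1(\Lambda)}=0$. **Theorem (Convergence rate I).** Let $u$ be a periodic entropy solution of (1). For $\varepsilon>0$ let $u_\varepsilon$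 be a classical ($C^1$ in $t$, $C^2$ in $x$, all these derivatives being continuous on $\mathbb R^d\times(0,T)$), $x$-periodic solution of $$\partial_t u_\varepsilon+\mathrm{div} f(u_\varepsilon)=\mathcal L^\mu[u_\varepsilon]+\varepsilon\Delta u_\varepsilon\quad\text{in }\mathbb R^d\times(0,T),\qquad \lim_{t\to0^+}\|u_\varepsilon(\cdot,t)-u_0\|_{L^1(\Lambda)}=0 .$$ Then $$\|u(\cdot,t)-u_\varepsilon(\cdot,t)\|_{L^1(\Lambda)}\le C\sqrt\varepsilon\qquad\text{for all } t\in(0,T)\text{ and all }\varepsilon>0,$$ where $C$ depends only on $d$, $T$ and an upper bound for $|u_0|_{BV(\Lambda)}$; in particular $C$ does not depend on $\varepsilon$ or $t$. -/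

import Mathlib

open MeasureTheory Set Filter Topology
open scoped ENNReal NNReal ContDiff

namespace FracCL

noncomputable section

/-- The space `ℝ^d` with its Euclidean norm. -/
abbrev Space (d : ℕ) : Type := EuclideanSpace ℝ (Fin d)

/-- The open period cell `Λ = (0, 2π)^d`. -/
def cell (d : ℕ) : Set (Space d) := {x | ∀ j, x j ∈ Ioo (0 : ℝ) (2 * Real.pi)}

/-- `Λ`-periodicity: `2π`-periodicity in each coordinate direction. -/
def CellPeriodic {d : ℕ} (g : Space d → ℝ) : Prop :=
  ∀ j : Fin d, Function.Periodic g (EuclideanSpace.single j (2 * Real.pi))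

/-- The distance `‖g - h‖_{L^1(Λ)}`, as an extended nonnegative number. -/
def distL1 {d : ℕ} (g h : Space d → ℝ) : ℝ≥0∞ :=
  eLpNorm (fun x => g x - h x) 1 (volume.restrict (cell d))

/-- The partial derivative `∂_j g`. -/
def partialDeriv {d : ℕ} (j : Fin d) (g : Space d → ℝ) (x : Space d) : ℝ :=
  fderiv ℝ g x (EuclideanSpace.single j 1)

/-- The divergence of a vector field, given by its components. -/
def divergence {d : ℕ} (F : Space d → Fin d → ℝ) (x : Space d) : ℝ :=
  ∑ j, partialDeriv j (fun y => F y j) x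

/-- The total variation `|g|_{BV(Λ)}` in the open cell: the supremum of `∫_Λ g div Φ` over the
`C^1` vector fields `Φ` that are compactly supported in `Λ` and satisfy `|Φ| ≤ 1`. -/
def variationBV {d : ℕ} (g : Space d → ℝ) : ℝ≥0∞ :=
  ⨆ (Φ : Space d → Space d) (_ : ContDiff ℝ 1 Φ) (_ : HasCompactSupport Φ)
    (_ : tsupport Φ ⊆ cell d) (_ : ∀ x, ‖Φ x‖ ≤ 1),
    ENNReal.ofReal (∫ x in cell d, g x * divergence (fun y j => Φ y j) x)

/-- A function of class `L^∞` on `ℝ^d`. -/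
def EssBounded {d : ℕ} (g : Space d → ℝ) : Prop :=
  AEStronglyMeasurable g volume ∧ ∃ M : ℝ, ∀ᵐ x, |g x| ≤ M

/-- A Lévy measure: a nonnegative Borel measure on `ℝ^d ∖ {0}`, extended by zero to `ℝ^d`, with
`∫ |z|² ∧ 1 dμ(z) < ∞`. Such a measure is automatically Radon on `ℝ^d ∖ {0}`. -/
structure IsLevyMeasure {d : ℕ} (μ : Measure (Space d)) : Prop where
  zero_atom : μ {0} = 0
  integrable_min : ∫⁻ z, ENNReal.ofReal (min (‖z‖ ^ 2) 1) ∂μ < ⊤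

/-- The term `z · ∂_x φ(x) 1_{|z| < 1}`. -/
def compensator {d : ℕ} (φ : Space d → ℝ) (x z : Space d) : ℝ :=
  {w : Space d | ‖w‖ < 1}.indicator (fun w => fderiv ℝ φ x w) z

/-- The Lévy operator `L^μ[φ](x) = ∫ φ(x+z) - φ(x) - z·∂_xφ(x) 1_{|z|<1} dμ(z)`. -/
def levy {d : ℕ} (μ : Measure (Space d)) (φ : Space d → ℝ) (x : Space d) : ℝ :=
  ∫ z in {z | 0 < ‖z‖}, (φ (x + z) - φ x - compensator φ x z) ∂μ

/-- The small-jump part of the adjoint operator: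
`∫_{|z| ≤ r} φ(x-z) - φ(x) + z·∂_xφ(x) 1_{|z|<1} dμ(z)`. -/
def levyAdjointSmall {d : ℕ} (μ : Measure (Space d)) (r : ℝ) (φ : Space d → ℝ)
    (x : Space d) : ℝ :=
  ∫ z in {z | 0 < ‖z‖ ∧ ‖z‖ ≤ r}, (φ (x - z) - φ x + compensator φ x z) ∂μ

/-- The large-jump part `L^{μ,r}[φ](x) = ∫_{|z| > r} φ(x+z) - φ(x) dμ(z)`. -/
def levyLarge {d : ℕ} (μ : Measure (Space d)) (r : ℝ) (φ : Space d → ℝ) (x : Space d) : ℝ :=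
  ∫ z in {z | r < ‖z‖}, (φ (x + z) - φ x) ∂μ

/-- The drift `γ_μ^r = ∫_{r < |z| < 1} z dμ(z)`, which is `0` for `r ≥ 1`. -/
def drift {d : ℕ} (μ : Measure (Space d)) (r : ℝ) : Space d :=
  ∫ z in {z | r < ‖z‖ ∧ ‖z‖ < 1}, z ∂μ

/-- The Kružkov entropy `η(u,k) = |u - k|`. -/
def eta (u k : ℝ) : ℝ := |u - k|

/-- Its derivative `η'(u,k) = sgn(u - k)`, with `sgn 0 = 0`. -/
def etaDeriv (u k : ℝ) : ℝ := Real.sign (u - k)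

/-- The entropy fluxes `q_j(u,k) = η'(u,k) (f_j(u) - f_j(k))`. -/
def entropyFlux {d : ℕ} (f : Fin d → ℝ → ℝ) (j : Fin d) (u k : ℝ) : ℝ :=
  etaDeriv u k * (f j u - f j k)

/-- Nonnegative test functions: smooth, `Λ`-periodic in space, compactly supported in time
in `(0,T)` (and extended by zero to all times). -/
structure IsTestFunction {d : ℕ} (T : ℝ) (φ : Space d → ℝ → ℝ) : Prop where
  smooth : ContDiff ℝ ∞ (fun p : Space d × ℝ => φ p.1 p.2)
  periodic : ∀ t, CellPeriodic (fun x => φ x t)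
  support : ∃ a b : ℝ, 0 < a ∧ b < T ∧ ∀ x t, t ∉ Icc a b → φ x t = 0
  nonneg : ∀ x t, 0 ≤ φ x t

/-- The integrand of the entropy inequality, at the space-time point `p = (x,t)`. -/
def entropyIntegrand {d : ℕ} (f : Fin d → ℝ → ℝ) (μ : Measure (Space d)) (k r : ℝ)
    (u φ : Space d → ℝ → ℝ) (p : Space d × ℝ) : ℝ :=
  eta (u p.1 p.2) k * deriv (φ p.1) p.2
    + ∑ j, entropyFlux f j (u p.1 p.2) k * partialDeriv j (fun x => φ x p.2) p.1
    + eta (u p.1 p.2) k * levyAdjointSmall μ r (fun x => φ x p.2) p.1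
    + etaDeriv (u p.1 p.2) k * levyLarge μ r (fun x => u x p.2) p.1 * φ p.1 p.2
    + eta (u p.1 p.2) k * fderiv ℝ (fun x => φ x p.2) p.1 (drift μ r)

/-- Periodic entropy solutions on `[0,T]` of
`∂_t u + div f(u) = L^μ[u]`, `u(·,0) = u₀`. The function `u` is a representative which is
measurable, `Λ`-periodic in space, bounded uniformly in time, and continuous in time with values
in `L^1(Λ)`. -/
structure IsEntropySolution {d : ℕ} (f : Fin d → ℝ → ℝ) (μ : Measure (Space d)) (T : ℝ)
    (u₀ : Space d → ℝ) (u : Space d → ℝ → ℝ) : Prop where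
  measurable : AEStronglyMeasurable (fun p : Space d × ℝ => u p.1 p.2)
    (volume.restrict (univ ×ˢ Icc 0 T))
  measurable_slice : ∀ t ∈ Icc 0 T, AEStronglyMeasurable (fun x => u x t) volume
  periodic : ∀ t ∈ Icc 0 T, CellPeriodic (fun x => u x t)
  bounded : ∃ M : ℝ, ∀ t ∈ Icc 0 T, ∀ᵐ x, |u x t| ≤ M
  continuous : ∀ t ∈ Icc 0 T,
    Tendsto (fun s => distL1 (fun x => u x s) (fun x => u x t)) (𝓝[Icc 0 T] t) (𝓝 0)
  entropy : ∀ k r : ℝ, 0 < r → ∀ φ : Space d → ℝ → ℝ, IsTestFunction T φ →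
    0 ≤ ∫ p in cell d ×ˢ Ioo 0 T, entropyIntegrand f μ k r u φ p
  /-- The essential limit of `‖u(·,t) - u₀‖_{L^1(Λ)}` as `t → 0` is `0`. -/
  initial : Tendsto (fun t => distL1 (fun x => u x t) u₀) (𝓝[>] (0 : ℝ) ⊓ ae volume) (𝓝 0)

/-- Classical (`C^1` in time, `C^2` in space) `Λ`-periodic solutions on `(0,T)` of
`∂_t v + div f(v) = L^μ[v] + ε Δ v`, with initial value `u₀` attained in `L^1(Λ)`. -/
structure IsViscousSolution {d : ℕ} (f : Fin d → ℝ → ℝ) (μ : Measure (Space d)) (T ε : ℝ)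
    (u₀ : Space d → ℝ) (v : Space d → ℝ → ℝ) : Prop where
  periodic : ∀ t ∈ Ioo 0 T, CellPeriodic (fun x => v x t)
  contDiff_space : ∀ t ∈ Ioo 0 T, ContDiff ℝ 2 (fun x => v x t)
  differentiable_time : ∀ x, ∀ t ∈ Ioo 0 T, DifferentiableAt ℝ (v x) t
  continuous : ContinuousOn (fun p : Space d × ℝ => v p.1 p.2) (univ ×ˢ Ioo 0 T)
  continuous_time : ContinuousOn (fun p : Space d × ℝ => deriv (v p.1) p.2) (univ ×ˢ Ioo 0 T)
  continuous_space : ContinuousOn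
    (fun p : Space d × ℝ => fderiv ℝ (fun x => v x p.2) p.1) (univ ×ˢ Ioo 0 T)
  continuous_space_two : ContinuousOn
    (fun p : Space d × ℝ => fderiv ℝ (fderiv ℝ (fun x => v x p.2)) p.1) (univ ×ˢ Ioo 0 T)
  equation : ∀ x, ∀ t ∈ Ioo 0 T,
    deriv (v x) t + divergence (fun y j => f j (v y t)) x
      = levy μ (fun y => v y t) x + ε * Laplacian.laplacian (fun y => v y t) x
  initial : Tendsto (fun t => distL1 (fun x => v x t) u₀) (𝓝[>] (0 : ℝ)) (𝓝 0)

end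

end FracCL

open MeasureTheory Set Filter Topology
open scoped ENNReal NNReal ContDiff

namespace FracCL

/-! ### The period cell and periodic functions -/

/-! The argument is Kuznetsov's form of Kružkov's doubling of variables. The entropy inequality for
`u(x,t)` is used with the constant `k = v(y,s)`, the viscous equation for `v(y,s)` is multiplied by
`sgn(v - u)`, and both are tested with `Ω(x - y) α(t) β(t - s)`, where `Ω` is an even periodic
kernel of mass one. Since `Ω` depends on `x - y` only, the convective fluxes and the drift terms
cancel. Jumps longer than `r` contribute at most zero: `sgn(a)(a' - a) ≤ |a'| - |a|`, and the
integral of `|u(x) - v(y)| Ω(x - y)` over two periods is unchanged when both points are moved by the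
same `z`. Jumps shorter than `r` act only on the smooth functions `v` and `Ω`, hence are controlled
by the second moment of `μ` on `|z| ≤ r`, which vanishes as `r → 0`. Only the viscosity remains;
with one derivative moved to `Ω` it costs `ε ∑ ‖∂_j v‖₁ ‖∂_j Ω‖₁` per unit time. Letting `r → 0` and
then the width of `β` tend to zero, which needs only continuity in time with values in `L¹`, gives
the growth estimate `IsEntropySolution.smearedDist_le_add` for the smeared distance `∬ |u(x,t) -
v(y,t)| Ω(x - y)`.

Two further ingredients turn this into a rate. The first is `‖∂_j v‖₁ ≤ 2B`. Viscous solutions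
contract in `L¹` and may be translated, so `v(·,t)` inherits the translation modulus of `u₀`. The
variation in the open cell does not see the jumps of `u₀` across the faces, but along each line such
a jump is at most the variation inside the period; the periodic variation in direction `j` is
therefore at most `2B` (`neg_integral_mul_partialDeriv_le`).

The second is a kernel on the torus, the product of the normalised `cos(h_j/2)^{2n}`, for which
`‖∂_j Ω‖₁ ≤ √n` and the first moment is of order `1/√n`. Replacing the smeared distance by the `L¹`
distance costs the smeared distance of `v` from itself, at most `dKπ/√(n+1)` with `K = 2B`, once at
the initial and once at the final time; no regularity of `u` enters. The choice `n = ⌊1/ε⌋` makes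
every error of order `√ε`. -/

/-- The basis `2π e_j` of the period lattice. -/
noncomputable def latticeBasis (d : ℕ) : Module.Basis (Fin d) ℝ (Space d) :=
  (EuclideanSpace.basisFun (Fin d) ℝ).toBasis.isUnitSMul
    (w := fun _ => 2 * Real.pi) (fun _ => isUnit_iff_ne_zero.2 Real.two_pi_pos.ne')

theorem latticeBasis_apply {d : ℕ} (j : Fin d) :
    latticeBasis d j = EuclideanSpace.single j (2 * Real.pi) := by
  ext i; simp [latticeBasis, Module.Basis.isUnitSMul_apply]

theorem latticeBasis_repr {d : ℕ} (x : Space d) (j : Fin d) :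
    (latticeBasis d).repr x j = (2 * Real.pi)⁻¹ * x j := by
  have h := congrArg (fun y : Space d => y j) ((latticeBasis d).sum_repr x)
  have h2 : (latticeBasis d).repr x j * (2 * Real.pi) = x j := by
    simpa [latticeBasis_apply, Finset.sum_apply, Pi.single_apply] using h
  rw [← h2]; field_simp

theorem mem_fundamentalDomain_iff {d : ℕ} (x : Space d) :
    x ∈ ZSpan.fundamentalDomain (latticeBasis d) ↔ ∀ j, x j ∈ Ico (0 : ℝ) (2 * Real.pi) := by
  rw [ZSpan.mem_fundamentalDomain]
  refine forall_congr' fun j => ?_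
  rw [latticeBasis_repr, mem_Ico, mem_Ico, inv_mul_lt_one₀ Real.two_pi_pos,
    mul_nonneg_iff_of_pos_left (inv_pos.2 Real.two_pi_pos)]

theorem cell_eq_preimage (d : ℕ) :
    cell d = WithLp.ofLp ⁻¹' (univ.pi fun _ : Fin d => Ioo (0 : ℝ) (2 * Real.pi)) := by
  ext x; simp [cell]

theorem isOpen_cell (d : ℕ) : IsOpen (cell d) := by
  rw [cell_eq_preimage]
  exact (isOpen_set_pi finite_univ fun _ _ => isOpen_Ioo).preimage (PiLp.continuous_ofLp 2 _)

theorem measurableSet_cell (d : ℕ) : MeasurableSet (cell d) := (isOpen_cell d).measurableSet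

/-- The open cube and the half-open fundamental domain of the lattice differ only by faces, which
are null sets; this gives access to the theory of fundamental domains. -/
theorem cell_ae_eq_fundamentalDomain (d : ℕ) :
    cell d =ᵐ[volume] (ZSpan.fundamentalDomain (latticeBasis d) : Set (Space d)) := by
  have h1 : (ZSpan.fundamentalDomain (latticeBasis d) : Set (Space d))
      = WithLp.ofLp ⁻¹' (univ.pi fun _ : Fin d => Ico (0 : ℝ) (2 * Real.pi)) := by
    ext x; rw [mem_fundamentalDomain_iff]; simp
  rw [h1, cell_eq_preimage]
  refine (PiLp.volume_preserving_ofLp (Fin d)).quasiMeasurePreserving.preimage_ae_eq ?_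
  exact Measure.univ_pi_Ioo_ae_eq_Icc.trans Measure.univ_pi_Ico_ae_eq_Icc.symm

/-- The lattice of periods. -/
abbrev periodLattice (d : ℕ) : AddSubgroup (Space d) :=
  (Submodule.span ℤ (range (latticeBasis d))).toAddSubgroup

instance instCountablePeriodLattice (d : ℕ) : Countable (periodLattice d) :=
  inferInstanceAs (Countable (Submodule.span ℤ (range (latticeBasis d))))

theorem isAddFundamentalDomain_cell (d : ℕ) :
    IsAddFundamentalDomain (periodLattice d) (ZSpan.fundamentalDomain (latticeBasis d))
      (volume : Measure (Space d)) :=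
  ZSpan.isAddFundamentalDomain' (latticeBasis d) volume

theorem periodic_add_lattice {d : ℕ} {α : Type*} {g : Space d → α}
    (hg : ∀ j : Fin d, Function.Periodic g (EuclideanSpace.single j (2 * Real.pi)))
    {l : Space d} (hl : l ∈ periodLattice d) (x : Space d) : g (l + x) = g x := by
  induction hl using Submodule.span_induction generalizing x with
  | mem y hy =>
    obtain ⟨j, rfl⟩ := hy
    rw [latticeBasis_apply, add_comm]; exact hg j x
  | zero => simp
  | add y z _ _ hy hz => rw [add_assoc, hy, hz]
  | smul n y _ hy =>
    have : Function.Periodic g y := fun x => by rw [add_comm]; exact hy x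
    rw [add_comm]; exact this.zsmul n x

theorem measure_cell_lt_top (d : ℕ) : volume (cell d) < ⊤ := by
  rw [measure_congr (cell_ae_eq_fundamentalDomain d)]
  exact (ZSpan.fundamentalDomain_isBounded (latticeBasis d)).measure_lt_top

instance instIsFiniteMeasureCell (d : ℕ) : IsFiniteMeasure (volume.restrict (cell d)) :=
  ⟨by simpa using measure_cell_lt_top d⟩

open scoped Pointwise in
theorem isAddFundamentalDomain_vadd_cell {d : ℕ} (z : Space d) :
    IsAddFundamentalDomain (periodLattice d)
      ((fun x => x + z) ⁻¹' ZSpan.fundamentalDomain (latticeBasis d))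
      (volume : Measure (Space d)) := by
  have h := (isAddFundamentalDomain_cell d).vadd_of_comm (-z)
  have h2 : (fun x => x + z) ⁻¹' ZSpan.fundamentalDomain (latticeBasis d)
      = -z +ᵥ (ZSpan.fundamentalDomain (latticeBasis d) : Set (Space d)) := by
    refine Set.ext fun x => ?_
    rw [Set.mem_vadd_set_iff_neg_vadd_mem]
    simp [add_comm]
  rwa [h2]

/-- A translate of a fundamental domain is again one, and a lattice-invariant function has the same
integral over all of them. -/
theorem setIntegral_cell_add {d : ℕ} {E : Type*} [NormedAddCommGroup E] [NormedSpace ℝ E]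
    {g : Space d → E}
    (hg : ∀ j : Fin d, Function.Periodic g (EuclideanSpace.single j (2 * Real.pi)))
    (z : Space d) : ∫ x in cell d, g (x + z) = ∫ x in cell d, g x := by
  rw [setIntegral_congr_set (cell_ae_eq_fundamentalDomain d),
    setIntegral_congr_set (cell_ae_eq_fundamentalDomain d)]
  have h1 := (isAddFundamentalDomain_vadd_cell (d := d) z).setIntegral_eq
    (isAddFundamentalDomain_cell d) (f := fun x => g (x + z)) (by
      intro l x
      have : (l +ᵥ x) + z = (l : Space d) + (x + z) := by
        rw [AddSubgroup.vadd_def, vadd_eq_add, add_assoc]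
      simp only [this]
      exact periodic_add_lattice hg l.2 _)
  rw [← h1]
  exact (measurePreserving_add_right volume z).setIntegral_preimage_emb
    (measurableEmbedding_addRight z) g _

theorem setLIntegral_cell_add {d : ℕ} {g : Space d → ℝ≥0∞}
    (hg : ∀ j : Fin d, Function.Periodic g (EuclideanSpace.single j (2 * Real.pi)))
    (z : Space d) : ∫⁻ x in cell d, g (x + z) = ∫⁻ x in cell d, g x := by
  rw [setLIntegral_congr (cell_ae_eq_fundamentalDomain d),
    setLIntegral_congr (cell_ae_eq_fundamentalDomain d)]
  have h1 := (isAddFundamentalDomain_vadd_cell (d := d) z).setLIntegral_eq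
    (isAddFundamentalDomain_cell d) (fun x => g (x + z)) (by
      intro l x
      have : (l +ᵥ x) + z = (l : Space d) + (x + z) := by
        rw [AddSubgroup.vadd_def, vadd_eq_add, add_assoc]
      simp only [this]
      exact periodic_add_lattice hg l.2 _)
  rw [← h1]
  exact (measurePreserving_add_right volume z).setLIntegral_comp_preimage_emb
    (measurableEmbedding_addRight z) g _

theorem exists_lattice_add_mem_box {d : ℕ} (x : Space d) :
    ∃ l ∈ periodLattice d, l + x ∈ WithLp.ofLp ⁻¹' (Icc (0 : Fin d → ℝ) fun _ => 2 * Real.pi) := by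
  refine ⟨-(ZSpan.floor (latticeBasis d) x : Space d),
    (periodLattice d).neg_mem (ZSpan.floor (latticeBasis d) x).2, ?_⟩
  have h := ZSpan.fract_mem_fundamentalDomain (latticeBasis d) x
  rw [mem_fundamentalDomain_iff] at h
  rw [neg_add_eq_sub]
  exact ⟨fun j => (h j).1, fun j => (h j).2.le⟩

theorem isCompact_box (d : ℕ) :
    IsCompact (WithLp.ofLp ⁻¹' (Icc (0 : Fin d → ℝ) fun _ => 2 * Real.pi) : Set (Space d)) :=
  (PiLp.homeomorph 2 fun _ : Fin d => ℝ).isCompact_preimage.2 isCompact_Icc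

/-- Periodicity replaces the space by a compact box. In time only compact subintervals of `(0,T)`
are available, as nothing is assumed about derivatives near the end points. -/
theorem exists_bound_of_periodic_time {d : ℕ} {E : Type*} [NormedAddCommGroup E]
    {g : Space d → ℝ → E} {T a b : ℝ} (ha : 0 < a) (hb : b < T)
    (hg : ∀ t ∈ Ioo 0 T, ∀ j : Fin d,
      Function.Periodic (fun x => g x t) (EuclideanSpace.single j (2 * Real.pi)))
    (hc : ContinuousOn (fun p : Space d × ℝ => g p.1 p.2) (univ ×ˢ Ioo 0 T)) :
    ∃ C, ∀ x, ∀ t ∈ Icc a b, ‖g x t‖ ≤ C := by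
  obtain ⟨C, hC⟩ := ((isCompact_box d).prod (isCompact_Icc (a := a) (b := b))).exists_bound_of_continuousOn
    (hc.mono (prod_mono (subset_univ _) fun t ht => ⟨ha.trans_le ht.1, ht.2.trans_lt hb⟩))
  refine ⟨C, fun x t ht => ?_⟩
  obtain ⟨l, hl, hx⟩ := exists_lattice_add_mem_box x
  have h := hC (l + x, t) ⟨hx, ht⟩
  rwa [show g (l + x) t = g x t from
    periodic_add_lattice (hg t ⟨ha.trans_le ht.1, ht.2.trans_lt hb⟩) hl x] at h

theorem exists_bound_of_periodic {d : ℕ} {E : Type*} [NormedAddCommGroup E] {g : Space d → E}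
    (hg : ∀ j : Fin d, Function.Periodic g (EuclideanSpace.single j (2 * Real.pi)))
    (hc : Continuous g) : ∃ C, ∀ x, ‖g x‖ ≤ C := by
  obtain ⟨C, hC⟩ := (isCompact_box d).exists_bound_of_continuousOn hc.continuousOn
  refine ⟨C, fun x => ?_⟩
  obtain ⟨l, hl, hx⟩ := exists_lattice_add_mem_box x
  rw [← periodic_add_lattice hg hl x]
  exact hC _ hx

theorem periodic_fderiv {d : ℕ} {E : Type*} [NormedAddCommGroup E] [NormedSpace ℝ E]
    {g : Space d → E} {c : Space d} (hg : Function.Periodic g c) :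
    Function.Periodic (fderiv ℝ g) c := by
  intro x
  rw [← fderiv_comp_add_right c]
  congr 1
  exact funext hg

theorem CellPeriodic.partialDeriv {d : ℕ} {g : Space d → ℝ} (hg : CellPeriodic g) (j : Fin d) :
    CellPeriodic (partialDeriv j g) := fun i x => by
  simp only [FracCL.partialDeriv]
  rw [periodic_fderiv (hg i) x]

theorem continuous_partialDeriv {d : ℕ} {g : Space d → ℝ} (hg : ContDiff ℝ 1 g) (j : Fin d) :
    Continuous (partialDeriv j g) :=
  (hg.continuous_fderiv one_ne_zero).clm_apply continuous_const

theorem integrable_cell_of_continuous {d : ℕ} {g : Space d → ℝ} (hc : Continuous g)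
    (hg : CellPeriodic g) : Integrable g (volume.restrict (cell d)) := by
  obtain ⟨C, hC⟩ := exists_bound_of_periodic hg hc
  exact Integrable.of_bound hc.aestronglyMeasurable C (ae_of_all _ hC)

/-- The integral of a partial derivative of a periodic function over the cell vanishes. -/
theorem integral_partialDeriv_eq_zero {d : ℕ} {g : Space d → ℝ} (hg : ContDiff ℝ 1 g)
    (hp : CellPeriodic g) (j : Fin d) : ∫ x in cell d, partialDeriv j g x = 0 := by
  set e : Space d := EuclideanSpace.single j (1 : ℝ) with he
  obtain ⟨C, hC⟩ := exists_bound_of_periodic (hp.partialDeriv j) (continuous_partialDeriv hg j)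
  have hder : ∀ x : Space d, ∀ τ : ℝ, HasDerivAt (fun τ : ℝ => g (x + τ • e))
      (FracCL.partialDeriv j g (x + τ • e)) τ := by
    intro x τ
    have h1 : HasDerivAt (fun τ : ℝ => x + τ • e) e τ := by
      simpa using ((hasDerivAt_id τ).smul_const e).const_add x
    exact ((hg.differentiable one_ne_zero (x + τ • e)).hasFDerivAt).comp_hasDerivAt τ h1
  -- The integral of the translate by `τ e_j` does not depend on `τ`; differentiating under the
  -- integral at `τ = 0` gives the claim without boundary terms.
  have h := hasDerivAt_integral_of_dominated_loc_of_deriv_le (μ := volume.restrict (cell d))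
    (F := fun (τ : ℝ) x => g (x + τ • e)) (F' := fun τ x => FracCL.partialDeriv j g (x + τ • e))
    (x₀ := 0) (s := univ) (bound := fun _ => C) univ_mem
    (Eventually.of_forall fun τ =>
      (hg.continuous.comp (continuous_add_const _)).aestronglyMeasurable)
    (by simpa using integrable_cell_of_continuous hg.continuous hp)
    ((continuous_partialDeriv hg j).comp (continuous_add_const _)).aestronglyMeasurable
    (ae_of_all _ fun x τ _ => hC _) (integrable_const C)
    (ae_of_all _ fun x τ _ => hder x τ)
  have h2 : (fun τ : ℝ => ∫ x in cell d, g (x + τ • e)) = fun _ => ∫ x in cell d, g x :=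
    funext fun τ => setIntegral_cell_add hp _
  rw [h2] at h
  simpa using h.2.unique (hasDerivAt_const (0 : ℝ) _)

/-! ### Smooth approximation of the sign and integration by parts -/

/-- A smooth approximation of the sign function. -/
noncomputable def smoothSign (n : ℕ) (w : ℝ) : ℝ := 2 / Real.pi * Real.arctan (n * w)

/-- The derivative of `smoothSign n`. -/
noncomputable def smoothSignDeriv (n : ℕ) (w : ℝ) : ℝ :=
  2 / Real.pi * (n / (1 + (n * w) ^ 2))

theorem contDiff_smoothSign (n : ℕ) {m : ℕ∞} : ContDiff ℝ m (smoothSign n) :=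
  contDiff_const.mul (Real.contDiff_arctan.comp (contDiff_const.mul contDiff_id))

theorem hasDerivAt_smoothSign (n : ℕ) (w : ℝ) :
    HasDerivAt (smoothSign n) (smoothSignDeriv n w) w := by
  have h := (((hasDerivAt_id w).const_mul (n : ℝ)).arctan).const_mul (2 / Real.pi)
  refine h.congr_deriv ?_
  simp only [smoothSignDeriv, id]; ring

theorem continuous_smoothSignDeriv (n : ℕ) : Continuous (smoothSignDeriv n) := by
  unfold smoothSignDeriv
  refine continuous_const.mul (continuous_const.div (by fun_prop) fun w => ?_)
  positivity

theorem smoothSignDeriv_nonneg (n : ℕ) (w : ℝ) : 0 ≤ smoothSignDeriv n w := by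
  unfold smoothSignDeriv; have := Real.pi_pos; positivity

theorem abs_smoothSign_le (n : ℕ) (w : ℝ) : |smoothSign n w| ≤ 1 := by
  unfold smoothSign
  have h1 := Real.arctan_lt_pi_div_two (n * w)
  have h2 := Real.neg_pi_div_two_lt_arctan (n * w)
  have hp := Real.pi_pos
  rw [abs_mul, abs_of_pos (by positivity)]
  have : |Real.arctan (n * w)| ≤ Real.pi / 2 := abs_le.2 ⟨by linarith, h1.le⟩
  calc 2 / Real.pi * |Real.arctan (n * w)| ≤ 2 / Real.pi * (Real.pi / 2) := by gcongr
    _ = 1 := by field_simp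

theorem tendsto_smoothSign (w : ℝ) :
    Tendsto (fun n => smoothSign n w) atTop (𝓝 (Real.sign w)) := by
  have hp := Real.pi_pos
  unfold smoothSign
  rcases lt_trichotomy w 0 with h | h | h
  · have h1 : Tendsto (fun n : ℕ => (n : ℝ) * w) atTop atBot :=
      tendsto_natCast_atTop_atTop.atTop_mul_const_of_neg h
    have h2 := ((Real.tendsto_arctan_atBot.mono_right nhdsWithin_le_nhds).comp h1).const_mul
      (2 / Real.pi)
    rw [Real.sign_of_neg h]
    rwa [show 2 / Real.pi * -(Real.pi / 2) = -1 by field_simp] at h2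
  · simp [h]
  · have h1 : Tendsto (fun n : ℕ => (n : ℝ) * w) atTop atTop :=
      tendsto_natCast_atTop_atTop.atTop_mul_const h
    have h2 := ((Real.tendsto_arctan_atTop.mono_right nhdsWithin_le_nhds).comp h1).const_mul
      (2 / Real.pi)
    rw [Real.sign_of_pos h]
    rwa [show 2 / Real.pi * (Real.pi / 2) = 1 by field_simp] at h2

/-- The derivative of the smoothed sign concentrates at zero like a Dirac mass, but its product with
`|w|` stays bounded and tends to zero pointwise. Dominated convergence therefore removes every term
where it meets a factor vanishing with `w`. -/
theorem abs_mul_smoothSignDeriv_le (n : ℕ) (w : ℝ) : |w| * smoothSignDeriv n w ≤ 1 := by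
  have hp : 2 / Real.pi ≤ 1 := by
    rw [div_le_one Real.pi_pos]; exact Real.two_le_pi
  have hp0 := Real.pi_pos
  have h : (n : ℝ) * |w| / (1 + (n * w) ^ 2) ≤ 1 := by
    rw [div_le_one (by positivity), mul_pow, ← sq_abs w]
    nlinarith [sq_nonneg ((n : ℝ) * |w| - 1), abs_nonneg w, (Nat.cast_nonneg n : (0 : ℝ) ≤ n)]
  have h0 : 0 ≤ (n : ℝ) * |w| / (1 + (n * w) ^ 2) := by positivity
  calc |w| * smoothSignDeriv n w = 2 / Real.pi * ((n : ℝ) * |w| / (1 + (n * w) ^ 2)) := by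
        unfold smoothSignDeriv; ring
    _ ≤ 1 * 1 := by gcongr
    _ = 1 := one_mul 1

theorem tendsto_abs_mul_smoothSignDeriv (w : ℝ) :
    Tendsto (fun n => |w| * smoothSignDeriv n w) atTop (𝓝 0) := by
  rcases eq_or_ne w 0 with rfl | hw
  · simp
  have hp0 := Real.pi_pos
  have h1 : Tendsto (fun n : ℕ => (n : ℝ) * |w|) atTop atTop :=
    tendsto_natCast_atTop_atTop.atTop_mul_const (abs_pos.2 hw)
  have h2 := (tendsto_inv_atTop_zero.comp h1).const_mul (2 / Real.pi)
  rw [mul_zero] at h2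
  refine squeeze_zero' (Eventually.of_forall fun n =>
    mul_nonneg (abs_nonneg w) (smoothSignDeriv_nonneg n w)) ?_ h2
  filter_upwards [eventually_gt_atTop 0] with n hn
  have hn' : (0 : ℝ) < n := Nat.cast_pos.2 hn
  have hw' := abs_pos.2 hw
  simp only [Function.comp, smoothSignDeriv]
  rw [show |w| * (2 / Real.pi * (n / (1 + (n * w) ^ 2)))
    = 2 / Real.pi * (n * |w| / (1 + (n * w) ^ 2)) by ring]
  gcongr
  rw [div_le_iff₀ (by positivity), mul_pow, ← sq_abs w]
  field_simp
  nlinarith [mul_pos hn' hw']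

theorem measurable_sign : Measurable Real.sign := by
  unfold Real.sign
  exact Measurable.ite measurableSet_Iio measurable_const
    (Measurable.ite measurableSet_Ioi measurable_const measurable_const)

theorem abs_sign_le_one (w : ℝ) : |Real.sign w| ≤ 1 := by
  rcases Real.sign_apply_eq w with h | h | h <;> simp [h]

theorem sign_mul_le_abs (a b : ℝ) : Real.sign a * b ≤ |b| := by
  calc Real.sign a * b ≤ |Real.sign a * b| := le_abs_self _
    _ = |Real.sign a| * |b| := abs_mul _ _
    _ ≤ 1 * |b| := by gcongr; exact abs_sign_le_one a
    _ = |b| := one_mul _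

theorem sign_mul_self_eq_abs (a : ℝ) : Real.sign a * a = |a| := by
  rcases lt_trichotomy a 0 with h | h | h
  · rw [Real.sign_of_neg h, abs_of_neg h]; ring
  · simp [h]
  · rw [Real.sign_of_pos h, abs_of_pos h]; ring

theorem partialDeriv_mul {d : ℕ} {g h : Space d → ℝ} (hg : ContDiff ℝ 1 g) (hh : ContDiff ℝ 1 h)
    (j : Fin d) (x : Space d) : partialDeriv j (fun y => g y * h y) x
      = partialDeriv j g x * h x + g x * partialDeriv j h x := by
  unfold partialDeriv
  rw [fderiv_fun_mul (hg.differentiable one_ne_zero x) (hh.differentiable one_ne_zero x)]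
  simp; ring

theorem partialDeriv_comp {d : ℕ} {g : Space d → ℝ} {S : ℝ → ℝ} {s : ℝ} (hg : ContDiff ℝ 1 g)
    (j : Fin d) (x : Space d) (hS : HasDerivAt S s (g x)) :
    partialDeriv j (fun y => S (g y)) x = s * partialDeriv j g x := by
  unfold partialDeriv
  have h := hS.comp_hasFDerivAt x (hg.differentiable one_ne_zero x).hasFDerivAt
  rw [show (fun y => S (g y)) = S ∘ g from rfl, h.fderiv]
  simp

theorem CellPeriodic.mul {d : ℕ} {g h : Space d → ℝ} (hg : CellPeriodic g) (hh : CellPeriodic h) :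
    CellPeriodic fun x => g x * h x := fun j x => by simp only [hg j x, hh j x]

theorem CellPeriodic.comp {d : ℕ} {g : Space d → ℝ} (hg : CellPeriodic g) (S : ℝ → ℝ) :
    CellPeriodic fun x => S (g x) := fun j x => by simp only [hg j x]

/-- Integration by parts against `smoothSign n (g)`. -/
theorem integral_smoothSign_mul_partialDeriv {d : ℕ} {g F ψ : Space d → ℝ}
    (hg : ContDiff ℝ 1 g) (hF : ContDiff ℝ 1 F) (hψ : ContDiff ℝ 1 ψ)
    (pg : CellPeriodic g) (pF : CellPeriodic F) (pψ : CellPeriodic ψ) (j : Fin d) (n : ℕ) :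
    ∫ x in cell d, smoothSign n (g x) * partialDeriv j F x * ψ x
      = -(∫ x in cell d, smoothSignDeriv n (g x) * partialDeriv j g x * F x * ψ x)
        - ∫ x in cell d, smoothSign n (g x) * F x * partialDeriv j ψ x := by
  have hs : ContDiff ℝ 1 fun x => smoothSign n (g x) := (contDiff_smoothSign n).comp hg
  have ps : CellPeriodic fun x => smoothSign n (g x) := pg.comp _
  have cs' : Continuous fun x => smoothSignDeriv n (g x) :=
    (continuous_smoothSignDeriv n).comp hg.continuous
  have h0 := integral_partialDeriv_eq_zero ((hs.mul hF).mul hψ) ((ps.mul pF).mul pψ) j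
  have h1 : ∀ x, partialDeriv j (fun x => smoothSign n (g x) * F x * ψ x) x
      = smoothSignDeriv n (g x) * partialDeriv j g x * F x * ψ x
        + smoothSign n (g x) * partialDeriv j F x * ψ x
        + smoothSign n (g x) * F x * partialDeriv j ψ x := by
    intro x
    rw [partialDeriv_mul (hs.mul hF) hψ, partialDeriv_mul hs hF,
      partialDeriv_comp hg j x (hasDerivAt_smoothSign n (g x))]
    ring
  have i1 : Integrable (fun x => smoothSignDeriv n (g x) * partialDeriv j g x * F x * ψ x)
      (volume.restrict (cell d)) := integrable_cell_of_continuous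
    (((cs'.mul (continuous_partialDeriv hg j)).mul hF.continuous).mul hψ.continuous)
    ((((pg.comp _).mul (pg.partialDeriv j)).mul pF).mul pψ)
  have i2 : Integrable (fun x => smoothSign n (g x) * partialDeriv j F x * ψ x)
      (volume.restrict (cell d)) := integrable_cell_of_continuous
    ((hs.continuous.mul (continuous_partialDeriv hF j)).mul hψ.continuous)
    ((ps.mul (pF.partialDeriv j)).mul pψ)
  have i3 : Integrable (fun x => smoothSign n (g x) * F x * partialDeriv j ψ x)
      (volume.restrict (cell d)) := integrable_cell_of_continuous
    ((hs.continuous.mul hF.continuous).mul (continuous_partialDeriv hψ j))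
    ((ps.mul pF).mul (pψ.partialDeriv j))
  rw [integral_congr_ae (ae_of_all _ h1), integral_add (by exact i1.add i2) i3, integral_add i1 i2] at h0
  linarith

/-- Dominated convergence of `smoothSign n (g)` against a bounded continuous periodic weight. -/
theorem tendsto_integral_smoothSign {d : ℕ} {g H : Space d → ℝ}
    (cg : Continuous g) (cH : Continuous H) (pH : CellPeriodic H) :
    Tendsto (fun n => ∫ x in cell d, smoothSign n (g x) * H x) atTop
      (𝓝 (∫ x in cell d, Real.sign (g x) * H x)) := by
  obtain ⟨C, hC⟩ := exists_bound_of_periodic pH cH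
  refine tendsto_integral_of_dominated_convergence (fun _ => C)
    (fun n => ((((contDiff_smoothSign n (m := 0)).continuous).comp cg).mul cH).aestronglyMeasurable)
    (integrable_const C) (fun n => ae_of_all _ fun x => ?_)
    (ae_of_all _ fun x => (tendsto_smoothSign (g x)).mul_const _)
  rw [norm_mul]
  calc ‖smoothSign n (g x)‖ * ‖H x‖ ≤ 1 * C :=
        mul_le_mul (abs_smoothSign_le n _) (hC x) (norm_nonneg _) zero_le_one
    _ = C := one_mul C

/-- Integration by parts against `sgn(g)` for a flux vanishing where `g` does. -/
theorem integral_sign_mul_partialDeriv {d : ℕ} {g F ψ : Space d → ℝ}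
    (hg : ContDiff ℝ 1 g) (hF : ContDiff ℝ 1 F) (hψ : ContDiff ℝ 1 ψ)
    (pg : CellPeriodic g) (pF : CellPeriodic F) (pψ : CellPeriodic ψ)
    {K : ℝ} (hK : ∀ x, |F x| ≤ K * |g x|) (j : Fin d) :
    ∫ x in cell d, Real.sign (g x) * partialDeriv j F x * ψ x
      = -∫ x in cell d, Real.sign (g x) * F x * partialDeriv j ψ x := by
  have l1 := tendsto_integral_smoothSign (H := fun x => partialDeriv j F x * ψ x) hg.continuous
    ((continuous_partialDeriv hF j).mul hψ.continuous) ((pF.partialDeriv j).mul pψ)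
  have l2 := tendsto_integral_smoothSign (H := fun x => F x * partialDeriv j ψ x) hg.continuous
    (hF.continuous.mul (continuous_partialDeriv hψ j)) (pF.mul (pψ.partialDeriv j))
  obtain ⟨C, hC⟩ := exists_bound_of_periodic ((pg.partialDeriv j).mul pψ)
    ((continuous_partialDeriv hg j).mul hψ.continuous)
  -- The bound `|F| ≤ K|g|` supplies the factor `|g|` that compensates the concentration of
  -- `smoothSignDeriv n (g)`.
  have hb : ∀ n x, ‖smoothSignDeriv n (g x) * partialDeriv j g x * F x * ψ x‖
      ≤ |K| * C * (|g x| * smoothSignDeriv n (g x)) := by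
    intro n x
    have h1 : |F x| ≤ |K| * |g x| := (hK x).trans (by gcongr; exact le_abs_self K)
    have h2 := hC x
    have h3 := smoothSignDeriv_nonneg n (g x)
    rw [show smoothSignDeriv n (g x) * partialDeriv j g x * F x * ψ x
      = smoothSignDeriv n (g x) * F x * (partialDeriv j g x * ψ x) by ring, norm_mul, norm_mul,
      Real.norm_of_nonneg h3]
    calc smoothSignDeriv n (g x) * ‖F x‖ * ‖partialDeriv j g x * ψ x‖
        ≤ smoothSignDeriv n (g x) * (|K| * |g x|) * C := by
          gcongr; exact h1
      _ = _ := by ring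
  have hC0 : 0 ≤ C := (norm_nonneg _).trans (hC 0)
  have l3 : Tendsto (fun n => ∫ x in cell d,
      smoothSignDeriv n (g x) * partialDeriv j g x * F x * ψ x) atTop (𝓝 (∫ _x in cell d, (0 : ℝ))) := by
    refine tendsto_integral_of_dominated_convergence (fun _ => |K| * C)
      (fun n => (((((continuous_smoothSignDeriv n).comp hg.continuous).mul
        (continuous_partialDeriv hg j)).mul hF.continuous).mul
          hψ.continuous).aestronglyMeasurable) (integrable_const _)
      (fun n => ae_of_all _ fun x => ?_) (ae_of_all _ fun x => ?_)
    · refine (hb n x).trans ?_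
      have := abs_mul_smoothSignDeriv_le n (g x)
      exact mul_le_of_le_one_right (by positivity) this
    · refine squeeze_zero_norm (fun n => hb n x) ?_
      simpa using (tendsto_abs_mul_smoothSignDeriv (g x)).const_mul (|K| * C)
  have l4 := (l3.neg.sub l2)
  simp only [← mul_assoc] at l1 l4
  have := tendsto_nhds_unique l1 (l4.congr fun n =>
    (integral_smoothSign_mul_partialDeriv hg hF hψ pg pF pψ j n).symm)
  simpa using this

/-- Kato's inequality, tested with a nonnegative weight. -/
theorem integral_sign_mul_partialDeriv_partialDeriv_le {d : ℕ} {g ψ : Space d → ℝ}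
    (hg : ContDiff ℝ 1 g) (hψ : ContDiff ℝ 1 ψ) (j : Fin d)
    (hg' : ContDiff ℝ 1 (partialDeriv j g))
    (pg : CellPeriodic g) (pψ : CellPeriodic ψ) (h0 : ∀ x, 0 ≤ ψ x) :
    ∫ x in cell d, Real.sign (g x) * partialDeriv j (partialDeriv j g) x * ψ x
      ≤ ∫ x in cell d, |partialDeriv j g x| * |partialDeriv j ψ x| := by
  have l1 := tendsto_integral_smoothSign (H := fun x => partialDeriv j (partialDeriv j g) x * ψ x)
    hg.continuous ((continuous_partialDeriv hg' j).mul hψ.continuous)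
    (((pg.partialDeriv j).partialDeriv j).mul pψ)
  simp only [← mul_assoc] at l1
  refine le_of_tendsto l1 (Eventually.of_forall fun n => ?_)
  have cs : Continuous fun x => smoothSign n (g x) :=
    ((contDiff_smoothSign n (m := 0)).continuous).comp hg.continuous
  have i0 : Integrable (fun x => |partialDeriv j g x| * |partialDeriv j ψ x|)
      (volume.restrict (cell d)) := integrable_cell_of_continuous
    ((continuous_partialDeriv hg j).abs.mul (continuous_partialDeriv hψ j).abs)
    (((pg.partialDeriv j).comp _).mul ((pψ.partialDeriv j).comp _))
  rw [integral_smoothSign_mul_partialDeriv hg hg' hψ pg (pg.partialDeriv j) pψ j n]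
  -- The dissipation `sgn_n'(g) (∂_j g)² ψ` has a good sign and is dropped. The cross term is kept
  -- as a product of first derivatives, so that the second derivative falls on neither factor.
  have h1 : 0 ≤ ∫ x in cell d, smoothSignDeriv n (g x) * partialDeriv j g x * partialDeriv j g x
      * ψ x := integral_nonneg fun x => by
    have := smoothSignDeriv_nonneg n (g x)
    have := h0 x
    simp only [Pi.zero_apply]
    rw [mul_assoc (smoothSignDeriv n (g x))]
    have := mul_self_nonneg (partialDeriv j g x)
    positivity
  have h2 : -(∫ x in cell d, smoothSign n (g x) * partialDeriv j g x * partialDeriv j ψ x)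
      ≤ ∫ x in cell d, |partialDeriv j g x| * |partialDeriv j ψ x| := by
    have i1 : Integrable (fun x => smoothSign n (g x) * partialDeriv j g x * partialDeriv j ψ x)
        (volume.restrict (cell d)) := integrable_cell_of_continuous
      ((cs.mul (continuous_partialDeriv hg j)).mul (continuous_partialDeriv hψ j))
      (((pg.comp _).mul (pg.partialDeriv j)).mul (pψ.partialDeriv j))
    rw [← integral_neg]
    refine integral_mono i1.neg i0 fun x => (neg_le_abs _).trans ?_
    rw [abs_mul, abs_mul, mul_assoc]
    exact mul_le_of_le_one_left (by positivity) (abs_smoothSign_le n _)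
  linarith

/-! ### The Lévy operator -/

/-- The truncated second moment `∫_{0 < |z| ≤ r} |z|² dμ(z)`. -/
noncomputable def levyMoment {d : ℕ} (μ : Measure (Space d)) (r : ℝ) : ℝ :=
  ∫ z in {z | 0 < ‖z‖ ∧ ‖z‖ ≤ r}, ‖z‖ ^ 2 ∂μ

theorem measurableSet_small {d : ℕ} (r : ℝ) :
    MeasurableSet {z : Space d | 0 < ‖z‖ ∧ ‖z‖ ≤ r} :=
  (measurableSet_lt measurable_const measurable_norm).inter
    (measurableSet_le measurable_norm measurable_const)

theorem measurableSet_large {d : ℕ} (r : ℝ) : MeasurableSet {z : Space d | r < ‖z‖} :=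
  measurableSet_lt measurable_const measurable_norm

theorem IsLevyMeasure.integrable_min_real {d : ℕ} {μ : Measure (Space d)} (hμ : IsLevyMeasure μ) :
    Integrable (fun z : Space d => min (‖z‖ ^ 2) 1) μ := by
  refine ⟨(by fun_prop : Continuous fun z : Space d => min (‖z‖ ^ 2) 1).aestronglyMeasurable, ?_⟩
  rw [hasFiniteIntegral_iff_ofReal (ae_of_all _ fun z => by positivity)]
  exact hμ.integrable_min

theorem IsLevyMeasure.integrableOn_sq {d : ℕ} {μ : Measure (Space d)} (hμ : IsLevyMeasure μ)
    {r : ℝ} (hr : r ≤ 1) : IntegrableOn (fun z : Space d => ‖z‖ ^ 2) {z | 0 < ‖z‖ ∧ ‖z‖ ≤ r} μ := by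
  refine (hμ.integrable_min_real.integrableOn).congr_fun (fun z hz => ?_) (measurableSet_small r)
  simp only
  rw [min_eq_left]
  have := hz.2.trans hr
  exact pow_le_one₀ (norm_nonneg z) this

theorem IsLevyMeasure.isFiniteMeasure_large {d : ℕ} {μ : Measure (Space d)}
    (hμ : IsLevyMeasure μ) {r : ℝ} (hr : 0 < r) :
    IsFiniteMeasure (μ.restrict {z | r < ‖z‖}) := by
  refine ⟨?_⟩
  rw [Measure.restrict_apply_univ]
  have h := hμ.integrable_min_real.measure_ge_lt_top (ε := min (r ^ 2) 1) (by positivity)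
  refine (measure_mono fun z hz => ?_).trans_lt h
  have hz' : r < ‖z‖ := hz
  simp only [mem_ofPred_eq]
  gcongr

theorem levyMoment_nonneg {d : ℕ} (μ : Measure (Space d)) (r : ℝ) : 0 ≤ levyMoment μ r :=
  integral_nonneg fun z => by positivity

/-- The punctured balls decrease to the empty set. The radii `1/(n+2)` are all less than one, as
required by the splitting of the Lévy operator. -/
theorem IsLevyMeasure.tendsto_levyMoment {d : ℕ} {μ : Measure (Space d)} (hμ : IsLevyMeasure μ) :
    Tendsto (fun n : ℕ => levyMoment μ (1 / ((n : ℝ) + 2))) atTop (𝓝 0) := by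
  have hmono : Antitone fun n : ℕ => {z : Space d | 0 < ‖z‖ ∧ ‖z‖ ≤ 1 / ((n : ℝ) + 2)} := by
    intro m n hmn z hz
    refine ⟨hz.1, hz.2.trans ?_⟩
    gcongr
  have h := tendsto_setIntegral_of_antitone (μ := μ) (f := fun z : Space d => ‖z‖ ^ 2)
    (fun n : ℕ => measurableSet_small (1 / ((n : ℝ) + 2))) hmono
    ⟨0, hμ.integrableOn_sq (by norm_num)⟩
  have he : (⋂ n : ℕ, {z : Space d | 0 < ‖z‖ ∧ ‖z‖ ≤ 1 / ((n : ℝ) + 2)}) = ∅ := by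
    refine eq_empty_of_forall_notMem fun z hz => ?_
    rw [mem_iInter] at hz
    have h0 := (hz 0).1
    obtain ⟨n, hn⟩ := exists_nat_one_div_lt h0
    have h1 := (hz n).2
    have h2 : 1 / ((n : ℝ) + 2) ≤ 1 / ((n : ℝ) + 1) := by gcongr; norm_num
    linarith
  rw [he] at h
  simpa [levyMoment] using h

/-- `V` has a quadratic first-order Taylor remainder with constant `A`. -/
def TaylorBound {d : ℕ} (A : ℝ) (V : Space d → ℝ) : Prop :=
  ∀ y z, |V (y + z) - V y - fderiv ℝ V y z| ≤ A * ‖z‖ ^ 2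

/-- The mean value inequality is used twice, first for the derivative and then for the remainder;
this loses the usual factor `1/2`, which is immaterial. -/
theorem taylorBound_of_fderiv_two {d : ℕ} {V : Space d → ℝ} (hV : ContDiff ℝ 2 V) {A : ℝ}
    (hA : ∀ x, ‖fderiv ℝ (fderiv ℝ V) x‖ ≤ A) : TaylorBound A V := by
  intro y z
  have hA0 : 0 ≤ A := le_trans (norm_nonneg (fderiv ℝ (fderiv ℝ V) 0)) (hA 0)
  have hd : Differentiable ℝ (fderiv ℝ V) :=
    (hV.fderiv_right (m := 1) (by norm_num)).differentiable one_ne_zero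
  have hlip : ∀ w, ‖fderiv ℝ V (y + w) - fderiv ℝ V y‖ ≤ A * ‖w‖ := by
    intro w
    have := Convex.norm_image_sub_le_of_norm_fderiv_le (𝕜 := ℝ) (f := fderiv ℝ V) (s := univ)
      (x := y) (y := y + w) (fun x _ => hd x) (fun x _ => hA x) convex_univ trivial trivial
    simpa using this
  have hg : ∀ w, HasFDerivAt (fun w => V (y + w) - fderiv ℝ V y w)
      (fderiv ℝ V (y + w) - fderiv ℝ V y) w := by
    intro w
    have h1 : HasFDerivAt (fun w => V (y + w)) (fderiv ℝ V (y + w)) w := by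
      have := (hV.differentiable two_ne_zero (y + w)).hasFDerivAt
      exact (hasFDerivAt_comp_add_left y).2 this
    exact h1.sub (fderiv ℝ V y).hasFDerivAt
  have h := Convex.norm_image_sub_le_of_norm_hasFDerivWithin_le (𝕜 := ℝ)
    (f := fun w => V (y + w) - fderiv ℝ V y w) (s := Metric.closedBall (0 : Space d) ‖z‖)
    (C := A * ‖z‖) (x := 0) (y := z) (fun w _ => (hg w).hasFDerivWithinAt)
    (fun w hw => (hlip w).trans (by
      have : ‖w‖ ≤ ‖z‖ := by simpa using hw
      gcongr)) (convex_closedBall _ _) (by simp) (by simp)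
  have e : V (y + z) - V y - fderiv ℝ V y z
      = (V (y + z) - fderiv ℝ V y z) - (V (y + 0) - fderiv ℝ V y 0) := by simp; ring
  rw [e]
  refine h.trans (le_of_eq ?_)
  simp; ring

/-- The part of `levy` over jumps of size at most `r`. -/
noncomputable def levySmall {d : ℕ} (μ : Measure (Space d)) (r : ℝ) (V : Space d → ℝ)
    (y : Space d) : ℝ :=
  ∫ z in {z | 0 < ‖z‖ ∧ ‖z‖ ≤ r}, (V (y + z) - V y - fderiv ℝ V y z) ∂μ

/-- Since the viscous solution and the kernel are smooth, the small jumps need no sign argument: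
their size tends to zero with `r`. -/
theorem IsLevyMeasure.abs_levySmall_le {d : ℕ} {μ : Measure (Space d)} (hμ : IsLevyMeasure μ)
    {V : Space d → ℝ} {A : ℝ} (hA : TaylorBound A V) {r : ℝ} (hr : r ≤ 1) (y : Space d) :
    |levySmall μ r V y| ≤ A * levyMoment μ r := by
  have h := norm_integral_le_of_norm_le ((hμ.integrableOn_sq hr).const_mul A)
    (f := fun z => V (y + z) - V y - fderiv ℝ V y z) (ae_of_all _ fun z => hA y z)
  rw [integral_const_mul] at h
  exact h

theorem levyAdjointSmall_eq {d : ℕ} (μ : Measure (Space d)) {r : ℝ} (hr : r < 1)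
    (φ : Space d → ℝ) (x : Space d) : levyAdjointSmall μ r φ x
      = ∫ z in {z | 0 < ‖z‖ ∧ ‖z‖ ≤ r}, (φ (x + -z) - φ x - fderiv ℝ φ x (-z)) ∂μ := by
  refine setIntegral_congr_fun (measurableSet_small r) fun z hz => ?_
  have : ‖z‖ < 1 := hz.2.trans_lt hr
  simp [compensator, this, sub_eq_add_neg]

theorem IsLevyMeasure.abs_levyAdjointSmall_le {d : ℕ} {μ : Measure (Space d)}
    (hμ : IsLevyMeasure μ) {φ : Space d → ℝ} {A : ℝ} (hA : TaylorBound A φ) {r : ℝ} (hr : r < 1)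
    (x : Space d) : |levyAdjointSmall μ r φ x| ≤ A * levyMoment μ r := by
  rw [levyAdjointSmall_eq μ hr]
  have h := norm_integral_le_of_norm_le ((hμ.integrableOn_sq hr.le).const_mul A)
    (f := fun z => φ (x + -z) - φ x - fderiv ℝ φ x (-z))
    (ae_of_all _ fun z => (hA x (-z)).trans (by rw [norm_neg]))
  rw [integral_const_mul] at h
  exact h

theorem IsLevyMeasure.continuous_levyAdjointSmall {d : ℕ} {μ : Measure (Space d)}
    (hμ : IsLevyMeasure μ) {φ : Space d → ℝ} (hφ : ContDiff ℝ 1 φ) {A : ℝ} (hA : TaylorBound A φ)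
    {r : ℝ} (hr : r < 1) : Continuous (levyAdjointSmall μ r φ) := by
  rw [show levyAdjointSmall μ r φ = _ from funext (levyAdjointSmall_eq μ hr φ)]
  have hc := hφ.continuous
  have hd := hφ.continuous_fderiv one_ne_zero
  refine continuous_of_dominated (bound := fun z => A * ‖z‖ ^ 2) (fun x => ?_)
    (fun x => ae_of_all _ fun z => (hA x (-z)).trans (by rw [norm_neg]))
    ((hμ.integrableOn_sq hr.le).const_mul A) (ae_of_all _ fun z => by fun_prop)
  exact (by fun_prop : Continuous fun z => φ (x + -z) - φ x
    - fderiv ℝ φ x (-z)).aestronglyMeasurable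

theorem levyAdjointSmall_mul_const {d : ℕ} (μ : Measure (Space d)) (r c : ℝ) (φ : Space d → ℝ)
    (hφ : Differentiable ℝ φ) (x : Space d) :
    levyAdjointSmall μ r (fun x => φ x * c) x = levyAdjointSmall μ r φ x * c := by
  unfold levyAdjointSmall
  rw [← integral_mul_const]
  congr 1
  ext z
  have : compensator (fun x => φ x * c) x z = compensator φ x z * c := by
    simp only [compensator, indicator]
    split_ifs
    · rw [fderiv_mul_const (hφ x)]; simp [mul_comm]
    · simp
  rw [this]; ring

theorem IsLevyMeasure.integrableOn_large {d : ℕ} {μ : Measure (Space d)} (hμ : IsLevyMeasure μ)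
    {V : Space d → ℝ} (hV : Measurable V) {M : ℝ} (hM : ∀ x, |V x| ≤ M) {r : ℝ} (hr : 0 < r)
    (y : Space d) : IntegrableOn (fun z => V (y + z) - V y) {z | r < ‖z‖} μ := by
  have := hμ.isFiniteMeasure_large hr
  refine Integrable.of_bound (C := M + M)
    ((hV.comp (measurable_const_add y)).sub_const _).aestronglyMeasurable (ae_of_all _ fun z => ?_)
  exact (norm_sub_le _ _).trans (add_le_add (hM _) (hM _))

theorem IsLevyMeasure.abs_levyLarge_le {d : ℕ} {μ : Measure (Space d)} (hμ : IsLevyMeasure μ)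
    {V : Space d → ℝ} {M : ℝ} (hM : ∀ x, |V x| ≤ M) {r : ℝ} (hr : 0 < r)
    (y : Space d) : |levyLarge μ r V y| ≤ (M + M) * (μ {z | r < ‖z‖}).toReal := by
  have := hμ.isFiniteMeasure_large hr
  have h := norm_integral_le_of_norm_le_const (μ := μ.restrict {z | r < ‖z‖}) (C := M + M)
    (f := fun z => V (y + z) - V y)
    (ae_of_all _ fun z => (norm_sub_le _ _).trans (add_le_add (hM _) (hM _)))
  simpa [levyLarge, Measure.real] using h

/-- Decomposition of the Lévy operator into small jumps, large jumps and drift. -/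
theorem IsLevyMeasure.levy_eq {d : ℕ} {μ : Measure (Space d)} (hμ : IsLevyMeasure μ)
    {V : Space d → ℝ} (hV : Continuous V) {A M : ℝ} (hA : TaylorBound A V)
    (hM : ∀ x, |V x| ≤ M) {r : ℝ} (h0 : 0 < r) (h1 : r < 1) (y : Space d) :
    levy μ V y = levySmall μ r V y + levyLarge μ r V y - fderiv ℝ V y (drift μ r) := by
  have hfin := hμ.isFiniteMeasure_large h0
  have hset : {z : Space d | 0 < ‖z‖} = {z | 0 < ‖z‖ ∧ ‖z‖ ≤ r} ∪ {z | r < ‖z‖} := by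
    ext z
    simp only [mem_ofPred_eq, mem_union]
    constructor
    · intro h
      rcases le_or_gt ‖z‖ r with h2 | h2
      · exact Or.inl ⟨h, h2⟩
      · exact Or.inr h2
    · rintro (h | h)
      · exact h.1
      · exact h0.trans h
  have hdisj : Disjoint {z : Space d | 0 < ‖z‖ ∧ ‖z‖ ≤ r} {z | r < ‖z‖} :=
    Set.disjoint_left.2 fun z hz hz' => absurd hz' (not_lt.2 hz.2)
  have e1 : EqOn (fun z => V (y + z) - V y - fderiv ℝ V y z)
      (fun z => V (y + z) - V y - compensator V y z) {z : Space d | 0 < ‖z‖ ∧ ‖z‖ ≤ r} := by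
    intro z hz
    have : ‖z‖ < 1 := hz.2.trans_lt h1
    simp [compensator, this]
  have i1 : IntegrableOn (fun z => V (y + z) - V y - fderiv ℝ V y z)
      {z : Space d | 0 < ‖z‖ ∧ ‖z‖ ≤ r} μ := by
    refine Integrable.mono' ((hμ.integrableOn_sq h1.le).const_mul A) ?_ (ae_of_all _ fun z => hA y z)
    exact (by fun_prop : Continuous fun z => V (y + z) - V y - fderiv ℝ V y z).aestronglyMeasurable
  have hball : MeasurableSet {w : Space d | ‖w‖ < 1} :=
    measurableSet_lt measurable_norm measurable_const
  have i3 : Integrable ({w : Space d | ‖w‖ < 1}.indicator fun w => w)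
      (μ.restrict {z | r < ‖z‖}) := by
    refine Integrable.of_bound (C := 1) (measurable_id.indicator hball).aestronglyMeasurable
      (ae_of_all _ fun z => ?_)
    by_cases hz : ‖z‖ < 1
    · simp [indicator, hz, hz.le]
    · simp [indicator, hz]
  have e3 : ∀ z, compensator V y z
      = fderiv ℝ V y ({w : Space d | ‖w‖ < 1}.indicator (fun w => w) z) := by
    intro z
    by_cases hz : ‖z‖ < 1 <;> simp [compensator, indicator, hz]
  have i2 := hμ.integrableOn_large hV.measurable hM h0 y
  have i4 : IntegrableOn (fun z => compensator V y z) {z | r < ‖z‖} μ := by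
    simp only [e3]
    exact (fderiv ℝ V y).integrable_comp i3
  -- On the large jumps the compensator no longer balances a Taylor expansion; being linear in `z`,
  -- it integrates to the derivative in the direction of the drift.
  have e4 : ∫ z in {z | r < ‖z‖}, compensator V y z ∂μ = fderiv ℝ V y (drift μ r) := by
    simp only [e3]
    rw [(fderiv ℝ V y).integral_comp_comm i3, integral_indicator hball,
      Measure.restrict_restrict hball]
    rw [show {w : Space d | ‖w‖ < 1} ∩ {z | r < ‖z‖} = {z | r < ‖z‖ ∧ ‖z‖ < 1} from
      Set.ext fun z => and_comm]
    rfl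
  unfold levy
  rw [hset, setIntegral_union hdisj (measurableSet_large r)
    (i1.congr_fun e1 (measurableSet_small r)) (i2.sub i4),
    ← setIntegral_congr_fun (measurableSet_small r) e1, integral_sub i2 i4, e4]
  unfold levySmall levyLarge
  ring

/-! ### Integrals of bounded measurable functions -/

section Bounded

variable {α β : Type*} [MeasurableSpace α] [MeasurableSpace β]

theorem integrable_of_bounded {m : Measure α} [IsFiniteMeasure m] {F : α → ℝ}
    (hF : Measurable F) {C : ℝ} (hC : ∀ a, |F a| ≤ C) : Integrable F m :=
  Integrable.of_bound hF.aestronglyMeasurable C (ae_of_all _ hC)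

theorem measurable_integral_right {n : Measure β} [SFinite n] {F : α → β → ℝ}
    (hF : Measurable (Function.uncurry F)) : Measurable fun a => ∫ b, F a b ∂n :=
  hF.stronglyMeasurable.integral_prod_right.measurable

theorem abs_integral_le_of_bounded {m : Measure α} [IsFiniteMeasure m] {F : α → ℝ}
    {C : ℝ} (hC : ∀ a, |F a| ≤ C) : |∫ a, F a ∂m| ≤ C * m.real univ := by
  rw [← Real.norm_eq_abs]
  exact norm_integral_le_of_norm_le_const (f := F) (ae_of_all _ hC)

theorem integral_swap_of_bounded {m : Measure α} [IsFiniteMeasure m] {n : Measure β}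
    [IsFiniteMeasure n] {F : α → β → ℝ} (hF : Measurable (Function.uncurry F)) {C : ℝ}
    (hC : ∀ a b, |F a b| ≤ C) : ∫ a, ∫ b, F a b ∂n ∂m = ∫ b, ∫ a, F a b ∂m ∂n :=
  integral_integral_swap (integrable_of_bounded hF fun p => hC p.1 p.2)

theorem integral_integral_mono_of_bounded {m : Measure α} [IsFiniteMeasure m] {n : Measure β}
    [IsFiniteMeasure n] {F G : α → β → ℝ} (hF : Measurable (Function.uncurry F))
    (hG : Measurable (Function.uncurry G)) {C D : ℝ} (hC : ∀ a b, |F a b| ≤ C)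
    (hD : ∀ a b, |G a b| ≤ D) (h : ∀ a b, F a b ≤ G a b) :
    ∫ a, ∫ b, F a b ∂n ∂m ≤ ∫ a, ∫ b, G a b ∂n ∂m :=
  integral_mono (integrable_of_bounded (measurable_integral_right hF)
      fun a => abs_integral_le_of_bounded (hC a))
    (integrable_of_bounded (measurable_integral_right hG)
      fun a => abs_integral_le_of_bounded (hD a)) fun a =>
    integral_mono (integrable_of_bounded (hF.comp measurable_prodMk_left) (hC a))
      (integrable_of_bounded (hG.comp measurable_prodMk_left) (hD a)) (h a)

end Bounded

/-! ### The nonlocal term in the doubled variables -/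

/-- Almost everywhere equal to a `Λ`-periodic function. -/
def AECellPeriodic {d : ℕ} (U : Space d → ℝ) : Prop :=
  ∃ U' : Space d → ℝ, CellPeriodic U' ∧ U =ᵐ[volume] U'

theorem CellPeriodic.aeCellPeriodic {d : ℕ} {U : Space d → ℝ} (hU : CellPeriodic U) :
    AECellPeriodic U := ⟨U, hU, ae_eq_rfl⟩

theorem ae_add_right {d : ℕ} {P : Space d → Prop} (h : ∀ᵐ x, P x) (z : Space d) :
    ∀ᵐ x, P (x + z) :=
  (measurePreserving_add_right volume z).quasiMeasurePreserving.ae h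

/-- With `Ω(x - y)` written as `Ω((x + z) - (y + z))`, the integrand is periodic in each variable
separately, so `x` and `y` can be translated one after the other. -/
theorem integral_abs_sub_add_add {d : ℕ} {U V Ω : Space d → ℝ} (pU : AECellPeriodic U)
    (pV : CellPeriodic V) (pΩ : CellPeriodic Ω) (z : Space d) :
    ∫ x in cell d, ∫ y in cell d, |U (x + z) - V (y + z)| * Ω (x - y)
      = ∫ x in cell d, ∫ y in cell d, |U x - V y| * Ω (x - y) := by
  obtain ⟨U', pU', hUU⟩ := pU
  have e1 : ∫ x in cell d, ∫ y in cell d, |U (x + z) - V (y + z)| * Ω (x - y)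
      = ∫ x in cell d, ∫ y in cell d, |U' (x + z) - V (y + z)| * Ω (x - y) := by
    refine integral_congr_ae (ae_restrict_of_ae ?_)
    filter_upwards [ae_add_right hUU z] with x hx
    rw [hx]
  have e2 : ∫ x in cell d, ∫ y in cell d, |U x - V y| * Ω (x - y)
      = ∫ x in cell d, ∫ y in cell d, |U' x - V y| * Ω (x - y) := by
    refine integral_congr_ae (ae_restrict_of_ae ?_)
    filter_upwards [hUU] with x hx
    rw [hx]
  have pG : CellPeriodic fun x => ∫ y in cell d, |U' x - V y| * Ω (x - y) := by
    intro j x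
    simp only [pU' j x]
    refine integral_congr_ae (ae_of_all _ fun y => ?_)
    simp only
    rw [add_sub_right_comm, pΩ j (x - y)]
  rw [e1, e2, ← setIntegral_cell_add pG z]
  refine integral_congr_ae (ae_of_all _ fun x => ?_)
  have pH : CellPeriodic fun y => |U' (x + z) - V y| * Ω (x + z - y) := by
    intro j y
    simp only [pV j y]
    rw [← pΩ j (x + z - (y + _))]
    congr 2; abel
  have := setIntegral_cell_add pH z
  simp only [add_sub_add_right_eq_sub] at this
  exact this

theorem measurable_levyLarge {d : ℕ} {α : Type*} [MeasurableSpace α] {μ : Measure (Space d)}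
    (hμ : IsLevyMeasure μ) {r : ℝ} (hr : 0 < r) {U : Space d → α → ℝ}
    (hU : Measurable fun p : Space d × α => U p.1 p.2) :
    Measurable fun p : Space d × α => levyLarge μ r (fun x => U x p.2) p.1 := by
  have := hμ.isFiniteMeasure_large hr
  unfold levyLarge
  refine measurable_integral_right (F := fun (p : Space d × α) z => U (p.1 + z) p.2 - U p.1 p.2) ?_
  have h1 : Measurable fun q : (Space d × α) × Space d => U (q.1.1 + q.2) q.1.2 :=
    hU.comp (f := fun q : (Space d × α) × Space d => (q.1.1 + q.2, q.1.2)) (by fun_prop)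
  exact h1.sub (hU.comp measurable_fst)

theorem IsLevyMeasure.measurable_levyLarge {d : ℕ} {μ : Measure (Space d)}
    (hμ : IsLevyMeasure μ) {r : ℝ} (hr : 0 < r) {U : Space d → ℝ} (hU : Measurable U) :
    Measurable (levyLarge μ r U) :=
  (FracCL.measurable_levyLarge (α := Unit) hμ hr (U := fun x _ => U x)
    (hU.comp measurable_fst)).comp (measurable_id.prodMk (measurable_const (a := ())))

/-- The increment of the doubled entropy along simultaneous jumps has mean zero. -/
theorem integral_abs_sub_increment_eq_zero {d : ℕ} {ν : Measure (Space d)} [IsFiniteMeasure ν]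
    {U V Ω : Space d → ℝ} (mU : Measurable U) (mV : Measurable V)
    (mΩ : Measurable Ω) (pU : AECellPeriodic U) (pV : CellPeriodic V) (pΩ : CellPeriodic Ω)
    {M N : ℝ} (hU : ∀ x, |U x| ≤ M) (hV : ∀ x, |V x| ≤ M) (hΩ : ∀ x, |Ω x| ≤ N) :
    ∫ x in cell d, ∫ y in cell d,
      ∫ z, (|U (x + z) - V (y + z)| - |U x - V y|) * Ω (x - y) ∂ν = 0 := by
  have hM : 0 ≤ M := (abs_nonneg _).trans (hU 0)
  have hN : 0 ≤ N := (abs_nonneg _).trans (hΩ 0)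
  set H : Space d → Space d → Space d → ℝ := fun x y z =>
    (|U (x + z) - V (y + z)| - |U x - V y|) * Ω (x - y) with hH
  have mH : Measurable fun p : Space d × Space d × Space d => H p.1 p.2.1 p.2.2 := by
    simp only [hH]
    have m1 : Measurable fun p : Space d × Space d × Space d => U (p.1 + p.2.2) :=
      mU.comp (by fun_prop)
    have m2 : Measurable fun p : Space d × Space d × Space d => V (p.2.1 + p.2.2) :=
      mV.comp (by fun_prop)
    have m3 : Measurable fun p : Space d × Space d × Space d => U p.1 := mU.comp (by fun_prop)
    have m4 : Measurable fun p : Space d × Space d × Space d => V p.2.1 := mV.comp (by fun_prop)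
    have m5 : Measurable fun p : Space d × Space d × Space d => Ω (p.1 - p.2.1) :=
      mΩ.comp (by fun_prop)
    exact ((m1.sub m2).abs.sub (m3.sub m4).abs).mul m5
  have bd : ∀ x y, |U x - V y| ≤ 2 * M := fun x y => by
    have := abs_sub (U x) (V y); linarith [hU x, hV y]
  have bH : ∀ x y z, |H x y z| ≤ 4 * M * N := by
    intro x y z
    simp only [hH, abs_mul]
    refine mul_le_mul ?_ (hΩ _) (abs_nonneg _) (by positivity)
    refine (abs_sub _ _).trans ?_
    rw [abs_abs, abs_abs]
    linarith [bd (x + z) (y + z), bd x y]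
  change ∫ x in cell d, ∫ y in cell d, ∫ z, H x y z ∂ν = 0
  -- Fubini, legitimate for a finite jump measure and a bounded integrand, makes `z` the outermost
  -- variable; the claim then holds for each `z` by translation invariance.
  have s1 : ∀ x, ∫ y in cell d, ∫ z, H x y z ∂ν = ∫ z, (∫ y in cell d, H x y z) ∂ν := fun x =>
    integral_swap_of_bounded (m := volume.restrict (cell d)) (n := ν) (F := fun y z => H x y z)
      (mH.comp (f := fun q : Space d × Space d => (x, q.1, q.2)) (by fun_prop)) (bH x)
  simp only [s1]
  rw [integral_swap_of_bounded (m := volume.restrict (cell d)) (n := ν) (F := fun x z => ∫ y in cell d, H x y z)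
    (C := 4 * M * N * (volume.restrict (cell d)).real univ) ?_
    fun x z => abs_integral_le_of_bounded fun y => bH x y z]
  · rw [← integral_zero (Space d) ℝ (μ := ν)]
    congr 1
    funext z
    have m6 : Measurable fun q : Space d × Space d => |U q.1 - V q.2| * Ω (q.1 - q.2) :=
      (((mU.comp measurable_fst).sub (mV.comp measurable_snd)).abs).mul
        (mΩ.comp (by fun_prop))
    have m7 : Measurable fun q : Space d × Space d =>
        |U (q.1 + z) - V (q.2 + z)| * Ω (q.1 - q.2) :=
      (((mU.comp (by fun_prop)).sub (mV.comp (by fun_prop))).abs).mul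
        (mΩ.comp (by fun_prop))
    have b6 : ∀ x y w, |(|U (x + w) - V (y + w)| * Ω (x - y))| ≤ 2 * M * N := fun x y w => by
      rw [abs_mul, abs_abs]
      exact mul_le_mul (bd _ _) (hΩ _) (abs_nonneg _) (by positivity)
    have b6' : ∀ x y, |(|U x - V y| * Ω (x - y))| ≤ 2 * M * N := fun x y => by
      rw [abs_mul, abs_abs]
      exact mul_le_mul (bd _ _) (hΩ _) (abs_nonneg _) (by positivity)
    simp only [hH, sub_mul]
    have e1 : ∀ x, ∫ y in cell d, (|U (x + z) - V (y + z)| * Ω (x - y) - |U x - V y| * Ω (x - y))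
        = (∫ y in cell d, |U (x + z) - V (y + z)| * Ω (x - y))
          - ∫ y in cell d, |U x - V y| * Ω (x - y) := fun x =>
      integral_sub (integrable_of_bounded (m7.comp (measurable_const.prodMk measurable_id))
          fun y => b6 x y z)
        (integrable_of_bounded (m6.comp (measurable_const.prodMk measurable_id)) fun y => b6' x y)
    simp only [e1]
    rw [integral_sub, integral_abs_sub_add_add pU pV pΩ z, sub_self]
    · exact integrable_of_bounded (measurable_integral_right (F := fun x y =>
        |U (x + z) - V (y + z)| * Ω (x - y)) m7)
        fun x => abs_integral_le_of_bounded fun y => b6 x y z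
    · exact integrable_of_bounded (measurable_integral_right (F := fun x y =>
        |U x - V y| * Ω (x - y)) m6) fun x => abs_integral_le_of_bounded fun y => b6' x y
  · exact measurable_integral_right (F := fun (q : Space d × Space d) y => H q.1 y q.2)
      (mH.comp (f := fun q : (Space d × Space d) × Space d => (q.1.1, q.2, q.1.2)) (by fun_prop))

/-- This is convexity of the modulus: `sgn(a) a' ≤ |a'|`, with equality for `a' = a`, applied to `a
= U x - V y` and to its value after a simultaneous jump. -/
theorem IsLevyMeasure.sign_mul_levyLarge_sub_mul_le {d : ℕ} {μ : Measure (Space d)}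
    (hμ : IsLevyMeasure μ) {U V : Space d → ℝ} (mU : Measurable U) (mV : Measurable V)
    {M w : ℝ} (hU : ∀ x, |U x| ≤ M) (hV : ∀ x, |V x| ≤ M) (h0 : 0 ≤ w) {r : ℝ} (hr : 0 < r)
    (x y : Space d) :
    Real.sign (U x - V y) * (levyLarge μ r U x - levyLarge μ r V y) * w
      ≤ ∫ z in {z | r < ‖z‖}, (|U (x + z) - V (y + z)| - |U x - V y|) * w ∂μ := by
  have hfin := hμ.isFiniteMeasure_large hr
  rw [integral_mul_const]
  refine mul_le_mul_of_nonneg_right ?_ h0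
  have iU := hμ.integrableOn_large mU hU hr x
  have iV := hμ.integrableOn_large mV hV hr y
  have bd : ∀ x y, |U x - V y| ≤ 2 * M := fun x y => by
    have := abs_sub (U x) (V y); linarith [hU x, hV y]
  have : levyLarge μ r U x - levyLarge μ r V y
      = ∫ z in {z | r < ‖z‖}, ((U (x + z) - U x) - (V (y + z) - V y)) ∂μ :=
    (integral_sub iU iV).symm
  rw [this, ← integral_const_mul]
  refine integral_mono ((iU.sub iV).const_mul _)
    (integrable_of_bounded (C := 4 * M) ?_ fun z => ?_) fun z => ?_
  · exact ((mU.comp (measurable_const_add x)).sub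
      (mV.comp (measurable_const_add y))).abs.sub_const _
  · refine (abs_sub _ _).trans ?_
    rw [abs_abs, abs_abs]
    linarith [bd (x + z) (y + z), bd x y]
  · have h1 := sign_mul_le_abs (U x - V y) (U (x + z) - V (y + z))
    have h2 := sign_mul_self_eq_abs (U x - V y)
    simp only
    have h3 : Real.sign (U x - V y) * (U (x + z) - U x - (V (y + z) - V y))
      = Real.sign (U x - V y) * (U (x + z) - V (y + z)) - Real.sign (U x - V y) * (U x - V y) := by
      ring
    rw [h3, h2]
    linarith

/-- The large-jump operator is dissipative in the doubled variables. -/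
theorem IsLevyMeasure.integral_sign_mul_levyLarge_sub_le {d : ℕ} {μ : Measure (Space d)}
    (hμ : IsLevyMeasure μ) {U V Ω : Space d → ℝ} (mU : Measurable U) (mV : Measurable V)
    (mΩ : Measurable Ω) (pU : AECellPeriodic U) (pV : CellPeriodic V) (pΩ : CellPeriodic Ω)
    {M N : ℝ} (hU : ∀ x, |U x| ≤ M) (hV : ∀ x, |V x| ≤ M) (hΩ : ∀ x, |Ω x| ≤ N)
    (h0 : ∀ x, 0 ≤ Ω x) {r : ℝ} (hr : 0 < r) :
    ∫ x in cell d, ∫ y in cell d,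
      Real.sign (U x - V y) * (levyLarge μ r U x - levyLarge μ r V y) * Ω (x - y) ≤ 0 := by
  have hfin := hμ.isFiniteMeasure_large hr
  have hM : 0 ≤ M := (abs_nonneg _).trans (hU 0)
  have hN : 0 ≤ N := (h0 0).trans ((le_abs_self _).trans (hΩ 0))
  rw [← integral_abs_sub_increment_eq_zero (ν := μ.restrict {z | r < ‖z‖}) mU mV mΩ pU pV pΩ
    hU hV hΩ]
  have bd : ∀ x y, |U x - V y| ≤ 2 * M := fun x y => by
    have := abs_sub (U x) (V y); linarith [hU x, hV y]
  have mLU := hμ.measurable_levyLarge hr mU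
  have mLV := hμ.measurable_levyLarge hr mV
  have m5 : Measurable fun p : Space d × Space d => Ω (p.1 - p.2) :=
    mΩ.comp (measurable_fst.sub measurable_snd)
  have m6 : Measurable fun p : Space d × Space d => U p.1 - V p.2 :=
    (mU.comp measurable_fst).sub (mV.comp measurable_snd)
  have m7 : Measurable fun p : (Space d × Space d) × Space d =>
      U (p.1.1 + p.2) - V (p.1.2 + p.2) :=
    m6.comp (f := fun p : (Space d × Space d) × Space d => (p.1.1 + p.2, p.1.2 + p.2))
      (((measurable_fst.comp measurable_fst).add measurable_snd).prodMk
        ((measurable_snd.comp measurable_fst).add measurable_snd))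
  refine integral_integral_mono_of_bounded
    (C := 2 * ((M + M) * (μ {z | r < ‖z‖}).toReal) * N)
    (D := 4 * M * N * (μ.restrict {z | r < ‖z‖}).real univ) ?_ ?_ ?_ ?_
    fun x y => hμ.sign_mul_levyLarge_sub_mul_le mU mV hU hV (h0 _) hr x y
  · exact ((measurable_sign.comp m6).mul
      ((mLU.comp measurable_fst).sub (mLV.comp measurable_snd))).mul m5
  · exact measurable_integral_right (F := fun (p : Space d × Space d) z =>
      (|U (p.1 + z) - V (p.2 + z)| - |U p.1 - V p.2|) * Ω (p.1 - p.2))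
      ((m7.abs.sub (m6.comp measurable_fst).abs).mul (m5.comp measurable_fst))
  · intro x y
    rw [abs_mul, abs_mul]
    have h1 := hμ.abs_levyLarge_le hU hr x
    have h2 := hμ.abs_levyLarge_le hV hr y
    have h3 := abs_sub (levyLarge μ r U x) (levyLarge μ r V y)
    refine mul_le_mul ?_ (hΩ _) (abs_nonneg _) (by positivity)
    calc |Real.sign (U x - V y)| * |levyLarge μ r U x - levyLarge μ r V y|
        ≤ 1 * |levyLarge μ r U x - levyLarge μ r V y| :=
          mul_le_mul_of_nonneg_right (abs_sign_le_one _) (abs_nonneg _)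
      _ ≤ _ := by linarith
  · intro x y
    refine abs_integral_le_of_bounded fun z => ?_
    rw [abs_mul]
    refine mul_le_mul ?_ (hΩ _) (abs_nonneg _) (by positivity)
    refine (abs_sub _ _).trans ?_
    rw [abs_abs, abs_abs]
    linarith [bd (x + z) (y + z), bd x y]

/-! ### The entropy inequality of classical solutions -/

theorem fderiv_eq_sum_partialDeriv {d : ℕ} (V : Space d → ℝ) (x w : Space d) :
    fderiv ℝ V x w = ∑ j, w j * partialDeriv j V x := by
  conv_lhs => rw [← (EuclideanSpace.basisFun (Fin d) ℝ).sum_repr w]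
  simp [partialDeriv]

theorem contDiff_partialDeriv {d : ℕ} {V : Space d → ℝ} (hV : ContDiff ℝ 2 V) (j : Fin d) :
    ContDiff ℝ 1 (partialDeriv j V) :=
  (hV.fderiv_right (m := 1) (by norm_num)).clm_apply contDiff_const

theorem laplacian_eq_sum_partialDeriv {d : ℕ} {V : Space d → ℝ} (hV : ContDiff ℝ 2 V)
    (x : Space d) :
    Laplacian.laplacian V x = ∑ j, partialDeriv j (partialDeriv j V) x := by
  rw [InnerProductSpace.laplacian_eq_iteratedFDeriv_orthonormalBasis V
    (EuclideanSpace.basisFun (Fin d) ℝ)]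
  refine Finset.sum_congr rfl fun j _ => ?_
  have hd : DifferentiableAt ℝ (fderiv ℝ V) x :=
    (hV.fderiv_right (m := 1) (by norm_num)).differentiable one_ne_zero x
  rw [iteratedFDeriv_two_apply]
  unfold partialDeriv
  rw [fderiv_clm_apply hd (differentiableAt_const _)]
  simp

theorem partialDeriv_sub {d : ℕ} {V W : Space d → ℝ} (hV : ContDiff ℝ 1 V) (hW : ContDiff ℝ 1 W)
    (j : Fin d) (x : Space d) :
    partialDeriv j (fun y => V y - W y) x = partialDeriv j V x - partialDeriv j W x := by
  unfold partialDeriv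
  rw [fderiv_fun_sub (hV.differentiable one_ne_zero x) (hW.differentiable one_ne_zero x)]
  simp

theorem CellPeriodic.sub {d : ℕ} {g h : Space d → ℝ} (hg : CellPeriodic g) (hh : CellPeriodic h) :
    CellPeriodic fun x => g x - h x := fun j x => by simp only [hg j x, hh j x]

theorem cellPeriodic_const {d : ℕ} (c : ℝ) : CellPeriodic fun _ : Space d => c := fun _ _ => rfl

/-- A `C¹` function is Lipschitz on bounded intervals. -/
theorem exists_lipschitz_bound {f : ℝ → ℝ} (hf : ContDiff ℝ 1 f) (M : ℝ) :
    ∃ K, 0 ≤ K ∧ ∀ a b, |a| ≤ M → |b| ≤ M → |f a - f b| ≤ K * |a - b| := by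
  obtain ⟨K, hK⟩ := (isCompact_Icc (a := -M) (b := M)).exists_bound_of_continuousOn
    (hf.continuous_deriv le_rfl).continuousOn
  refine ⟨|K|, abs_nonneg K, fun a b ha hb => ?_⟩
  have h := Convex.norm_image_sub_le_of_norm_deriv_le (𝕜 := ℝ) (f := f) (s := Icc (-M) M)
    (C := |K|) (x := b) (y := a) (fun x _ => hf.differentiable one_ne_zero x)
    (fun x hx => (hK x hx).trans (le_abs_self K)) (convex_Icc _ _) (abs_le.1 hb) (abs_le.1 ha)
  exact h

theorem IsLevyMeasure.continuous_levySmall {d : ℕ} {μ : Measure (Space d)}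
    (hμ : IsLevyMeasure μ) {φ : Space d → ℝ} (hφ : ContDiff ℝ 1 φ) {A : ℝ} (hA : TaylorBound A φ)
    {r : ℝ} (hr : r < 1) : Continuous (levySmall μ r φ) := by
  have hc := hφ.continuous
  have hd := hφ.continuous_fderiv one_ne_zero
  refine continuous_of_dominated (bound := fun z => A * ‖z‖ ^ 2) (fun x => ?_)
    (fun x => ae_of_all _ fun z => hA x z)
    ((hμ.integrableOn_sq hr.le).const_mul A) (ae_of_all _ fun z => by fun_prop)
  exact (by fun_prop : Continuous fun z => φ (x + z) - φ x
    - fderiv ℝ φ x z).aestronglyMeasurable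

/-- The right-hand side of the viscous equation, solved for the time derivative. -/
noncomputable def viscousRHS {d : ℕ} (f : Fin d → ℝ → ℝ) (μ : Measure (Space d)) (ε : ℝ)
    (V : Space d → ℝ) (y : Space d) : ℝ :=
  -divergence (fun y j => f j (V y)) y + levy μ V y + ε * Laplacian.laplacian V y

/-- Constants are stationary solutions. Comparing two right-hand sides thus covers both the `L¹`
contraction and the Kružkov entropies `|v - k|`. -/
theorem viscousRHS_const {d : ℕ} (f : Fin d → ℝ → ℝ) (μ : Measure (Space d)) (ε k : ℝ)
    (y : Space d) : viscousRHS f μ ε (fun _ => k) y = 0 := by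
  have h : ∀ c : ℝ, ∀ x : Space d, fderiv ℝ (fun _ : Space d => c) x = 0 := fun c x => by simp
  simp [viscousRHS, divergence, partialDeriv, levy, compensator, h]

theorem integrable_sign_mul {d : ℕ} {g H : Space d → ℝ} (hg : Measurable g)
    (hH : Integrable H (volume.restrict (cell d))) :
    Integrable (fun x => Real.sign (g x) * H x) (volume.restrict (cell d)) :=
  hH.bdd_mul (c := 1) (measurable_sign.comp hg).aestronglyMeasurable
    (ae_of_all _ fun x => abs_sign_le_one (g x))

theorem IsLevyMeasure.integrable_cell_levyLarge {d : ℕ} {μ : Measure (Space d)}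
    (hμ : IsLevyMeasure μ) {V : Space d → ℝ} (mV : Measurable V) {M : ℝ} (hV : ∀ x, |V x| ≤ M)
    {r : ℝ} (hr : 0 < r) : Integrable (levyLarge μ r V) (volume.restrict (cell d)) :=
  integrable_of_bounded (hμ.measurable_levyLarge hr mV) fun x => hμ.abs_levyLarge_le hV hr x

/-- The difference of two right-hand sides, tested with `sgn(V - W) ψ`. -/
theorem IsLevyMeasure.integral_sign_mul_viscousRHS_sub_le {d : ℕ} {μ : Measure (Space d)}
    (hμ : IsLevyMeasure μ) {f : Fin d → ℝ → ℝ} (hf : ∀ j, ContDiff ℝ 1 (f j)) {ε : ℝ} (hε : 0 ≤ ε)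
    {V W ψ : Space d → ℝ} (hV : ContDiff ℝ 2 V) (hW : ContDiff ℝ 2 W) (hψ : ContDiff ℝ 1 ψ)
    (pV : CellPeriodic V) (pW : CellPeriodic W) (pψ : CellPeriodic ψ) (h0 : ∀ x, 0 ≤ ψ x)
    {A A' : ℝ} (tV : TaylorBound A V) (tW : TaylorBound A' W) {r : ℝ} (r0 : 0 < r) (r1 : r < 1) :
    ∫ y in cell d, Real.sign (V y - W y) * (viscousRHS f μ ε V y - viscousRHS f μ ε W y) * ψ y
      ≤ ∑ j, (∫ y in cell d, Real.sign (V y - W y) * (f j (V y) - f j (W y)) * partialDeriv j ψ y)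
        + (∫ y in cell d, Real.sign (V y - W y) * (levyLarge μ r V y - levyLarge μ r W y) * ψ y)
        + (∫ y in cell d, |V y - W y| * fderiv ℝ ψ y (drift μ r))
        + ε * ∑ j, (∫ y in cell d, |partialDeriv j V y - partialDeriv j W y| * |partialDeriv j ψ y|)
        + (A + A') * levyMoment μ r * ∫ y in cell d, ψ y := by
  have hV1 : ContDiff ℝ 1 V := hV.of_le (by norm_num)
  have hW1 : ContDiff ℝ 1 W := hW.of_le (by norm_num)
  set g : Space d → ℝ := fun y => V y - W y with hgdef
  have hg : ContDiff ℝ 2 g := hV.sub hW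
  have hg1 : ContDiff ℝ 1 g := hV1.sub hW1
  have pg : CellPeriodic g := pV.sub pW
  have mg : Measurable g := hg.continuous.measurable
  obtain ⟨M₁, hM₁⟩ := exists_bound_of_periodic pV hV.continuous
  obtain ⟨M₂, hM₂⟩ := exists_bound_of_periodic pW hW.continuous
  set F : Fin d → Space d → ℝ := fun j y => f j (V y) - f j (W y) with hF
  have hF1 : ∀ j, ContDiff ℝ 1 (F j) := fun j => ((hf j).comp hV1).sub ((hf j).comp hW1)
  have pF : ∀ j, CellPeriodic (F j) := fun j => (pV.comp _).sub (pW.comp _)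
  have hgj : ∀ j, partialDeriv j g = fun y => partialDeriv j V y - partialDeriv j W y :=
    fun j => funext (partialDeriv_sub hV1 hW1 j)
  have iF : ∀ j, Integrable (fun y => Real.sign (g y) * partialDeriv j (F j) y * ψ y)
      (volume.restrict (cell d)) := fun j => by
    simpa only [mul_assoc] using integrable_sign_mul mg
      (H := fun y => partialDeriv j (F j) y * ψ y) (integrable_cell_of_continuous
      ((continuous_partialDeriv (hF1 j) j).mul hψ.continuous) (((pF j).partialDeriv j).mul pψ))
  have iG : ∀ j, Integrable (fun y => Real.sign (g y) * partialDeriv j g y * ψ y)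
      (volume.restrict (cell d)) := fun j => by
    simpa only [mul_assoc] using integrable_sign_mul mg
      (H := fun y => partialDeriv j g y * ψ y) (integrable_cell_of_continuous
      ((continuous_partialDeriv hg1 j).mul hψ.continuous) ((pg.partialDeriv j).mul pψ))
  have hgj1 : ∀ j, ContDiff ℝ 1 (partialDeriv j g) := contDiff_partialDeriv hg
  have iD : ∀ j, Integrable (fun y => Real.sign (g y) * partialDeriv j (partialDeriv j g) y * ψ y)
      (volume.restrict (cell d)) := fun j => by
    simpa only [mul_assoc] using integrable_sign_mul mg
      (H := fun y => partialDeriv j (partialDeriv j g) y * ψ y) (integrable_cell_of_continuous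
      ((continuous_partialDeriv (hgj1 j) j).mul hψ.continuous)
      (((pg.partialDeriv j).partialDeriv j).mul pψ))
  obtain ⟨Mψ, hMψ⟩ := exists_bound_of_periodic pψ hψ.continuous
  have iψ := integrable_cell_of_continuous hψ.continuous pψ
  have iL : Integrable (fun y => Real.sign (g y) * (levyLarge μ r V y - levyLarge μ r W y) * ψ y)
      (volume.restrict (cell d)) :=
    (integrable_sign_mul mg ((hμ.integrable_cell_levyLarge hV.continuous.measurable hM₁ r0).sub
      (hμ.integrable_cell_levyLarge hW.continuous.measurable hM₂ r0))).mul_bdd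
      hψ.continuous.aestronglyMeasurable (ae_of_all _ hMψ)
  set S : Space d → ℝ := fun y => levySmall μ r V y - levySmall μ r W y with hS
  have cS : Continuous S :=
    (hμ.continuous_levySmall hV1 tV r1).sub (hμ.continuous_levySmall hW1 tW r1)
  have bS : ∀ y, |S y| ≤ (A + A') * levyMoment μ r := fun y => by
    have h1 := hμ.abs_levySmall_le tV r1.le y
    have h2 := hμ.abs_levySmall_le tW r1.le y
    have := abs_sub (levySmall μ r V y) (levySmall μ r W y)
    simp only [hS]; linarith
  have iS : Integrable (fun y => Real.sign (g y) * S y * ψ y) (volume.restrict (cell d)) :=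
    (integrable_sign_mul mg (integrable_of_bounded cS.measurable bS)).mul_bdd
      hψ.continuous.aestronglyMeasurable (ae_of_all _ hMψ)
  -- The difference of the right-hand sides is split into flux, small jumps, large jumps, drift and
  -- viscosity, each to be treated by its own argument.
  have key : ∀ y, Real.sign (g y) * (viscousRHS f μ ε V y - viscousRHS f μ ε W y) * ψ y
      = -(∑ j, Real.sign (g y) * partialDeriv j (F j) y * ψ y) + Real.sign (g y) * S y * ψ y
        + Real.sign (g y) * (levyLarge μ r V y - levyLarge μ r W y) * ψ y
        - (∑ j, drift μ r j * (Real.sign (g y) * partialDeriv j g y * ψ y))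
        + ε * ∑ j, Real.sign (g y) * partialDeriv j (partialDeriv j g) y * ψ y := by
    intro y
    have e1 : ∀ j, partialDeriv j (F j) y
        = partialDeriv j (fun y => f j (V y)) y - partialDeriv j (fun y => f j (W y)) y := fun j =>
      partialDeriv_sub ((hf j).comp hV1) ((hf j).comp hW1) j y
    have e2 : ∀ j, partialDeriv j (partialDeriv j g) y
        = partialDeriv j (partialDeriv j V) y - partialDeriv j (partialDeriv j W) y := fun j => by
      rw [hgj j]
      exact partialDeriv_sub (contDiff_partialDeriv hV j) (contDiff_partialDeriv hW j) j y
    unfold viscousRHS divergence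
    rw [hμ.levy_eq hV.continuous tV hM₁ r0 r1, hμ.levy_eq hW.continuous tW hM₂ r0 r1,
      laplacian_eq_sum_partialDeriv hV, laplacian_eq_sum_partialDeriv hW,
      fderiv_eq_sum_partialDeriv V, fderiv_eq_sum_partialDeriv W]
    have e3 : ∀ j, partialDeriv j g y = partialDeriv j V y - partialDeriv j W y := fun j =>
      congrFun (hgj j) y
    have e4 : ∀ a : Fin d → ℝ, ∑ j, Real.sign (g y) * a j * ψ y
        = Real.sign (g y) * (∑ j, a j) * ψ y := fun a => by
      rw [Finset.mul_sum, Finset.sum_mul]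
    have e5 : ∀ a : Fin d → ℝ, ∑ j, drift μ r j * (Real.sign (g y) * a j * ψ y)
        = Real.sign (g y) * (∑ j, drift μ r j * a j) * ψ y := fun a => by
      rw [Finset.mul_sum, Finset.sum_mul]
      exact Finset.sum_congr rfl fun j _ => by ring
    rw [e4, e4, e5]
    simp only [e1, e2, e3, hS, mul_sub, Finset.sum_sub_distrib]
    ring
  rw [integral_congr_ae (ae_of_all _ key)]
  have iF' := integrable_finsetSum Finset.univ fun j (_ : j ∈ Finset.univ) => iF j
  have iG' := integrable_finsetSum Finset.univ fun j (_ : j ∈ Finset.univ) =>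
    (iG j).const_mul (drift μ r j)
  have iD' := (integrable_finsetSum Finset.univ fun j (_ : j ∈ Finset.univ) => iD j).const_mul ε
  rw [integral_add (by exact ((iF'.neg.add iS).add iL).sub iG') iD',
    integral_sub (by exact (iF'.neg.add iS).add iL) iG',
    integral_add (by exact iF'.neg.add iS) iL, integral_add (by exact iF'.neg) iS, integral_neg,
    integral_finsetSum _ fun j _ => iF j, integral_const_mul,
    integral_finsetSum _ fun j _ => iD j,
    integral_finsetSum _ fun j _ => (iG j).const_mul (drift μ r j)]
  simp only [integral_const_mul]
  -- The fluxes are Lipschitz on the bounded range of `V` and `W`, so `F j` vanishes at least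
  -- linearly where `g` does and the sign can be taken through the derivative.
  have t1 : ∀ j, ∫ y in cell d, Real.sign (g y) * partialDeriv j (F j) y * ψ y
      = -∫ y in cell d, Real.sign (g y) * F j y * partialDeriv j ψ y := fun j => by
    obtain ⟨K, -, hK⟩ := exists_lipschitz_bound (hf j) (max M₁ M₂)
    exact integral_sign_mul_partialDeriv hg1 (hF1 j) hψ pg (pF j) pψ (K := K)
      (fun x => hK _ _ ((hM₁ x).trans (le_max_left _ _)) ((hM₂ x).trans (le_max_right _ _))) j
  have t2 : ∀ j, ∫ y in cell d, Real.sign (g y) * partialDeriv j g y * ψ y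
      = -∫ y in cell d, |g y| * partialDeriv j ψ y := fun j => by
    rw [integral_sign_mul_partialDeriv hg1 hg1 hψ pg pg pψ (K := 1) (fun x => by simp) j]
    simp only [sign_mul_self_eq_abs]
  have t3 : ∫ y in cell d, |g y| * fderiv ℝ ψ y (drift μ r)
      = ∑ j, drift μ r j * ∫ y in cell d, |g y| * partialDeriv j ψ y := by
    simp only [fderiv_eq_sum_partialDeriv ψ, Finset.mul_sum]
    rw [integral_finsetSum]
    · refine Finset.sum_congr rfl fun j _ => ?_
      rw [← integral_const_mul]
      refine integral_congr_ae (ae_of_all _ fun y => ?_)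
      simp only; ring
    · intro j _
      exact integrable_cell_of_continuous (hg.continuous.abs.mul
        (continuous_const.mul (continuous_partialDeriv hψ j)))
        ((pg.comp _).mul ((cellPeriodic_const _).mul (pψ.partialDeriv j)))
  have t4 : ∑ j, (∫ y in cell d, Real.sign (g y) * partialDeriv j (partialDeriv j g) y * ψ y)
      ≤ ∑ j, ∫ y in cell d, |partialDeriv j V y - partialDeriv j W y| * |partialDeriv j ψ y| := by
    refine Finset.sum_le_sum fun j _ => ?_
    have := integral_sign_mul_partialDeriv_partialDeriv_le hg1 hψ j (hgj1 j) pg pψ h0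
    rwa [show (fun x => |partialDeriv j g x| * |partialDeriv j ψ x|)
      = fun y => |partialDeriv j V y - partialDeriv j W y| * |partialDeriv j ψ y| by
        rw [hgj j]] at this
  -- The small jumps are estimated by absolute value; the constants `A` and `A'` may be large
  -- because the moment in front of them will vanish.
  have t5 : ∫ y in cell d, Real.sign (g y) * S y * ψ y
      ≤ (A + A') * levyMoment μ r * ∫ y in cell d, ψ y := by
    rw [← integral_const_mul]
    exact integral_mono iS (iψ.const_mul _) fun y =>
      mul_le_mul_of_nonneg_right ((sign_mul_le_abs _ _).trans (bS y)) (h0 y)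
  rw [t3]
  simp only [t1, t2, Finset.sum_neg_distrib, mul_neg]
  have t6 := mul_le_mul_of_nonneg_left t4 hε
  linarith

/-! ### Accretivity in `L¹` of the cell -/

theorem measure_cell_pos (d : ℕ) : 0 < (volume.restrict (cell d)).real univ := by
  have hne : (cell d).Nonempty := by
    refine ⟨WithLp.toLp 2 fun _ => Real.pi, fun j => ?_⟩
    exact ⟨Real.pi_pos, by have := Real.pi_pos; simp only; linarith⟩
  rw [measureReal_restrict_apply_univ]
  exact ENNReal.toReal_pos ((isOpen_cell d).measure_pos volume hne).ne' (measure_cell_lt_top d).ne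

theorem partialDeriv_const {d : ℕ} (j : Fin d) (c : ℝ) (x : Space d) :
    partialDeriv j (fun _ => c) x = 0 := by simp [partialDeriv]

theorem levyLarge_const {d : ℕ} (μ : Measure (Space d)) (r c : ℝ) (x : Space d) :
    levyLarge μ r (fun _ => c) x = 0 := by simp [levyLarge]

theorem taylorBound_const {d : ℕ} (c : ℝ) : TaylorBound 0 fun _ : Space d => c := fun y z => by simp

/-- The right-hand side of the viscous equation is accretive in `L¹` of the cell. -/
theorem IsLevyMeasure.integral_sign_mul_viscousRHS_sub_nonpos {d : ℕ} {μ : Measure (Space d)}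
    (hμ : IsLevyMeasure μ) {f : Fin d → ℝ → ℝ} (hf : ∀ j, ContDiff ℝ 1 (f j)) {ε : ℝ} (hε : 0 ≤ ε)
    {V W : Space d → ℝ} (hV : ContDiff ℝ 2 V) (hW : ContDiff ℝ 2 W)
    (pV : CellPeriodic V) (pW : CellPeriodic W) {A A' : ℝ} (tV : TaylorBound A V)
    (tW : TaylorBound A' W) :
    ∫ y in cell d, Real.sign (V y - W y) * (viscousRHS f μ ε V y - viscousRHS f μ ε W y) ≤ 0 := by
  set c := (volume.restrict (cell d)).real univ
  have hc : 0 < c := measure_cell_pos d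
  have hl := (hμ.tendsto_levyMoment.const_mul (A + A')).mul_const c
  simp only [mul_zero, zero_mul] at hl
  refine ge_of_tendsto' hl fun n => ?_
  set r : ℝ := 1 / ((n : ℝ) + 2)
  have r0 : 0 < r := by positivity
  have r1 : r < 1 := by
    simp only [r]; rw [div_lt_one (by positivity)]; linarith [(Nat.cast_nonneg n : (0 : ℝ) ≤ n)]
  -- The weight `1` kills every term containing a derivative of the test function, leaving the large
  -- jumps and an error that vanishes with `r`.
  have h := hμ.integral_sign_mul_viscousRHS_sub_le hf hε hV hW (contDiff_const (c := (1 : ℝ)))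
    pV pW (cellPeriodic_const 1) (fun _ => zero_le_one) tV tW r0 r1
  obtain ⟨M₁, hM₁⟩ := exists_bound_of_periodic pV hV.continuous
  obtain ⟨M₂, hM₂⟩ := exists_bound_of_periodic pW hW.continuous
  have hg : ∀ x, |V x - W x| ≤ M₁ + M₂ := fun x =>
    (abs_sub _ _).trans (add_le_add (hM₁ x) (hM₂ x))
  have hM0 : 0 ≤ M₁ + M₂ := (abs_nonneg _).trans (hg 0)
  -- The doubled inequality is used in a degenerate way: difference against zero, kernel constant.
  -- The second integration only contributes the measure of the cell, divided out below.
  have h2 := hμ.integral_sign_mul_levyLarge_sub_le (U := fun x => V x - W x) (V := fun _ => 0)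
    (Ω := fun _ => 1) (hV.continuous.sub hW.continuous).measurable measurable_const
    measurable_const (pV.sub pW).aeCellPeriodic (cellPeriodic_const 0) (cellPeriodic_const 1)
    hg (fun x => by simpa using hM0) (N := 1) (fun x => by simp) (fun _ => zero_le_one) r0
  have h3 : ∀ x, levyLarge μ r (fun x => V x - W x) x = levyLarge μ r V x - levyLarge μ r W x := by
    intro x
    have := integral_sub (hμ.integrableOn_large hV.continuous.measurable hM₁ r0 x)
      (hμ.integrableOn_large hW.continuous.measurable hM₂ r0 x)
    unfold levyLarge
    rw [← this]
    refine integral_congr_ae (ae_of_all _ fun z => ?_)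
    simp only; ring
  simp only [levyLarge_const, sub_zero, mul_one, h3, integral_const, smul_eq_mul] at h2
  rw [integral_const_mul] at h2
  have h4 : ∫ x in cell d, Real.sign (V x - W x) * (levyLarge μ r V x - levyLarge μ r W x) ≤ 0 := by
    by_contra hcon
    push Not at hcon
    exact absurd h2 (not_le.2 (mul_pos hc hcon))
  simp only [partialDeriv_const, mul_one, mul_zero, abs_zero, integral_zero,
    Finset.sum_const_zero, fderiv_fun_const, Pi.zero_apply, zero_apply,
    zero_add, add_zero, integral_const, smul_eq_mul] at h
  linarith

/-! ### The spatial inequality in the doubled variables -/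

/-- The spatial part of the entropy integrand for the test function `Ω(x - y)`, as a function of
the displacement `h = x - y`, the values `a = u(x)`, `b = v(y)` and the large-jump term `l`. -/
noncomputable def doubledFlux {d : ℕ} (f : Fin d → ℝ → ℝ) (μ : Measure (Space d)) (r : ℝ)
    (Ω : Space d → ℝ) (h : Space d) (a b l : ℝ) : ℝ :=
  ∑ j, entropyFlux f j a b * partialDeriv j Ω h + eta a b * levyAdjointSmall μ r Ω h
    + etaDeriv a b * l * Ω h + eta a b * fderiv ℝ Ω h (drift μ r)

theorem measurable_doubledFlux {d : ℕ} {f : Fin d → ℝ → ℝ} (hf : ∀ j, ContDiff ℝ 1 (f j))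
    {μ : Measure (Space d)} (hμ : IsLevyMeasure μ) {r : ℝ} (r1 : r < 1) {Ω : Space d → ℝ}
    (hΩ : ContDiff ℝ 1 Ω) {A : ℝ} (tΩ : TaylorBound A Ω) {α : Type*} [MeasurableSpace α]
    {h : α → Space d} {a b l : α → ℝ} (mh : Measurable h) (ma : Measurable a) (mb : Measurable b)
    (ml : Measurable l) : Measurable fun p => doubledFlux f μ r Ω (h p) (a p) (b p) (l p) := by
  have hs : Measurable fun p => etaDeriv (a p) (b p) := measurable_sign.comp (ma.sub mb)
  have he : Measurable fun p => eta (a p) (b p) := (ma.sub mb).abs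
  unfold doubledFlux entropyFlux
  refine (((Finset.measurable_fun_sum _ fun j _ => ?_).add (he.mul ?_)).add
    ((hs.mul ml).mul (hΩ.continuous.measurable.comp mh))).add (he.mul ?_)
  · exact (hs.mul (((hf j).continuous.measurable.comp ma).sub
      ((hf j).continuous.measurable.comp mb))).mul
      ((continuous_partialDeriv hΩ j).measurable.comp mh)
  · exact (hμ.continuous_levyAdjointSmall hΩ tΩ r1).measurable.comp mh
  · exact ((hΩ.continuous_fderiv one_ne_zero).clm_apply continuous_const).measurable.comp mh

theorem abs_eta_le {M a b : ℝ} (ha : |a| ≤ M) (hb : |b| ≤ M) : |eta a b| ≤ 2 * M := by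
  rw [eta, abs_abs]
  exact (abs_sub a b).trans (by linarith)

/-- This bound, which depends on `r`, serves only integrability and Fubini; it does not enter the
final estimate. -/
theorem exists_bound_doubledFlux {d : ℕ} {f : Fin d → ℝ → ℝ} (hf : ∀ j, ContDiff ℝ 1 (f j))
    {μ : Measure (Space d)} (hμ : IsLevyMeasure μ) {r : ℝ} (r1 : r < 1) {Ω : Space d → ℝ}
    (hΩ : ContDiff ℝ 1 Ω) (pΩ : CellPeriodic Ω) {A : ℝ} (tΩ : TaylorBound A Ω) (M L : ℝ)
    (hM : 0 ≤ M) (hL : 0 ≤ L) :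
    ∃ C, ∀ h a b l, |a| ≤ M → |b| ≤ M → |l| ≤ L → |doubledFlux f μ r Ω h a b l| ≤ C := by
  obtain ⟨N, hN⟩ := exists_bound_of_periodic pΩ hΩ.continuous
  have hN0 : 0 ≤ N := (norm_nonneg _).trans (hN 0)
  choose D hD using fun j =>
    exists_bound_of_periodic (pΩ.partialDeriv j) (continuous_partialDeriv hΩ j)
  have hD0 : ∀ j, 0 ≤ D j := fun j => (norm_nonneg _).trans (hD j 0)
  obtain ⟨E, hE⟩ := exists_bound_of_periodic (fun j => periodic_fderiv (pΩ j))
    (hΩ.continuous_fderiv one_ne_zero)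
  have hE0 : 0 ≤ E := le_trans (norm_nonneg (fderiv ℝ Ω 0)) (hE 0)
  choose K hK0 hK using fun j => exists_lipschitz_bound (hf j) M
  refine ⟨∑ j, K j * (2 * M) * D j + 2 * M * (A * levyMoment μ r) + 1 * L * N
    + 2 * M * (E * ‖drift μ r‖), fun h a b l ha hb hl => ?_⟩
  have hη := abs_eta_le ha hb
  have hs : |etaDeriv a b| ≤ 1 := abs_sign_le_one _
  have hab : |a - b| ≤ 2 * M := (abs_sub a b).trans (by linarith)
  unfold doubledFlux
  refine (abs_add_le _ _).trans (add_le_add ((abs_add_le _ _).trans (add_le_add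
    ((abs_add_le _ _).trans (add_le_add ?_ ?_)) ?_)) ?_)
  · refine (Finset.abs_sum_le_sum_abs _ _).trans (Finset.sum_le_sum fun j _ => ?_)
    rw [abs_mul]
    refine mul_le_mul ?_ (hD j h) (abs_nonneg _) (by have := hK0 j; positivity)
    rw [entropyFlux, abs_mul]
    calc |etaDeriv a b| * |f j a - f j b| ≤ 1 * (K j * (2 * M)) :=
          mul_le_mul hs ((hK j a b ha hb).trans (mul_le_mul_of_nonneg_left hab (hK0 j)))
            (abs_nonneg _) zero_le_one
      _ = _ := one_mul _
  · rw [abs_mul]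
    exact mul_le_mul hη (hμ.abs_levyAdjointSmall_le tΩ r1 h) (abs_nonneg _) (by positivity)
  · rw [abs_mul, abs_mul]
    exact mul_le_mul (mul_le_mul hs hl (abs_nonneg _) zero_le_one) (hN h) (abs_nonneg _)
      (by positivity)
  · rw [abs_mul]
    refine mul_le_mul hη ?_ (abs_nonneg _) (by positivity)
    exact ((fderiv ℝ Ω h).le_opNorm _).trans (mul_le_mul_of_nonneg_right (hE h) (norm_nonneg _))

theorem fderiv_comp_const_sub_apply {d : ℕ} {Ω : Space d → ℝ} (hΩ : Differentiable ℝ Ω)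
    (x y w : Space d) : fderiv ℝ (fun y => Ω (x - y)) y w = -fderiv ℝ Ω (x - y) w := by
  have h : HasFDerivAt (fun y => Ω (x - y))
      ((fderiv ℝ Ω (x - y)).comp (-ContinuousLinearMap.id ℝ (Space d))) y :=
    (hΩ (x - y)).hasFDerivAt.comp y ((hasFDerivAt_id y).const_sub x)
  rw [h.fderiv]; simp

theorem partialDeriv_comp_const_sub {d : ℕ} {Ω : Space d → ℝ} (hΩ : Differentiable ℝ Ω) (j : Fin d)
    (x y : Space d) : partialDeriv j (fun y => Ω (x - y)) y = -partialDeriv j Ω (x - y) :=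
  fderiv_comp_const_sub_apply hΩ x y _

theorem etaDeriv_comm (a b : ℝ) : etaDeriv a b = -etaDeriv b a := by
  unfold etaDeriv; rw [← Real.sign_neg, neg_sub]

theorem entropyFlux_comm {d : ℕ} (f : Fin d → ℝ → ℝ) (j : Fin d) (a b : ℝ) :
    entropyFlux f j a b = entropyFlux f j b a := by
  unfold entropyFlux; rw [etaDeriv_comm]; ring

theorem CellPeriodic.const_sub {d : ℕ} {Ω : Space d → ℝ} (pΩ : CellPeriodic Ω) (x : Space d) :
    CellPeriodic fun y => Ω (x - y) := fun j y => by
  have := pΩ j (x - (y + EuclideanSpace.single j (2 * Real.pi)))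
  simp only
  rw [← this]; congr 1; abel

/-- The inner integral of the doubled spatial inequality. -/
theorem IsLevyMeasure.integral_doubledFlux_add_le {d : ℕ} {μ : Measure (Space d)}
    (hμ : IsLevyMeasure μ) {f : Fin d → ℝ → ℝ} (hf : ∀ j, ContDiff ℝ 1 (f j)) {ε : ℝ} (hε : 0 ≤ ε)
    {V Ω : Space d → ℝ} (hV : ContDiff ℝ 2 V) (pV : CellPeriodic V) (hΩ : ContDiff ℝ 1 Ω)
    (pΩ : CellPeriodic Ω) (h0 : ∀ x, 0 ≤ Ω x) {M N A A' : ℝ} (bV : ∀ x, |V x| ≤ M)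
    (bΩ : ∀ x, |Ω x| ≤ N)
    (tV : TaylorBound A V) (tΩ : TaylorBound A' Ω) {r : ℝ} (r0 : 0 < r) (r1 : r < 1)
    {D : Space d → ℝ} (mD : Measurable D) {CD : ℝ} (bD : ∀ y, |D y| ≤ CD)
    (hD : ∀ y, D y = viscousRHS f μ ε V y) (x : Space d) {k l : ℝ} (hk : |k| ≤ M) :
    ∫ y in cell d, (doubledFlux f μ r Ω (x - y) k (V y) l
        + Real.sign (V y - k) * D y * Ω (x - y))
      ≤ (∫ y in cell d, Real.sign (k - V y) * (l - levyLarge μ r V y) * Ω (x - y))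
        + ε * ∑ j, (∫ y in cell d, |partialDeriv j V y| * |partialDeriv j Ω (x - y)|)
        + levyMoment μ r * ((2 * M * A' + A * N) * (volume.restrict (cell d)).real univ) := by
  have hM : 0 ≤ M := (abs_nonneg _).trans hk
  have mV : Measurable V := hV.continuous.measurable
  set ψ : Space d → ℝ := fun y => Ω (x - y) with hψdef
  have hΩd := hΩ.differentiable one_ne_zero
  have hψ : ContDiff ℝ 1 ψ := hΩ.comp (contDiff_const.sub contDiff_id)
  have pψ : CellPeriodic ψ := pΩ.const_sub x
  have bψ : ∀ y, |ψ y| ≤ N := fun y => bΩ _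
  have dψ : ∀ j y, partialDeriv j ψ y = -partialDeriv j Ω (x - y) :=
    fun j => partialDeriv_comp_const_sub hΩd j x
  have dψ' : ∀ y w, fderiv ℝ ψ y w = -fderiv ℝ Ω (x - y) w := fderiv_comp_const_sub_apply hΩd x
  -- The entropy inequality for `V` is the comparison of `V` with the stationary solution `k`,
  -- tested with `y ↦ Ω(x - y)`.
  have q := hμ.integral_sign_mul_viscousRHS_sub_le hf hε hV (contDiff_const (c := k)) hψ pV
    (cellPeriodic_const k) pψ (fun y => h0 _) tV (taylorBound_const k) r0 r1
  simp only [viscousRHS_const, levyLarge_const, partialDeriv_const, sub_zero, ← hD, dψ, dψ',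
    abs_neg, add_zero] at q
  have mψ : Measurable ψ := hψ.continuous.measurable
  have ms : Measurable fun y => Real.sign (V y - k) := measurable_sign.comp (mV.sub_const k)
  have iψ : Integrable ψ (volume.restrict (cell d)) := integrable_of_bounded mψ bψ
  have ml := hμ.measurable_levyLarge r0 mV
  have iE : ∀ j, Integrable (fun y => entropyFlux f j k (V y) * partialDeriv j Ω (x - y))
      (volume.restrict (cell d)) := fun j => by
    have h1 : Integrable (fun y => Real.sign (V y - k)
        * ((f j (V y) - f j k) * partialDeriv j Ω (x - y))) (volume.restrict (cell d)) :=
      integrable_sign_mul (mV.sub_const k) (integrable_cell_of_continuous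
        ((((hf j).continuous.comp hV.continuous).sub continuous_const).mul
          ((continuous_partialDeriv hΩ j).comp (continuous_const.sub continuous_id)))
        (((pV.comp (f j)).sub (cellPeriodic_const _)).mul ((pΩ.partialDeriv j).const_sub x)))
    refine h1.congr (ae_of_all _ fun y => ?_)
    simp only
    rw [entropyFlux_comm]; simp only [entropyFlux, etaDeriv]; ring
  have bη : ∀ y, |eta k (V y)| ≤ 2 * M := fun y => abs_eta_le hk (bV y)
  have mη : Measurable fun y => eta k (V y) := (measurable_const.sub mV).abs
  have bA : ∀ y, |levyAdjointSmall μ r Ω (x - y)| ≤ A' * levyMoment μ r := fun y =>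
    hμ.abs_levyAdjointSmall_le tΩ r1 _
  have iA : Integrable (fun y => eta k (V y) * levyAdjointSmall μ r Ω (x - y))
      (volume.restrict (cell d)) :=
    integrable_of_bounded (C := 2 * M * (A' * levyMoment μ r))
      (mη.mul ((hμ.continuous_levyAdjointSmall hΩ tΩ r1).measurable.comp
        (measurable_const.sub measurable_id))) fun y => by
      rw [abs_mul]; exact mul_le_mul (bη y) (bA y) (abs_nonneg _) (by positivity)
  have iS : Integrable (fun y => etaDeriv k (V y) * l * Ω (x - y)) (volume.restrict (cell d)) :=
    ((integrable_sign_mul (measurable_const.sub mV) (integrable_const l)).mul_bdd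
      hψ.continuous.aestronglyMeasurable (ae_of_all _ bψ))
  have iG : Integrable (fun y => eta k (V y) * fderiv ℝ Ω (x - y) (drift μ r))
      (volume.restrict (cell d)) := by
    have : Integrable (fun y => |k - V y| * fderiv ℝ ψ y (drift μ r))
        (volume.restrict (cell d)) := integrable_cell_of_continuous
      ((continuous_const.sub hV.continuous).abs.mul
        ((hψ.continuous_fderiv one_ne_zero).clm_apply continuous_const))
      ((((cellPeriodic_const k).sub pV).comp (|·|)).mul
        fun j y => by simp only [periodic_fderiv (pψ j) y])
    refine this.neg.congr (ae_of_all _ fun y => ?_)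
    simp [eta, dψ']
  have iD : Integrable (fun y => Real.sign (V y - k) * D y * Ω (x - y))
      (volume.restrict (cell d)) :=
    ((integrable_sign_mul (mV.sub_const k) (integrable_of_bounded mD bD)).mul_bdd
      hψ.continuous.aestronglyMeasurable (ae_of_all _ bψ))
  have iL : Integrable (fun y => Real.sign (V y - k) * levyLarge μ r V y * Ω (x - y))
      (volume.restrict (cell d)) :=
    ((integrable_sign_mul (mV.sub_const k) (hμ.integrable_cell_levyLarge mV bV r0)).mul_bdd
      hψ.continuous.aestronglyMeasurable (ae_of_all _ bψ))
  have iE' := integrable_finsetSum Finset.univ fun j (_ : j ∈ Finset.univ) => iE j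
  unfold doubledFlux
  rw [integral_add (by exact ((iE'.add iA).add iS).add iG) iD,
    integral_add (by exact (iE'.add iA).add iS) iG, integral_add (by exact iE'.add iA) iS,
    integral_add iE' iA, integral_finsetSum _ fun j _ => iE j]
  have e1 : ∀ j, ∫ y in cell d, Real.sign (V y - k) * (f j (V y) - f j k) * -partialDeriv j Ω (x - y)
      = -∫ y in cell d, entropyFlux f j k (V y) * partialDeriv j Ω (x - y) := fun j => by
    rw [← integral_neg]
    refine integral_congr_ae (ae_of_all _ fun y => ?_)
    simp only
    rw [entropyFlux_comm, entropyFlux, etaDeriv]; ring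
  have e2 : ∫ y in cell d, |V y - k| * -fderiv ℝ Ω (x - y) (drift μ r)
      = -∫ y in cell d, eta k (V y) * fderiv ℝ Ω (x - y) (drift μ r) := by
    rw [← integral_neg]
    refine integral_congr_ae (ae_of_all _ fun y => ?_)
    simp only [eta, abs_sub_comm k]; ring
  have e3 : ∫ y in cell d, Real.sign (k - V y) * (l - levyLarge μ r V y) * Ω (x - y)
      = (∫ y in cell d, etaDeriv k (V y) * l * Ω (x - y))
        + ∫ y in cell d, Real.sign (V y - k) * levyLarge μ r V y * Ω (x - y) := by
    rw [← integral_add iS iL]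
    refine integral_congr_ae (ae_of_all _ fun y => ?_)
    have := etaDeriv_comm k (V y)
    simp only [etaDeriv] at this ⊢
    rw [this]; ring
  have e4 : ∫ y in cell d, eta k (V y) * levyAdjointSmall μ r Ω (x - y)
      ≤ 2 * M * (A' * levyMoment μ r) * (volume.restrict (cell d)).real univ :=
    (le_abs_self _).trans (abs_integral_le_of_bounded fun y => by
      rw [abs_mul]; exact mul_le_mul (bη y) (bA y) (abs_nonneg _) (by positivity))
  have hA : 0 ≤ A * levyMoment μ r := (abs_nonneg _).trans (hμ.abs_levySmall_le tV r1.le 0)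
  have e5 : ∫ y in cell d, Ω (x - y) ≤ N * (volume.restrict (cell d)).real univ :=
    (le_abs_self _).trans (abs_integral_le_of_bounded bψ)
  have e6 := mul_le_mul_of_nonneg_left e5 hA
  -- The gradients of `Ω(x - y)` in `x` and in `y` are opposite, while `q_j` and `η` are symmetric.
  -- Hence flux and drift terms cancel between the two inequalities.
  simp only [e1, Finset.sum_neg_distrib] at q
  rw [e2] at q
  rw [e3]
  linarith

/-- The doubled spatial inequality. -/
theorem IsLevyMeasure.integral_integral_doubledFlux_add_le {d : ℕ} {μ : Measure (Space d)}
    (hμ : IsLevyMeasure μ) {f : Fin d → ℝ → ℝ} (hf : ∀ j, ContDiff ℝ 1 (f j)) {ε : ℝ} (hε : 0 ≤ ε)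
    {U V Ω : Space d → ℝ} (mU : Measurable U) (pU : AECellPeriodic U)
    (hV : ContDiff ℝ 2 V) (pV : CellPeriodic V) (hΩ : ContDiff ℝ 1 Ω)
    (pΩ : CellPeriodic Ω) (h0 : ∀ x, 0 ≤ Ω x) {M N A A' : ℝ} (bU : ∀ x, |U x| ≤ M)
    (bV : ∀ x, |V x| ≤ M) (bΩ : ∀ x, |Ω x| ≤ N)
    (tV : TaylorBound A V) (tΩ : TaylorBound A' Ω) {r : ℝ} (r0 : 0 < r) (r1 : r < 1)
    {D : Space d → ℝ} (mD : Measurable D) {CD : ℝ} (bD : ∀ y, |D y| ≤ CD)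
    (hD : ∀ y, D y = viscousRHS f μ ε V y) :
    ∫ x in cell d, ∫ y in cell d, (doubledFlux f μ r Ω (x - y) (U x) (V y) (levyLarge μ r U x)
        + Real.sign (V y - U x) * D y * Ω (x - y))
      ≤ ε * ∑ j, (∫ y in cell d, |partialDeriv j V y|) * (∫ x in cell d, |partialDeriv j Ω x|)
        + levyMoment μ r * ((2 * M * A' + A * N) * (volume.restrict (cell d)).real univ ^ 2) := by
  have hM : 0 ≤ M := (abs_nonneg _).trans (bU 0)
  have hN : 0 ≤ N := (abs_nonneg _).trans (bΩ 0)
  have hCD : 0 ≤ CD := (abs_nonneg _).trans (bD 0)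
  have mV : Measurable V := hV.continuous.measurable
  have hV1 : ContDiff ℝ 1 V := hV.of_le (by norm_num)
  have mLU := hμ.measurable_levyLarge r0 mU
  have mLV := hμ.measurable_levyLarge r0 mV
  have mh : Measurable fun p : Space d × Space d => p.1 - p.2 := measurable_fst.sub measurable_snd
  have mU' : Measurable fun p : Space d × Space d => U p.1 := mU.comp measurable_fst
  have mV' : Measurable fun p : Space d × Space d => V p.2 := mV.comp measurable_snd
  have mΩ' : Measurable fun p : Space d × Space d => Ω (p.1 - p.2) := hΩ.continuous.measurable.comp mh
  set L := (M + M) * (μ {z : Space d | r < ‖z‖}).toReal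
  have hL : 0 ≤ L := by positivity
  have bLU : ∀ x, |levyLarge μ r U x| ≤ L := hμ.abs_levyLarge_le bU r0
  have bLV : ∀ x, |levyLarge μ r V x| ≤ L := hμ.abs_levyLarge_le bV r0
  obtain ⟨C, hC⟩ := exists_bound_doubledFlux hf hμ r1 hΩ pΩ tΩ M L hM hL
  have iI : Integrable (fun x => ∫ y in cell d,
      (doubledFlux f μ r Ω (x - y) (U x) (V y) (levyLarge μ r U x)
        + Real.sign (V y - U x) * D y * Ω (x - y))) (volume.restrict (cell d)) := by
    refine integrable_of_bounded (C := (C + 1 * CD * N) * (volume.restrict (cell d)).real univ)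
      (measurable_integral_right (F := fun x y =>
        doubledFlux f μ r Ω (x - y) (U x) (V y) (levyLarge μ r U x)
        + Real.sign (V y - U x) * D y * Ω (x - y)) ?_) fun x => abs_integral_le_of_bounded fun y => ?_
    · exact (measurable_doubledFlux hf hμ r1 hΩ tΩ mh mU' mV' (mLU.comp measurable_fst)).add
        (((measurable_sign.comp (mV'.sub mU')).mul (mD.comp measurable_snd)).mul mΩ')
    · refine (abs_add_le _ _).trans (add_le_add (hC _ _ _ _ (bU x) (bV y) (bLU x)) ?_)
      rw [abs_mul, abs_mul]
      exact mul_le_mul (mul_le_mul (abs_sign_le_one _) (bD y) (abs_nonneg _) zero_le_one) (bΩ _)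
        (abs_nonneg _) (by positivity)
  have iN : Integrable (fun x => ∫ y in cell d, Real.sign (U x - V y)
      * (levyLarge μ r U x - levyLarge μ r V y) * Ω (x - y)) (volume.restrict (cell d)) := by
    refine integrable_of_bounded (C := 1 * (L + L) * N * (volume.restrict (cell d)).real univ)
      (measurable_integral_right (F := fun x y => Real.sign (U x - V y)
      * (levyLarge μ r U x - levyLarge μ r V y) * Ω (x - y)) ?_)
      fun x => abs_integral_le_of_bounded fun y => ?_
    · exact ((measurable_sign.comp (mU'.sub mV')).mul ((mLU.comp measurable_fst).sub
        (mLV.comp measurable_snd))).mul mΩ'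
    · rw [abs_mul, abs_mul]
      exact mul_le_mul (mul_le_mul (abs_sign_le_one _)
        ((abs_sub _ _).trans (add_le_add (bLU x) (bLV y))) (abs_nonneg _) zero_le_one) (bΩ _)
        (abs_nonneg _) (by positivity)
  choose E hE using fun j => exists_bound_of_periodic (pV.partialDeriv j)
    (continuous_partialDeriv hV1 j)
  choose E' hE' using fun j => exists_bound_of_periodic (pΩ.partialDeriv j)
    (continuous_partialDeriv hΩ j)
  have mG : ∀ j, Measurable fun p : Space d × Space d =>
      |partialDeriv j V p.2| * |partialDeriv j Ω (p.1 - p.2)| := fun j =>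
    ((continuous_partialDeriv hV1 j).measurable.comp measurable_snd).abs.mul
      ((continuous_partialDeriv hΩ j).measurable.comp mh).abs
  have bG : ∀ j x y, |(|partialDeriv j V y| * |partialDeriv j Ω (x - y)|)| ≤ E j * E' j :=
    fun j x y => by
    rw [abs_mul, abs_abs, abs_abs]
    exact mul_le_mul (hE j y) (hE' j _) (abs_nonneg _) ((norm_nonneg _).trans (hE j 0))
  have iG : ∀ j, Integrable (fun x => ∫ y in cell d,
      |partialDeriv j V y| * |partialDeriv j Ω (x - y)|) (volume.restrict (cell d)) := fun j =>
    integrable_of_bounded (measurable_integral_right (F := fun x y =>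
      |partialDeriv j V y| * |partialDeriv j Ω (x - y)|) (mG j))
      fun x => abs_integral_le_of_bounded (bG j x)
  have iG' := integrable_finsetSum Finset.univ fun j (_ : j ∈ Finset.univ) => iG j
  -- By periodicity the integral of `|∂_j Ω(x - y)|` over `x` does not depend on `y`, so the viscous
  -- term factorises.
  have eG : ∀ j, ∫ x in cell d, ∫ y in cell d, |partialDeriv j V y| * |partialDeriv j Ω (x - y)|
      = (∫ y in cell d, |partialDeriv j V y|) * (∫ x in cell d, |partialDeriv j Ω x|) := fun j => by
    rw [integral_swap_of_bounded (F := fun x y => |partialDeriv j V y| * |partialDeriv j Ω (x - y)|)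
      (mG j) (bG j), ← integral_mul_const]
    refine integral_congr_ae (ae_of_all _ fun y => ?_)
    simp only
    rw [integral_const_mul]
    congr 1
    have := setIntegral_cell_add ((pΩ.partialDeriv j).comp (|·|)) (-y)
    simpa only [sub_eq_add_neg] using this
  have hle := integral_mono iI (((iN.add (iG'.const_mul ε)).add (integrable_const
    (levyMoment μ r * ((2 * M * A' + A * N) * (volume.restrict (cell d)).real univ))))) fun x =>
      hμ.integral_doubledFlux_add_le hf hε hV pV hΩ pΩ h0 bV bΩ tV tΩ r0 r1 mD bD hD x
        (l := levyLarge μ r U x) (bU x)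
  refine hle.trans ?_
  have hNL := hμ.integral_sign_mul_levyLarge_sub_le mU mV hΩ.continuous.measurable pU pV pΩ
    bU bV bΩ h0 r0
  simp only [Pi.add_apply]
  rw [integral_add (by exact iN.add (iG'.const_mul ε)) (integrable_const _),
    integral_add iN (iG'.const_mul ε), integral_const_mul, integral_finsetSum _ fun j _ => iG j,
    integral_const, smul_eq_mul]
  simp only [eG]
  refine le_trans (add_le_add_left (add_le_add_left hNL _) _) (le_of_eq ?_)
  ring

/-! ### The `L¹` contraction for classical solutions -/

/-- Integration by parts for the absolute value of a `C¹` function of one variable. -/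
theorem abs_mul_sub_abs_mul_eq_integral {c c' ψ ψ' : ℝ → ℝ} {a b : ℝ} (hab : a ≤ b)
    (hc : ∀ s ∈ Icc a b, HasDerivAt c (c' s) s) (cc' : ContinuousOn c' (Icc a b))
    (hψ : ∀ s ∈ Icc a b, HasDerivAt ψ (ψ' s) s) (cψ' : ContinuousOn ψ' (Icc a b)) :
    |c b| * ψ b - |c a| * ψ a
      = (∫ s in Icc a b, Real.sign (c s) * c' s * ψ s) + ∫ s in Icc a b, |c s| * ψ' s := by
  have cc : ContinuousOn c (Icc a b) := fun s hs => (hc s hs).continuousAt.continuousWithinAt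
  have cψ : ContinuousOn ψ (Icc a b) := fun s hs => (hψ s hs).continuousAt.continuousWithinAt
  obtain ⟨C₁, hC₁⟩ := isCompact_Icc.exists_bound_of_continuousOn (cc'.mul cψ)
  obtain ⟨C₂, hC₂⟩ := isCompact_Icc.exists_bound_of_continuousOn (cc.mul cψ')
  have hae : ∀ {P : ℝ → Prop}, (∀ s ∈ Icc a b, P s) → ∀ᵐ s ∂volume.restrict (Icc a b), P s :=
    fun h => (ae_restrict_iff' measurableSet_Icc).2 (ae_of_all _ h)
  have cS : ∀ n, ContinuousOn (fun s => smoothSign n (c s)) (Icc a b) := fun n =>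
    (contDiff_smoothSign n (m := 0)).continuous.comp_continuousOn cc
  have cS' : ∀ n, ContinuousOn (fun s => smoothSignDeriv n (c s)) (Icc a b) := fun n =>
    (continuous_smoothSignDeriv n).comp_continuousOn cc
  have k1 : ∀ n, ContinuousOn (fun s => smoothSignDeriv n (c s) * c' s * c s * ψ s) (Icc a b) :=
    fun n => (((cS' n).mul cc').mul cc).mul cψ
  have k2 : ∀ n, ContinuousOn (fun s => smoothSign n (c s) * (c' s * ψ s)) (Icc a b) :=
    fun n => (cS n).mul (cc'.mul cψ)
  have k3 : ∀ n, ContinuousOn (fun s => smoothSign n (c s) * (c s * ψ' s)) (Icc a b) :=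
    fun n => (cS n).mul (cc.mul cψ')
  -- Here `|c|` is replaced by `smoothSign n (c) * c`. Its derivative has one extra term,
  -- `smoothSignDeriv n (c) * c' * c`, which disappears in the limit by the factor `c`.
  have hn : ∀ n, smoothSign n (c b) * c b * ψ b - smoothSign n (c a) * c a * ψ a
      = (∫ s in Icc a b, smoothSignDeriv n (c s) * c' s * c s * ψ s)
        + (∫ s in Icc a b, smoothSign n (c s) * (c' s * ψ s))
        + ∫ s in Icc a b, smoothSign n (c s) * (c s * ψ' s) := by
    intro n
    have hd : ∀ s ∈ uIcc a b, HasDerivAt (fun s => smoothSign n (c s) * c s * ψ s)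
        (smoothSignDeriv n (c s) * c' s * c s * ψ s + smoothSign n (c s) * (c' s * ψ s)
          + smoothSign n (c s) * (c s * ψ' s)) s := by
      intro s hs
      rw [uIcc_of_le hab] at hs
      refine ((((hasDerivAt_smoothSign n (c s)).comp s (hc s hs)).mul (hc s hs)).mul
        (hψ s hs)).congr_deriv ?_
      simp only [Function.comp, Pi.mul_apply]; ring
    have := intervalIntegral.integral_eq_sub_of_hasDerivAt hd
      ((((k1 n).add (k2 n)).add (k3 n)).intervalIntegrable_of_Icc hab)
    rw [← this, intervalIntegral.integral_of_le hab, ← integral_Icc_eq_integral_Ioc,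
      integral_add (by exact ((k1 n).add (k2 n)).integrableOn_Icc) (k3 n).integrableOn_Icc,
      integral_add (k1 n).integrableOn_Icc (k2 n).integrableOn_Icc]
  have l1 : Tendsto (fun n => ∫ s in Icc a b, smoothSignDeriv n (c s) * c' s * c s * ψ s) atTop
      (𝓝 (∫ _s in Icc a b, (0 : ℝ))) := by
    have hb : ∀ n, ∀ s ∈ Icc a b, ‖smoothSignDeriv n (c s) * c' s * c s * ψ s‖
        ≤ C₁ * (|c s| * smoothSignDeriv n (c s)) := by
      intro n s hs
      have h2 := hC₁ s hs
      rw [show smoothSignDeriv n (c s) * c' s * c s * ψ s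
        = (c' s * ψ s) * (c s * smoothSignDeriv n (c s)) by ring, norm_mul]
      rw [norm_mul (c s), Real.norm_of_nonneg (smoothSignDeriv_nonneg n (c s))]
      exact mul_le_mul_of_nonneg_right h2
        (mul_nonneg (norm_nonneg _) (smoothSignDeriv_nonneg _ _))
    refine tendsto_integral_of_dominated_convergence (fun _ => |C₁|)
      (fun n => (k1 n).aestronglyMeasurable measurableSet_Icc) (integrable_const _)
      (fun n => hae fun s hs => (hb n s hs).trans ?_) (hae fun s hs => ?_)
    · have h1 := abs_mul_smoothSignDeriv_le n (c s)
      have h2 : 0 ≤ |c s| * smoothSignDeriv n (c s) :=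
        mul_nonneg (abs_nonneg _) (smoothSignDeriv_nonneg _ _)
      calc C₁ * (|c s| * smoothSignDeriv n (c s)) ≤ |C₁| * 1 :=
            mul_le_mul (le_abs_self _) h1 h2 (abs_nonneg _)
        _ = |C₁| := mul_one _
    · refine squeeze_zero_norm (fun n => hb n s hs) ?_
      simpa using (tendsto_abs_mul_smoothSignDeriv (c s)).const_mul C₁
  have l23 : ∀ (H : ℝ → ℝ) (C : ℝ), (∀ s ∈ Icc a b, ‖H s‖ ≤ C) →
      (∀ n, ContinuousOn (fun s => smoothSign n (c s) * H s) (Icc a b)) →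
      Tendsto (fun n => ∫ s in Icc a b, smoothSign n (c s) * H s) atTop
        (𝓝 (∫ s in Icc a b, Real.sign (c s) * H s)) := by
    intro H C hC hk
    refine tendsto_integral_of_dominated_convergence (fun _ => C)
      (fun n => (hk n).aestronglyMeasurable measurableSet_Icc) (integrable_const _)
      (fun n => hae fun s hs => ?_) (ae_of_all _ fun s => (tendsto_smoothSign (c s)).mul_const _)
    rw [norm_mul]
    calc ‖smoothSign n (c s)‖ * ‖H s‖ ≤ 1 * C :=
          mul_le_mul (abs_smoothSign_le n _) (hC s hs) (norm_nonneg _) zero_le_one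
      _ = C := one_mul C
  have hlim := ((l1.add (l23 _ C₁ hC₁ k2)).add (l23 _ C₂ hC₂ k3))
  have hlim2 : Tendsto (fun n => smoothSign n (c b) * c b * ψ b - smoothSign n (c a) * c a * ψ a)
      atTop (𝓝 (Real.sign (c b) * c b * ψ b - Real.sign (c a) * c a * ψ a)) :=
    (((tendsto_smoothSign (c b)).mul_const _).mul_const _).sub
      (((tendsto_smoothSign (c a)).mul_const _).mul_const _)
  have := tendsto_nhds_unique hlim2 (hlim.congr fun n => (hn n).symm)
  simp only [sign_mul_self_eq_abs, integral_zero, zero_add] at this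
  rw [this]
  congr 1
  · refine integral_congr_ae (ae_of_all _ fun s => ?_)
    simp only [Pi.mul_apply]; ring
  · refine integral_congr_ae (ae_of_all _ fun s => ?_)
    simp only [Pi.mul_apply, ← mul_assoc, sign_mul_self_eq_abs]

section Viscous

variable {d : ℕ} {f : Fin d → ℝ → ℝ} {μ : Measure (Space d)} {T ε : ℝ} {u₀ w₀ : Space d → ℝ}
  {v w : Space d → ℝ → ℝ}

theorem IsViscousSolution.deriv_eq (hv : IsViscousSolution f μ T ε u₀ v) (x : Space d) {t : ℝ}
    (ht : t ∈ Ioo 0 T) : deriv (v x) t = viscousRHS f μ ε (fun y => v y t) x := by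
  have := hv.equation x t ht
  unfold viscousRHS
  linarith

theorem IsViscousSolution.periodic_deriv (hv : IsViscousSolution f μ T ε u₀ v) {t : ℝ}
    (ht : t ∈ Ioo 0 T) : CellPeriodic fun x => deriv (v x) t := by
  intro j x
  refine Filter.EventuallyEq.deriv_eq ?_
  filter_upwards [isOpen_Ioo.mem_nhds ht] with s hs
  exact hv.periodic s hs j x

theorem IsViscousSolution.exists_bound (hv : IsViscousSolution f μ T ε u₀ v) {a b : ℝ}
    (ha : 0 < a) (hb : b < T) : ∃ C, ∀ x, ∀ t ∈ Icc a b, |v x t| ≤ C :=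
  exists_bound_of_periodic_time ha hb hv.periodic hv.continuous

theorem IsViscousSolution.exists_bound_deriv (hv : IsViscousSolution f μ T ε u₀ v) {a b : ℝ}
    (ha : 0 < a) (hb : b < T) : ∃ C, ∀ x, ∀ t ∈ Icc a b, |deriv (v x) t| ≤ C :=
  exists_bound_of_periodic_time (g := fun x t => deriv (v x) t) ha hb
    (fun _ ht => hv.periodic_deriv ht) hv.continuous_time

/-- The constant depends on the time window and on `ε`. This is harmless, since it only multiplies
the vanishing moment of the small jumps. -/
theorem IsViscousSolution.exists_taylorBound (hv : IsViscousSolution f μ T ε u₀ v) {a b : ℝ}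
    (ha : 0 < a) (hb : b < T) : ∃ A, ∀ t ∈ Icc a b, TaylorBound A fun x => v x t := by
  obtain ⟨A, hA⟩ := exists_bound_of_periodic_time
    (g := fun x t => fderiv ℝ (fderiv ℝ fun y => v y t) x) ha hb
    (fun t ht j => periodic_fderiv (periodic_fderiv (hv.periodic t ht j))) hv.continuous_space_two
  exact ⟨A, fun t ht => taylorBound_of_fderiv_two
    (hv.contDiff_space t ⟨ha.trans_le ht.1, ht.2.trans_lt hb⟩) fun x => hA x t ht⟩

theorem IsViscousSolution.continuous_slice (hv : IsViscousSolution f μ T ε u₀ v) {t : ℝ}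
    (ht : t ∈ Ioo 0 T) : Continuous fun x => v x t := (hv.contDiff_space t ht).continuous

theorem IsViscousSolution.continuousOn_deriv_time (hv : IsViscousSolution f μ T ε u₀ v)
    (x : Space d) : ContinuousOn (fun t => deriv (v x) t) (Ioo 0 T) :=
  hv.continuous_time.comp (f := fun t : ℝ => (x, t)) (by fun_prop) fun t ht => ⟨trivial, ht⟩

/-- Classical solutions contract in `L¹` of the cell. -/
theorem IsViscousSolution.integral_abs_sub_le (hμ : IsLevyMeasure μ)
    (hf : ∀ j, ContDiff ℝ 1 (f j)) (hε : 0 ≤ ε) (hv : IsViscousSolution f μ T ε u₀ v)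
    (hw : IsViscousSolution f μ T ε w₀ w) {a b : ℝ} (ha : 0 < a) (hab : a ≤ b) (hb : b < T) :
    ∫ x in cell d, |v x b - w x b| ≤ ∫ x in cell d, |v x a - w x a| := by
  have hsub : Icc a b ⊆ Ioo 0 T := fun t ht => ⟨ha.trans_le ht.1, ht.2.trans_lt hb⟩
  obtain ⟨A, hA⟩ := hv.exists_taylorBound ha hb
  obtain ⟨A', hA'⟩ := hw.exists_taylorBound ha hb
  obtain ⟨C, hC⟩ := hv.exists_bound_deriv ha hb
  obtain ⟨C', hC'⟩ := hw.exists_bound_deriv ha hb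
  have hi : ∀ t ∈ Ioo 0 T, Integrable (fun x => |v x t - w x t|) (volume.restrict (cell d)) :=
    fun t ht => integrable_cell_of_continuous
      ((hv.continuous_slice ht).sub (hw.continuous_slice ht)).abs
      (((hv.periodic t ht).sub (hw.periodic t ht)).comp (|·|))
  -- The time evolution is computed pointwise in `x`; Fubini then leaves, at each time, the
  -- accretivity of the spatial operator.
  have e : ∀ x, |v x b - w x b| - |v x a - w x a|
      = ∫ s in Icc a b, Real.sign (v x s - w x s) * (deriv (v x) s - deriv (w x) s) := by
    intro x
    have := abs_mul_sub_abs_mul_eq_integral (c := fun s => v x s - w x s)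
      (c' := fun s => deriv (v x) s - deriv (w x) s) (ψ := fun _ => 1) (ψ' := fun _ => 0) hab
      (fun s hs => (hv.differentiable_time x s (hsub hs)).hasDerivAt.sub
        (hw.differentiable_time x s (hsub hs)).hasDerivAt)
      (((hv.continuousOn_deriv_time x).sub (hw.continuousOn_deriv_time x)).mono hsub)
      (fun s _ => hasDerivAt_const s 1) continuousOn_const
    simpa using this
  have hm : MeasurableSet ((univ : Set (Space d)) ×ˢ Icc a b) := MeasurableSet.univ.prod measurableSet_Icc
  -- Continuity is known only over the time window, which gives measurability for the restricted
  -- product measure; it passes to the smaller measure on the cell.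
  have hprod : (volume.restrict (cell d)).prod (volume.restrict (Icc a b))
      ≤ (volume.prod volume).restrict ((univ : Set (Space d)) ×ˢ Icc a b) := by
    rw [Measure.prod_restrict]
    exact Measure.restrict_mono (prod_mono (subset_univ _) le_rfl) le_rfl
  have hmono := prod_mono (subset_univ (univ : Set (Space d))) hsub
  have m1 := ((hv.continuous.sub hw.continuous).mono hmono).aestronglyMeasurable hm
    (μ := volume.prod volume)
  have m2 := ((hv.continuous_time.sub hw.continuous_time).mono hmono).aestronglyMeasurable hm
    (μ := volume.prod volume)
  have hint : Integrable (Function.uncurry fun (x : Space d) s =>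
      Real.sign (v x s - w x s) * (deriv (v x) s - deriv (w x) s))
      ((volume.restrict (cell d)).prod (volume.restrict (Icc a b))) := by
    refine Integrable.of_bound (C := C + C')
      (((measurable_sign.comp_aemeasurable m1.aemeasurable).aestronglyMeasurable.mul m2).mono_measure
        hprod) ?_
    rw [Measure.prod_restrict]
    refine (ae_restrict_iff' ((measurableSet_cell d).prod measurableSet_Icc)).2
      (ae_of_all _ fun p hp => ?_)
    simp only [Function.uncurry, norm_mul]
    calc _ ≤ 1 * (C + C') := mul_le_mul (abs_sign_le_one _)
          ((norm_sub_le _ _).trans (add_le_add (hC p.1 p.2 hp.2) (hC' p.1 p.2 hp.2)))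
          (norm_nonneg _) zero_le_one
      _ = _ := one_mul _
  have h1 : (∫ x in cell d, |v x b - w x b|) - ∫ x in cell d, |v x a - w x a|
      = ∫ s in Icc a b, ∫ x in cell d,
        Real.sign (v x s - w x s) * (deriv (v x) s - deriv (w x) s) := by
    rw [← integral_sub (hi b (hsub (right_mem_Icc.2 hab))) (hi a (hsub (left_mem_Icc.2 hab))),
      integral_congr_ae (ae_of_all _ e)]
    exact integral_integral_swap hint
  have h2 : ∫ s in Icc a b, ∫ x in cell d,
      Real.sign (v x s - w x s) * (deriv (v x) s - deriv (w x) s) ≤ 0 := by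
    refine setIntegral_nonpos measurableSet_Icc fun s hs => ?_
    have := hμ.integral_sign_mul_viscousRHS_sub_nonpos hf hε (hv.contDiff_space s (hsub hs))
      (hw.contDiff_space s (hsub hs)) (hv.periodic s (hsub hs)) (hw.periodic s (hsub hs))
      (hA s hs) (hA' s hs)
    simpa only [hv.deriv_eq _ (hsub hs), hw.deriv_eq _ (hsub hs)] using this
  linarith

theorem distL1_eq_lintegral {d : ℕ} (g h : Space d → ℝ) :
    distL1 g h = ∫⁻ x in cell d, ‖g x - h x‖ₑ := by
  rw [distL1, eLpNorm_one_eq_lintegral_enorm]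

theorem distL1_comm {d : ℕ} (g h : Space d → ℝ) : distL1 g h = distL1 h g := by
  simp only [distL1_eq_lintegral]
  refine lintegral_congr fun x => ?_
  rw [← enorm_neg, neg_sub]

theorem distL1_triangle {d : ℕ} {g h k : Space d → ℝ}
    (hg : AEStronglyMeasurable g (volume.restrict (cell d)))
    (hh : AEStronglyMeasurable h (volume.restrict (cell d)))
    (hk : AEStronglyMeasurable k (volume.restrict (cell d))) :
    distL1 g k ≤ distL1 g h + distL1 h k := by
  have := eLpNorm_add_le (hg.sub hh) (hh.sub hk) (le_refl (1 : ℝ≥0∞))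
  refine le_trans (le_of_eq ?_) this
  unfold distL1
  congr 1
  ext x
  simp

theorem distL1_eq_ofReal {d : ℕ} {g h : Space d → ℝ}
    (hi : Integrable (fun x => |g x - h x|) (volume.restrict (cell d))) :
    distL1 g h = ENNReal.ofReal (∫ x in cell d, |g x - h x|) := by
  rw [distL1_eq_lintegral, ofReal_integral_eq_lintegral_ofReal hi (ae_of_all _ fun x => abs_nonneg _)]
  refine lintegral_congr fun x => ?_
  rw [← Real.norm_eq_abs, ofReal_norm]

theorem distL1_translate {d : ℕ} {g h : Space d → ℝ} (pg : CellPeriodic g) (ph : CellPeriodic h)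
    (z : Space d) : distL1 (fun x => g (x + z)) (fun x => h (x + z)) = distL1 g h := by
  simp only [distL1_eq_lintegral]
  exact setLIntegral_cell_add (g := fun x => ‖g x - h x‖ₑ)
    (fun j x => by simp only [pg j x, ph j x]) z

/-- `L¹` contraction up to the initial time. -/
theorem IsViscousSolution.distL1_le (hμ : IsLevyMeasure μ)
    (hf : ∀ j, ContDiff ℝ 1 (f j)) (hε : 0 ≤ ε) (hv : IsViscousSolution f μ T ε u₀ v)
    (hw : IsViscousSolution f μ T ε w₀ w) (hu₀ : AEStronglyMeasurable u₀ volume)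
    (hw₀ : AEStronglyMeasurable w₀ volume) {t : ℝ} (ht : t ∈ Ioo 0 T) :
    distL1 (fun x => v x t) (fun x => w x t) ≤ distL1 u₀ w₀ := by
  -- The contraction from time `a > 0` is combined with the triangle inequality through both initial
  -- data, and then `a → 0`.
  have hl : Tendsto (fun a => distL1 (fun x => v x a) u₀ + distL1 u₀ w₀
      + distL1 (fun x => w x a) w₀) (𝓝[>] (0 : ℝ)) (𝓝 (0 + distL1 u₀ w₀ + 0)) :=
    (hv.initial.add tendsto_const_nhds).add hw.initial
  rw [zero_add, add_zero] at hl
  refine ge_of_tendsto hl ?_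
  filter_upwards [Ioo_mem_nhdsGT ht.1] with a ha
  have ha' : a ∈ Ioo 0 T := ⟨ha.1, ha.2.trans ht.2⟩
  have mv : AEStronglyMeasurable (fun x => v x a) (volume.restrict (cell d)) :=
    (hv.continuous_slice ha').aestronglyMeasurable
  have mw : AEStronglyMeasurable (fun x => w x a) (volume.restrict (cell d)) :=
    (hw.continuous_slice ha').aestronglyMeasurable
  have hi : ∀ t ∈ Ioo 0 T, Integrable (fun x => |v x t - w x t|) (volume.restrict (cell d)) :=
    fun t ht => integrable_cell_of_continuous
      ((hv.continuous_slice ht).sub (hw.continuous_slice ht)).abs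
      (((hv.periodic t ht).sub (hw.periodic t ht)).comp (|·|))
  calc distL1 (fun x => v x t) (fun x => w x t) ≤ distL1 (fun x => v x a) (fun x => w x a) := by
        rw [distL1_eq_ofReal (hi t ht), distL1_eq_ofReal (hi a ha')]
        exact ENNReal.ofReal_le_ofReal
          (hv.integral_abs_sub_le hμ hf hε hw ha.1 ha.2.le ht.2)
    _ ≤ distL1 (fun x => v x a) u₀ + distL1 u₀ (fun x => w x a) :=
        distL1_triangle mv hu₀.restrict mw
    _ ≤ distL1 (fun x => v x a) u₀ + (distL1 u₀ w₀ + distL1 w₀ (fun x => w x a)) := by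
        gcongr; exact distL1_triangle hu₀.restrict hw₀.restrict mw
    _ = _ := by rw [distL1_comm w₀, add_assoc]

/-- Translates of classical solutions are classical solutions. -/
theorem IsViscousSolution.translate (hv : IsViscousSolution f μ T ε u₀ v) (hT : 0 < T)
    (pu : CellPeriodic u₀) (z : Space d) : IsViscousSolution f μ T ε (fun x => u₀ (x + z)) (fun x t => v (x + z) t) := by
  have hp : ∀ {g : Space d → ℝ}, CellPeriodic g → CellPeriodic fun x => g (x + z) := by
    intro g hg j x
    simp only
    rw [add_right_comm]
    exact hg j (x + z)
  have hcont : Continuous fun p : Space d × ℝ => (p.1 + z, p.2) := by fun_prop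
  have hmap : MapsTo (fun p : Space d × ℝ => (p.1 + z, p.2)) (univ ×ˢ Ioo 0 T) (univ ×ˢ Ioo 0 T) :=
    fun p hp => ⟨trivial, hp.2⟩
  have hfd : ∀ (g : Space d → ℝ), fderiv ℝ (fun x => g (x + z)) = fun x => fderiv ℝ g (x + z) :=
    fun g => funext fun x => fderiv_comp_add_right z
  have hfd2 : ∀ (g : Space d → (Space d →L[ℝ] ℝ)),
      fderiv ℝ (fun x => g (x + z)) = fun x => fderiv ℝ g (x + z) :=
    fun g => funext fun x => fderiv_comp_add_right z
  refine ⟨fun t ht => hp (hv.periodic t ht), fun t ht => ?_, fun x t ht => ?_, ?_, ?_, ?_, ?_,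
    fun x t ht => ?_, ?_⟩
  · exact (hv.contDiff_space t ht).comp (contDiff_id.add contDiff_const)
  · exact hv.differentiable_time (x + z) t ht
  · exact hv.continuous.comp hcont.continuousOn hmap
  · exact hv.continuous_time.comp hcont.continuousOn hmap
  · refine (hv.continuous_space.comp hcont.continuousOn hmap).congr fun p _ => ?_
    rw [hfd fun x => v x p.2]
    rfl
  · refine (hv.continuous_space_two.comp hcont.continuousOn hmap).congr fun p _ => ?_
    rw [hfd fun x => v x p.2, hfd2 (fderiv ℝ fun x => v x p.2)]
    rfl
  · have h := hv.equation (x + z) t ht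
    have e1 : divergence (fun y j => f j (v (y + z) t)) x
        = divergence (fun y j => f j (v y t)) (x + z) := by
      refine Finset.sum_congr rfl fun j _ => ?_
      simp only [FracCL.partialDeriv]
      rw [hfd fun y => f j (v y t)]
    have e2 : levy μ (fun y => v (y + z) t) x = levy μ (fun y => v y t) (x + z) := by
      simp only [levy, compensator, hfd fun y => v y t, add_right_comm x _ z]
    have h2 := (hv.contDiff_space t ht)
    have h3 : ContDiff ℝ 2 fun y => v (y + z) t := h2.comp (contDiff_id.add contDiff_const)
    have e3 : Laplacian.laplacian (fun y => v (y + z) t) x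
        = Laplacian.laplacian (fun y => v y t) (x + z) := by
      rw [laplacian_eq_sum_partialDeriv h2, laplacian_eq_sum_partialDeriv h3]
      refine Finset.sum_congr rfl fun j _ => ?_
      have : partialDeriv j (fun y => v (y + z) t) = fun y => partialDeriv j (fun y => v y t) (y + z) :=
        funext fun y => by simp only [FracCL.partialDeriv, hfd fun y => v y t]
      rw [this]
      exact congrArg (fun L => L (EuclideanSpace.single j 1))
        (congrFun (hfd (FracCL.partialDeriv j fun y => v y t)) x)
    rw [e1, e2, e3]
    exact h
  · refine hv.initial.congr' ?_
    filter_upwards [Ioo_mem_nhdsGT hT] with t ht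
    exact (distL1_translate (hv.periodic t ht) pu z).symm

/-- The translates of a classical solution satisfy the modulus of continuity of the data. -/
theorem IsViscousSolution.distL1_translate_le (hμ : IsLevyMeasure μ)
    (hf : ∀ j, ContDiff ℝ 1 (f j)) (hε : 0 ≤ ε) (hv : IsViscousSolution f μ T ε u₀ v)
    (hu₀ : AEStronglyMeasurable u₀ volume) (pu : CellPeriodic u₀) {t : ℝ} (ht : t ∈ Ioo 0 T)
    (z : Space d) :
    distL1 (fun x => v (x + z) t) (fun x => v x t) ≤ distL1 (fun x => u₀ (x + z)) u₀ :=
  (hv.translate (ht.1.trans ht.2) pu z).distL1_le hμ hf hε hv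
    (hu₀.comp_measurePreserving (measurePreserving_add_right volume z)) hu₀ ht

end Viscous

/-- A bound for the difference quotients in `L¹` bounds the partial derivative in `L¹`. -/
theorem integral_abs_partialDeriv_le {d : ℕ} {V : Space d → ℝ} (hV : ContDiff ℝ 1 V)
    (pV : CellPeriodic V) (j : Fin d) {K : ℝ}
    (h : ∀ τ : ℝ, 0 < τ → ∫ x in cell d, |V (x + EuclideanSpace.single j τ) - V x| ≤ K * τ) :
    ∫ x in cell d, |partialDeriv j V x| ≤ K := by
  obtain ⟨C, hC⟩ := exists_bound_of_periodic (pV.partialDeriv j) (continuous_partialDeriv hV j)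
  set e : Space d := EuclideanSpace.single j (1 : ℝ) with he
  have hes : ∀ τ : ℝ, EuclideanSpace.single j τ = τ • e := fun τ => by
    rw [he]; ext i; simp
  have hder : ∀ x : Space d, ∀ τ : ℝ, HasDerivAt (fun τ : ℝ => V (x + τ • e))
      (partialDeriv j V (x + τ • e)) τ := by
    intro x τ
    have h1 : HasDerivAt (fun τ : ℝ => x + τ • e) e τ := by
      simpa using ((hasDerivAt_id τ).smul_const e).const_add x
    exact ((hV.differentiable one_ne_zero (x + τ • e)).hasFDerivAt).comp_hasDerivAt τ h1
  set τ : ℕ → ℝ := fun n => 1 / ((n : ℝ) + 1) with hτ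
  have hτ0 : ∀ n, 0 < τ n := fun n => by simp only [hτ]; positivity
  -- The difference quotients converge pointwise and are dominated by the supremum of the continuous
  -- periodic derivative, so the bound survives in the limit.
  have hlim : Tendsto (fun n => ∫ x in cell d, |(τ n)⁻¹ * (V (x + τ n • e) - V x)|) atTop
      (𝓝 (∫ x in cell d, |partialDeriv j V x|)) := by
    refine tendsto_integral_of_dominated_convergence (fun _ => C) (fun n => ?_)
      (integrable_const C) (fun n => ae_of_all _ fun x => ?_) (ae_of_all _ fun x => ?_)
    · exact (continuous_const.mul ((hV.continuous.comp (continuous_add_const _)).sub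
        hV.continuous)).abs.aestronglyMeasurable
    · have := Convex.norm_image_sub_le_of_norm_hasDerivWithin_le (f := fun τ : ℝ => V (x + τ • e))
        (s := univ) (C := C) (x := 0) (y := τ n) (fun τ _ => (hder x τ).hasDerivWithinAt)
        (fun τ _ => hC _) convex_univ trivial trivial
      simp only [zero_smul, add_zero, sub_zero, Real.norm_of_nonneg (hτ0 n).le] at this
      rw [Real.norm_eq_abs, abs_abs, abs_mul, abs_of_pos (inv_pos.2 (hτ0 n)),
        inv_mul_le_iff₀ (hτ0 n), mul_comm]
      exact this
    · have h1 := (hasDerivAt_iff_tendsto_slope_zero.1 (hder x 0))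
      simp only [zero_add, zero_smul, add_zero, smul_eq_mul] at h1
      have h2 : Tendsto τ atTop (𝓝[≠] 0) := tendsto_nhdsWithin_iff.2
        ⟨tendsto_one_div_add_atTop_nhds_zero_nat, Eventually.of_forall fun n => (hτ0 n).ne'⟩
      exact (h1.comp h2).abs
  refine le_of_tendsto hlim (Eventually.of_forall fun n => ?_)
  have h1 := h (τ n) (hτ0 n)
  simp only [abs_mul, abs_of_pos (inv_pos.2 (hτ0 n)), ← hes]
  rw [integral_const_mul, inv_mul_le_iff₀ (hτ0 n), mul_comm]
  exact h1

/-! ### The `L¹` modulus of continuity of functions of bounded variation -/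

theorem hasDerivAt_comp_line {d : ℕ} {g : Space d → ℝ} (hg : Differentiable ℝ g) (j : Fin d)
    (x : Space d) (s : ℝ) : HasDerivAt (fun s : ℝ => g (x + s • EuclideanSpace.single j (1 : ℝ)))
      (partialDeriv j g (x + s • EuclideanSpace.single j (1 : ℝ))) s := by
  have h1 : HasDerivAt (fun s : ℝ => x + s • EuclideanSpace.single j (1 : ℝ))
      (EuclideanSpace.single j (1 : ℝ)) s := by
    simpa using ((hasDerivAt_id s).smul_const (EuclideanSpace.single j (1 : ℝ))).const_add x
  exact ((hg _).hasFDerivAt).comp_hasDerivAt s h1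

theorem partialDeriv_eq_of_hasDerivAt {d : ℕ} {g : Space d → ℝ} (hg : Differentiable ℝ g)
    {j : Fin d} {x : Space d} {c : ℝ}
    (h : HasDerivAt (fun s : ℝ => g (x + s • EuclideanSpace.single j (1 : ℝ))) c 0) :
    partialDeriv j g x = c := by
  have := (hasDerivAt_comp_line hg j x 0).unique h
  simpa using this

theorem single_eq_smul {d : ℕ} (j : Fin d) (s : ℝ) :
    EuclideanSpace.single j s = s • EuclideanSpace.single j (1 : ℝ) := by ext i; simp

theorem integral_mul_divergence_le {d : ℕ} {g : Space d → ℝ} {B : ℝ≥0}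
    (hB : variationBV g ≤ (B : ℝ≥0∞)) {Φ : Space d → Space d} (h1 : ContDiff ℝ 1 Φ)
    (h2 : HasCompactSupport Φ) (h3 : tsupport Φ ⊆ cell d) (h4 : ∀ x, ‖Φ x‖ ≤ 1) :
    ∫ x in cell d, g x * divergence (fun y j => Φ y j) x ≤ B := by
  have h : ENNReal.ofReal (∫ x in cell d, g x * divergence (fun y j => Φ y j) x)
      ≤ (B : ℝ≥0∞) := by
    refine le_trans ?_ hB
    unfold variationBV
    exact le_iSup_of_le Φ (le_iSup_of_le h1 (le_iSup_of_le h2 (le_iSup_of_le h3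
      (le_iSup_of_le h4 le_rfl))))
  rw [← ENNReal.ofReal_coe_nnreal] at h
  exact (ENNReal.ofReal_le_ofReal_iff B.2).1 h

/-! ### Cutoffs of the open cell -/

theorem exists_bound_deriv_smoothTransition :
    ∃ L, 0 ≤ L ∧ ∀ w, |deriv Real.smoothTransition w| ≤ L := by
  have hc : Continuous (deriv Real.smoothTransition) :=
    (Real.smoothTransition.contDiff (n := 1)).continuous_deriv le_rfl
  obtain ⟨L, hL⟩ := (isCompact_Icc (a := (0 : ℝ)) (b := 1)).exists_bound_of_continuousOn
    hc.continuousOn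
  have hL0 : 0 ≤ L := (norm_nonneg _).trans (hL 0 (by simp))
  refine ⟨L, hL0, fun w => ?_⟩
  rcases lt_or_ge w 0 with h | h
  · have : Real.smoothTransition =ᶠ[𝓝 w] fun _ => 0 := by
      filter_upwards [Iio_mem_nhds h] with y hy
      exact Real.smoothTransition.zero_of_nonpos (le_of_lt hy)
    rw [this.deriv_eq]; simpa using hL0
  · rcases le_or_gt w 1 with h' | h'
    · exact hL w ⟨h, h'⟩
    · have : Real.smoothTransition =ᶠ[𝓝 w] fun _ => 1 := by
        filter_upwards [Ioi_mem_nhds h'] with y hy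
        exact Real.smoothTransition.one_of_one_le (le_of_lt hy)
      rw [this.deriv_eq]; simpa using hL0

theorem deriv_smoothTransition_of_one_lt {w : ℝ} (h : 1 < w) :
    deriv Real.smoothTransition w = 0 := by
  have : Real.smoothTransition =ᶠ[𝓝 w] fun _ => 1 := by
    filter_upwards [Ioi_mem_nhds h] with y hy
    exact Real.smoothTransition.one_of_one_le (le_of_lt hy)
  rw [this.deriv_eq]; simp

/-- A smooth cutoff of the interval `(0, 2π)`. -/
noncomputable def cutoff (n : ℕ) (s : ℝ) : ℝ :=
  Real.smoothTransition (n * (s * (2 * Real.pi - s)) - 1)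

/-- The derivative of `cutoff n`. -/
noncomputable def cutoffDeriv (n : ℕ) (s : ℝ) : ℝ :=
  deriv Real.smoothTransition (n * (s * (2 * Real.pi - s)) - 1) * (n * (2 * Real.pi - 2 * s))

theorem contDiff_cutoff (n : ℕ) {m : ℕ∞} : ContDiff ℝ m (cutoff n) :=
  Real.smoothTransition.contDiff.comp (by fun_prop)

theorem hasDerivAt_cutoff (n : ℕ) (s : ℝ) : HasDerivAt (cutoff n) (cutoffDeriv n s) s := by
  have h1 : HasDerivAt (fun s : ℝ => n * (s * (2 * Real.pi - s)) - 1)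
      (n * (2 * Real.pi - 2 * s)) s := by
    have := (((hasDerivAt_id s).mul ((hasDerivAt_id s).const_sub (2 * Real.pi))).const_mul
      (n : ℝ)).sub_const 1
    refine this.congr_deriv ?_
    simp only [id]; ring
  have h2 := (((Real.smoothTransition.contDiff (n := 1)).differentiable one_ne_zero)
    (n * (s * (2 * Real.pi - s)) - 1)).hasDerivAt
  exact h2.comp s h1

theorem cutoff_nonneg (n : ℕ) (s : ℝ) : 0 ≤ cutoff n s := Real.smoothTransition.nonneg _

theorem cutoff_le_one (n : ℕ) (s : ℝ) : cutoff n s ≤ 1 := Real.smoothTransition.le_one _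

theorem eventually_cutoff_eq {s : ℝ} (hs : s ∈ Ioo 0 (2 * Real.pi)) :
    ∀ᶠ n in atTop, cutoff n s = 1 ∧ cutoffDeriv n s = 0 := by
  have hp : 0 < s * (2 * Real.pi - s) := mul_pos hs.1 (sub_pos.2 hs.2)
  have ht : Tendsto (fun n : ℕ => (n : ℝ) * (s * (2 * Real.pi - s))) atTop atTop :=
    tendsto_natCast_atTop_atTop.atTop_mul_const hp
  filter_upwards [ht.eventually_gt_atTop 2] with n hn
  refine ⟨Real.smoothTransition.one_of_one_le (by linarith), ?_⟩
  rw [cutoffDeriv, deriv_smoothTransition_of_one_lt (by linarith), zero_mul]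

/-- The derivative of the cutoff against a function vanishing linearly at both ends. -/
theorem abs_cutoffDeriv_mul_le {L : ℝ} (hL0 : 0 ≤ L)
    (hL : ∀ w, |deriv Real.smoothTransition w| ≤ L) (n : ℕ) {s a K : ℝ}
    (hs : s ∈ Ioo 0 (2 * Real.pi)) (hK : 0 ≤ K) (h1 : |a| ≤ K * s)
    (h2 : |a| ≤ K * (2 * Real.pi - s)) : |cutoffDeriv n s * a| ≤ 4 * L * K := by
  have hpi := Real.pi_pos
  have hp : 0 < s * (2 * Real.pi - s) := mul_pos hs.1 (sub_pos.2 hs.2)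
  -- Where `n s (2π - s) > 2` the cutoff is locally constant. Elsewhere the two linear bounds
  -- combine to `π |a| ≤ K s (2π - s)`, because `s` or `2π - s` is at least `π`; with the factor `2π
  -- n L` of the derivative this gives `4LK`.
  rcases lt_or_ge 2 (n * (s * (2 * Real.pi - s))) with h | h
  · rw [cutoffDeriv, deriv_smoothTransition_of_one_lt (by linarith), zero_mul, zero_mul, abs_zero]
    positivity
  · have ha : |a| * Real.pi ≤ K * (s * (2 * Real.pi - s)) := by
      rcases le_total s Real.pi with h3 | h3
      · calc |a| * Real.pi ≤ (K * s) * (2 * Real.pi - s) := by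
              apply mul_le_mul h1 (by linarith) hpi.le
              exact mul_nonneg hK hs.1.le
          _ = _ := by ring
      · calc |a| * Real.pi ≤ (K * (2 * Real.pi - s)) * s := by
              apply mul_le_mul h2 h3 hpi.le
              exact mul_nonneg hK (sub_pos.2 hs.2).le
          _ = _ := by ring
    have h5 : |2 * Real.pi - 2 * s| ≤ 2 * Real.pi := abs_le.2 ⟨by linarith [hs.2], by linarith [hs.1]⟩
    rw [cutoffDeriv, abs_mul, abs_mul, abs_mul, Nat.abs_cast]
    have hn : (0 : ℝ) ≤ n := Nat.cast_nonneg n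
    calc |deriv Real.smoothTransition (n * (s * (2 * Real.pi - s)) - 1)|
          * (n * |2 * Real.pi - 2 * s|) * |a|
        ≤ L * (n * (2 * Real.pi)) * |a| := by gcongr; exact hL _
      _ = 2 * L * (n * (|a| * Real.pi)) := by ring
      _ ≤ 2 * L * (n * (K * (s * (2 * Real.pi - s)))) := by gcongr
      _ = 2 * L * K * (n * (s * (2 * Real.pi - s))) := by ring
      _ ≤ 2 * L * K * 2 := by gcongr
      _ = _ := by ring

/-- The cutoff of the cell. -/
noncomputable def cellCutoff {d : ℕ} (n : ℕ) (x : Space d) : ℝ := ∏ i, cutoff n (x i)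

theorem contDiff_cellCutoff {d : ℕ} (n : ℕ) {m : ℕ∞} : ContDiff ℝ m (cellCutoff (d := d) n) := by
  unfold cellCutoff
  exact contDiff_prod fun i _ => (contDiff_cutoff n).comp
    ((EuclideanSpace.proj i : Space d →L[ℝ] ℝ)).contDiff

theorem cellCutoff_nonneg {d : ℕ} (n : ℕ) (x : Space d) : 0 ≤ cellCutoff n x :=
  Finset.prod_nonneg fun i _ => cutoff_nonneg n (x i)

theorem cellCutoff_le_one {d : ℕ} (n : ℕ) (x : Space d) : cellCutoff n x ≤ 1 :=
  Finset.prod_le_one (fun i _ => cutoff_nonneg n (x i)) fun i _ => cutoff_le_one n (x i)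

/-- The support lies in the closed set where `n x_i (2π - x_i) ≥ 1` for all `i`, at positive
distance from the faces. For `n = 0` it is empty unless there are no coordinates at all. -/
theorem tsupport_cellCutoff_subset {d : ℕ} (n : ℕ) : tsupport (cellCutoff (d := d) n) ⊆ cell d := by
  have hcl : IsClosed {x : Space d | ∀ i, 1 ≤ n * (x i * (2 * Real.pi - x i))} := by
    simp only [ofPred_forall]
    exact isClosed_iInter fun i => isClosed_le continuous_const (by fun_prop)
  have hsub : tsupport (cellCutoff (d := d) n)
      ⊆ {x : Space d | ∀ i, 1 ≤ n * (x i * (2 * Real.pi - x i))} := by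
    refine closure_minimal (fun x hx i => ?_) hcl
    by_contra hcon
    push Not at hcon
    refine hx (Finset.prod_eq_zero (Finset.mem_univ i) ?_)
    exact Real.smoothTransition.zero_of_nonpos (by linarith)
  refine hsub.trans fun x hx i => ?_
  have h := hx i
  have hpi := Real.pi_pos
  have hn : (0 : ℝ) ≤ n := Nat.cast_nonneg n
  have hp : 0 < x i * (2 * Real.pi - x i) := by
    by_contra hcon
    push Not at hcon
    have := mul_nonpos_of_nonneg_of_nonpos hn hcon
    linarith
  rcases (mul_pos_iff.1 hp) with h | h
  · exact ⟨h.1, by linarith [h.2]⟩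
  · exfalso; linarith [h.1, h.2]

theorem isBounded_cell (d : ℕ) : Bornology.IsBounded (cell d) :=
  ((isCompact_box d).isBounded).subset fun _ hx => ⟨fun j => (hx j).1.le, fun j => (hx j).2.le⟩

theorem hasCompactSupport_cellCutoff {d : ℕ} (n : ℕ) : HasCompactSupport (cellCutoff (d := d) n) :=
  Metric.isCompact_of_isClosed_isBounded (isClosed_tsupport _)
    ((isBounded_cell d).subset (tsupport_cellCutoff_subset n))

/-- A bounded periodic `C¹` function tests the variation in the open cell, up to a factor `2`. -/
theorem neg_integral_mul_partialDeriv_le {d : ℕ} {g Ψ : Space d → ℝ} {B : ℝ≥0} {M K : ℝ}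
    (hB : variationBV g ≤ (B : ℝ≥0∞)) (mg : AEStronglyMeasurable g volume) (hM : ∀ᵐ x, |g x| ≤ M)
    (hΨ : ContDiff ℝ 1 Ψ) (pΨ : CellPeriodic Ψ) (hK : 0 < K) (bΨ : ∀ x, |Ψ x| ≤ K) (j : Fin d) :
    -∫ x in cell d, g x * partialDeriv j Ψ x ≤ 2 * K * B := by
  set e : Space d := EuclideanSpace.single j (1 : ℝ) with he
  obtain ⟨L', hL'⟩ := exists_bound_of_periodic (pΨ.partialDeriv j) (continuous_partialDeriv hΨ j)
  have hL'0 : 0 ≤ L' := (norm_nonneg _).trans (hL' 0)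
  obtain ⟨L, hL0, hL⟩ := exists_bound_deriv_smoothTransition
  have hM0 : 0 ≤ |M| := abs_nonneg M
  set P : Space d → Space d := fun x => x - x j • e with hP
  have hPd : ContDiff ℝ 1 P := contDiff_id.sub
    (((EuclideanSpace.proj j : Space d →L[ℝ] ℝ)).contDiff.smul contDiff_const)
  have hPs : ∀ x : Space d, ∀ s : ℝ, P (x + s • e) = P x := by
    intro x s
    simp only [hP]
    have : (x + s • e) j = x j + s := by simp [he]
    rw [this, add_smul]; abel
  set Θ : Space d → ℝ := fun x => Ψ x - Ψ (P x) with hΘ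
  have hΘd : ContDiff ℝ 1 Θ := hΨ.sub (hΨ.comp hPd)
  have hlip : ∀ (y : Space d) (a b : ℝ), |Ψ (y + a • e) - Ψ (y + b • e)| ≤ L' * |a - b| := by
    intro y a b
    exact Convex.norm_image_sub_le_of_norm_hasDerivWithin_le (f := fun s : ℝ => Ψ (y + s • e))
      (s := univ) (C := L') (x := b) (y := a)
      (fun s _ => (hasDerivAt_comp_line (hΨ.differentiable one_ne_zero) j y s).hasDerivWithinAt)
      (fun s _ => hL' _) convex_univ trivial trivial
  have hPx : ∀ x : Space d, P x + x j • e = x := fun x => sub_add_cancel _ _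
  have hΘ1 : ∀ x ∈ cell d, |Θ x| ≤ L' * x j := by
    intro x hx
    have := hlip (P x) (x j) 0
    rw [hPx, zero_smul, add_zero, sub_zero, abs_of_pos (hx j).1] at this
    exact this
  have hΘ2 : ∀ x ∈ cell d, |Θ x| ≤ L' * (2 * Real.pi - x j) := by
    intro x hx
    have := hlip (P x) (x j) (2 * Real.pi)
    rw [hPx, ← single_eq_smul, pΨ j (P x), abs_sub_comm (x j), abs_of_pos (sub_pos.2 (hx j).2)]
      at this
    exact this
  have hΘb : ∀ x, |Θ x| ≤ 2 * K := fun x => (abs_sub _ _).trans (by linarith [bΨ x, bΨ (P x)])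
  set H : ℕ → Space d → ℝ := fun n x => cellCutoff n x * Θ x with hH
  have hHd : ∀ n, ContDiff ℝ 1 (H n) := fun n => (contDiff_cellCutoff n (m := 1)).mul hΘd
  -- Only the cutoff in the `j`-th coordinate is differentiated; the cutoffs in the other
  -- coordinates, where `Θ` need not vanish at the faces, are merely bounded by one.
  have hHder : ∀ n x, partialDeriv j (H n) x
      = cutoffDeriv n (x j) * (∏ i ∈ Finset.univ.erase j, cutoff n (x i)) * Θ x
        + cellCutoff n x * partialDeriv j Ψ x := by
    intro n x
    refine partialDeriv_eq_of_hasDerivAt ((hHd n).differentiable one_ne_zero) ?_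
    have e1 : ∀ s : ℝ, H n (x + s • e) = cutoff n (x j + s)
        * (∏ i ∈ Finset.univ.erase j, cutoff n (x i)) * (Ψ (x + s • e) - Ψ (P x)) := by
      intro s
      simp only [hH, hΘ, hPs, cellCutoff]
      rw [← Finset.mul_prod_erase Finset.univ _ (Finset.mem_univ j)]
      congr 2
      · simp [he]
      · refine Finset.prod_congr rfl fun i hi => ?_
        simp [he, Finset.ne_of_mem_erase hi]
    have e2 : cellCutoff n x
        = cutoff n (x j) * ∏ i ∈ Finset.univ.erase j, cutoff n (x i) :=
      (Finset.mul_prod_erase Finset.univ _ (Finset.mem_univ j)).symm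
    rw [show (fun s : ℝ => H n (x + s • EuclideanSpace.single j (1 : ℝ))) = _ from funext e1]
    have d1 : HasDerivAt (fun s : ℝ => cutoff n (x j + s)) (cutoffDeriv n (x j)) 0 := by
      have h1 := hasDerivAt_cutoff n (x j + 0)
      have h2 := HasDerivAt.comp (0 : ℝ) h1 ((hasDerivAt_id (0 : ℝ)).const_add (x j))
      simpa [Function.comp_def] using h2
    have d2 := (hasDerivAt_comp_line (hΨ.differentiable one_ne_zero) j x 0).sub_const (Ψ (P x))
    refine ((d1.mul_const _).mul d2).congr_deriv ?_
    rw [e2]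
    simp [hΘ]
  have htest : ∀ n, ∫ x in cell d, g x * partialDeriv j (H n) x ≥ -(2 * K * B) := by
    intro n
    -- The scaling makes the field admissible in the definition of the variation; the sign selects
    -- the needed one-sided bound.
    set Φ : Space d → Space d := fun x => (-(2 * K)⁻¹ * H n x) • e with hΦ
    have h1 : ContDiff ℝ 1 Φ := (contDiff_const.mul (hHd n)).smul contDiff_const
    have hsupp : tsupport Φ ⊆ tsupport (cellCutoff (d := d) n) := by
      refine closure_mono fun x hx => ?_
      contrapose! hx
      have : cellCutoff n x = 0 := by simpa using hx
      simp [hΦ, hH, this]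
    have h2 : HasCompactSupport Φ :=
      (hasCompactSupport_cellCutoff (d := d) n).mono' ((subset_tsupport Φ).trans hsupp)
    have h4 : ∀ x, ‖Φ x‖ ≤ 1 := by
      intro x
      have hen : ‖e‖ = 1 := by simp [he]
      simp only [hΦ, norm_smul, hen, mul_one, norm_mul, norm_neg, hH]
      rw [Real.norm_of_nonneg (by positivity : (0 : ℝ) ≤ (2 * K)⁻¹), inv_mul_le_iff₀ (by positivity),
        mul_one, Real.norm_of_nonneg (cellCutoff_nonneg n x)]
      exact (mul_le_of_le_one_left (norm_nonneg _) (cellCutoff_le_one n x)).trans (hΘb x)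
    have h := integral_mul_divergence_le hB h1 h2 (hsupp.trans (tsupport_cellCutoff_subset n)) h4
    have hdiv : ∀ x, divergence (fun y i => Φ y i) x = -(2 * K)⁻¹ * partialDeriv j (H n) x := by
      intro x
      unfold divergence
      rw [Finset.sum_eq_single j]
      · have : (fun y => Φ y j) = fun y => -(2 * K)⁻¹ * H n y := by ext y; simp [hΦ, he]
        rw [this]
        unfold partialDeriv
        rw [fderiv_const_mul ((hHd n).differentiable one_ne_zero x)]
        simp
      · intro i _ hij
        have : (fun y => Φ y i) = fun _ => 0 := by ext y; simp [hΦ, he, hij]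
        rw [this, partialDeriv_const]
      · simp
    simp only [hdiv, mul_left_comm (g _)] at h
    rw [integral_const_mul, neg_mul, neg_le, inv_mul_eq_div] at h
    rw [ge_iff_le, neg_le, ← sub_nonneg]
    have h2K : 0 < 2 * K := by positivity
    rw [← neg_le, neg_le_iff_add_nonneg] at h
    have := mul_nonneg h2K.le h
    rw [mul_add, mul_div_cancel₀ _ h2K.ne'] at this
    linarith
  have hae : ∀ᵐ x ∂(volume.restrict (cell d)), |g x| ≤ |M| :=
    ae_restrict_of_ae (hM.mono fun x hx => hx.trans (le_abs_self M))
  have hmem : ∀ᵐ x ∂(volume.restrict (cell d)), x ∈ cell d := ae_restrict_mem (measurableSet_cell d)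
  -- Near the two faces the cutoff derivative grows like the inverse distance while `Θ` is bounded
  -- by a multiple of the distance. The product is bounded and vanishes eventually at each interior
  -- point.
  have hlim : Tendsto (fun n => ∫ x in cell d, g x * partialDeriv j (H n) x) atTop
      (𝓝 (∫ x in cell d, g x * partialDeriv j Ψ x)) := by
    refine tendsto_integral_of_dominated_convergence (fun _ => |M| * (4 * L * L' + L'))
      (fun n => mg.restrict.mul (continuous_partialDeriv (hHd n) j).aestronglyMeasurable)
      (integrable_const _) (fun n => ?_) ?_
    · filter_upwards [hae, hmem] with x hx hxc
      rw [norm_mul]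
      refine mul_le_mul hx ?_ (norm_nonneg _) hM0
      rw [hHder, Real.norm_eq_abs]
      refine (abs_add_le _ _).trans (add_le_add ?_ ?_)
      · rw [mul_right_comm, abs_mul]
        have h1 := abs_cutoffDeriv_mul_le hL0 hL n (hxc j) hL'0 (hΘ1 x hxc) (hΘ2 x hxc)
        have h2 : |∏ i ∈ Finset.univ.erase j, cutoff n (x i)| ≤ 1 := by
          rw [abs_of_nonneg (Finset.prod_nonneg fun i _ => cutoff_nonneg n (x i))]
          exact Finset.prod_le_one (fun i _ => cutoff_nonneg n (x i)) fun i _ => cutoff_le_one n (x i)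
        exact (mul_le_of_le_one_right (abs_nonneg _) h2).trans h1
      · rw [abs_mul, abs_of_nonneg (cellCutoff_nonneg n x)]
        exact (mul_le_of_le_one_left (abs_nonneg _) (cellCutoff_le_one n x)).trans (hL' x)
    · filter_upwards [hmem] with x hxc
      refine Tendsto.const_mul _ (tendsto_const_nhds.congr' ?_)
      have := eventually_all.2 fun i => eventually_cutoff_eq (hxc i)
      filter_upwards [this] with n hn
      rw [hHder, (hn j).2, show cellCutoff n x = 1 from Finset.prod_eq_one fun i _ => (hn i).1]
      ring
  have := ge_of_tendsto hlim (Eventually.of_forall htest)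
  linarith

/-- By duality the translation is moved to the smooth weight: `s ↦ ∫ g ψ(· - s e_j)` has derivative
at most `2B` by the variation bound for the translated weight, and the mean value inequality
concludes. -/
theorem integral_translate_sub_mul_le {d : ℕ} {g ψ : Space d → ℝ} {B : ℝ≥0} {M : ℝ}
    (hB : variationBV g ≤ (B : ℝ≥0∞)) (mg : AEStronglyMeasurable g volume) (hM : ∀ᵐ x, |g x| ≤ M)
    (pg : CellPeriodic g) (hψ : ContDiff ℝ 1 ψ) (pψ : CellPeriodic ψ) (bψ : ∀ x, |ψ x| ≤ 1)
    (j : Fin d) {τ : ℝ} (hτ : 0 ≤ τ) :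
    ∫ x in cell d, (g (x + EuclideanSpace.single j τ) - g x) * ψ x ≤ 2 * B * τ := by
  set e : Space d := EuclideanSpace.single j (1 : ℝ) with he
  obtain ⟨L, hL⟩ := exists_bound_of_periodic (pψ.partialDeriv j) (continuous_partialDeriv hψ j)
  have hψc : Continuous ψ := hψ.continuous
  have hint : ∀ {F : Space d → ℝ} {C : ℝ}, Continuous F → (∀ x, |F x| ≤ C) →
      Integrable (fun x => g x * F x) (volume.restrict (cell d)) := by
    intro F C hF hC
    refine Integrable.of_bound (C := |M| * |C|)
      (mg.restrict.mul hF.aestronglyMeasurable) ?_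
    filter_upwards [ae_restrict_of_ae hM] with x hx
    rw [norm_mul]
    exact mul_le_mul (hx.trans (le_abs_self M)) ((hC x).trans (le_abs_self C)) (norm_nonneg _)
      (abs_nonneg _)
  have hsd : ∀ (x : Space d) (s : ℝ),
      HasDerivAt (fun s : ℝ => ψ (x - s • e)) (-partialDeriv j ψ (x - s • e)) s := by
    intro x s
    have h1 := hasDerivAt_comp_line (hψ.differentiable one_ne_zero) j x (-s)
    have h2 := HasDerivAt.comp s h1 (hasDerivAt_neg s)
    simpa [Function.comp_def, sub_eq_add_neg] using h2
  set h : ℝ → ℝ := fun s => ∫ x in cell d, g x * ψ (x - s • e) with hh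
  have hder : ∀ s, HasDerivAt h (∫ x in cell d, g x * -partialDeriv j ψ (x - s • e)) s := by
    intro s
    refine (hasDerivAt_integral_of_dominated_loc_of_deriv_le (μ := volume.restrict (cell d)) (F := fun s x => g x * ψ (x - s • e)) (F' := fun s x => g x * -partialDeriv j ψ (x - s • e)) (s := univ)
      (bound := fun _ => |M| * L) univ_mem ?_ ?_ ?_ ?_ ?_ ?_).2
    · exact Eventually.of_forall fun s => mg.restrict.mul
        (hψc.comp (continuous_id.sub continuous_const)).aestronglyMeasurable
    · exact hint (hψc.comp (continuous_id.sub continuous_const)) fun x => bψ _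
    · exact mg.restrict.mul (((continuous_partialDeriv hψ j).comp
        (continuous_id.sub continuous_const)).neg).aestronglyMeasurable
    · filter_upwards [ae_restrict_of_ae hM] with x hx s _
      rw [norm_mul, norm_neg]
      exact mul_le_mul (hx.trans (le_abs_self M)) (hL _) (norm_nonneg _) (abs_nonneg _)
    · exact integrable_const _
    · exact Eventually.of_forall fun x s _ => (hsd x s).const_mul _
  have hle : ∀ s, deriv h s ≤ 2 * B := by
    intro s
    rw [(hder s).deriv]
    have hΨ : ContDiff ℝ 1 fun x => ψ (x - s • e) := hψ.comp (contDiff_id.sub contDiff_const)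
    have pΨ : CellPeriodic fun x => ψ (x - s • e) := fun i x => by
      simp only
      rw [add_sub_right_comm]; exact pψ i _
    have := neg_integral_mul_partialDeriv_le hB mg hM hΨ pΨ one_pos (fun x => bψ _) j
    rw [← integral_neg] at this
    refine le_trans (le_of_eq ?_) (this.trans (by simp))
    refine integral_congr_ae (Eventually.of_forall fun x => ?_)
    have hp : partialDeriv j (fun x => ψ (x - s • e)) x = partialDeriv j ψ (x - s • e) := by
      simp only [partialDeriv, sub_eq_add_neg, fderiv_comp_add_right]
    simp only [hp, mul_neg]
  have hmv := image_sub_le_mul_sub_of_deriv_le (fun s => (hder s).differentiableAt) hle hτ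
  rw [sub_zero] at hmv
  refine le_trans (le_of_eq ?_) hmv
  have e1 : ∫ x in cell d, g (x + EuclideanSpace.single j τ) * ψ x = h τ := by
    simp only [hh]
    rw [← setIntegral_cell_add (g := fun x => g x * ψ (x - τ • e)) ?_
      (EuclideanSpace.single j τ)]
    · simp only [single_eq_smul j τ, he, add_sub_cancel_right]
    · intro i x
      simp only
      rw [pg i x, add_sub_right_comm, pψ i]
  have e0 : ∫ x in cell d, g x * ψ x = h 0 := by simp [hh]
  rw [← e1, ← e0, ← integral_sub ?_ (hint hψc bψ)]
  · exact integral_congr_ae (Eventually.of_forall fun x => sub_mul _ _ _)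
  · have hM' : ∀ᵐ x, |g (x + EuclideanSpace.single j τ)| ≤ M :=
      (measurePreserving_add_right volume _).quasiMeasurePreserving.ae hM
    refine Integrable.of_bound (C := |M|) (((mg.comp_measurePreserving
      (measurePreserving_add_right volume _)).restrict).mul hψc.aestronglyMeasurable) ?_
    filter_upwards [ae_restrict_of_ae hM'] with x hx
    rw [norm_mul]
    exact (mul_le_of_le_one_right (norm_nonneg _) (bψ x)).trans (hx.trans (le_abs_self M))

open scoped Convolution in
/-- A bounded periodic function is an a.e. limit of equibounded smooth periodic functions. -/
theorem exists_smooth_periodic_approx {d : ℕ} {σ : Space d → ℝ}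
    (mσ : AEStronglyMeasurable σ volume) (bσ : ∀ x, |σ x| ≤ 1) (pσ : CellPeriodic σ) :
    ∃ ψ : ℕ → Space d → ℝ, (∀ n, ContDiff ℝ 1 (ψ n)) ∧ (∀ n, CellPeriodic (ψ n)) ∧
      (∀ n x, |ψ n x| ≤ 1) ∧ ∀ᵐ x, Tendsto (fun n => ψ n x) atTop (𝓝 (σ x)) := by
  have hpos : ∀ n : ℕ, (0 : ℝ) < 1 / ((n : ℝ) + 1) := fun n => by positivity
  let b : ℕ → ContDiffBump (0 : Space d) := fun n =>
    ⟨1 / ((n : ℝ) + 1), 2 * (1 / ((n : ℝ) + 1)), hpos n, by linarith [hpos n]⟩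
  have hloc : LocallyIntegrable σ volume := by
    refine (locallyIntegrable_const (1 : ℝ)).mono mσ (Eventually.of_forall fun x => ?_)
    simpa using bσ x
  have hb : ∀ n x, (((b n).normed volume ⋆[ContinuousLinearMap.lsmul ℝ ℝ, volume] σ) x)
      = ∫ y, (b n).normed volume y * σ (x - y) := fun n x => by
    simp [MeasureTheory.convolution]
  refine ⟨fun n => (b n).normed volume ⋆[ContinuousLinearMap.lsmul ℝ ℝ, volume] σ,
    fun n => ?_, fun n i x => ?_, fun n x => ?_, ?_⟩
  · exact (b n).hasCompactSupport_normed.contDiff_convolution_left _ (b n).contDiff_normed hloc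
  · simp only [hb]
    refine integral_congr_ae (Eventually.of_forall fun y => ?_)
    simp only
    rw [add_sub_right_comm, pσ i]
  · simp only [hb]
    rw [← Real.norm_eq_abs]
    refine (norm_integral_le_of_norm_le (b n).integrable_normed
      (Eventually.of_forall fun y => ?_)).trans (b n).integral_normed.le
    rw [norm_mul, Real.norm_of_nonneg ((b n).nonneg_normed y)]
    exact mul_le_of_le_one_right ((b n).nonneg_normed y) (bσ _)
  -- The ratio of outer to inner radius of the bumps is `2` for every `n`; this bounded ratio is
  -- what Lebesgue differentiation asks for, with `K = 2`.
  · refine ContDiffBump.ae_convolution_tendsto_right_of_locallyIntegrable (K := 2) ?_ ?_ hloc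
    · have := (tendsto_one_div_add_atTop_nhds_zero_nat (𝕜 := ℝ)).const_mul 2
      rw [mul_zero] at this; exact this
    · exact Eventually.of_forall fun n => le_rfl

/-- The optimal weight is the sign of the increment. It is not smooth, but it is an almost
everywhere limit of admissible periodic weights. -/
theorem integral_abs_translate_sub_le {d : ℕ} {g : Space d → ℝ} {B : ℝ≥0} {M : ℝ}
    (hB : variationBV g ≤ (B : ℝ≥0∞)) (mg : AEStronglyMeasurable g volume) (hM : ∀ᵐ x, |g x| ≤ M)
    (pg : CellPeriodic g) (j : Fin d) {τ : ℝ} (hτ : 0 ≤ τ) :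
    ∫ x in cell d, |g (x + EuclideanSpace.single j τ) - g x| ≤ 2 * B * τ := by
  set w : Space d → ℝ := fun x => g (x + EuclideanSpace.single j τ) - g x with hw
  have mw : AEStronglyMeasurable w volume :=
    (mg.comp_measurePreserving (measurePreserving_add_right volume _)).sub mg
  have hwM : ∀ᵐ x, |w x| ≤ M + M := by
    have hM' : ∀ᵐ x, |g (x + EuclideanSpace.single j τ)| ≤ M :=
      (measurePreserving_add_right volume _).quasiMeasurePreserving.ae hM
    filter_upwards [hM, hM'] with x h1 h2
    exact (abs_sub _ _).trans (add_le_add h2 h1)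
  obtain ⟨ψ, dψ, pψ, bψ, lψ⟩ := exists_smooth_periodic_approx
    (σ := fun x => Real.sign (w x))
    (measurable_sign.comp_aemeasurable mw.aemeasurable).aestronglyMeasurable
    (fun x => abs_sign_le_one _) (fun i x => by
      simp only [hw]
      rw [add_right_comm, pg i, pg i])
  have hlim : Tendsto (fun n => ∫ x in cell d, w x * ψ n x) atTop
      (𝓝 (∫ x in cell d, w x * Real.sign (w x))) := by
    refine tendsto_integral_of_dominated_convergence (fun _ => M + M)
      (fun n => mw.restrict.mul (dψ n).continuous.aestronglyMeasurable) (integrable_const _)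
      (fun n => ?_) ?_
    · filter_upwards [ae_restrict_of_ae hwM] with x hx
      rw [norm_mul]
      exact (mul_le_of_le_one_right (norm_nonneg _) (bψ n x)).trans hx
    · filter_upwards [ae_restrict_of_ae lψ] with x hx
      exact hx.const_mul _
  have := le_of_tendsto' hlim fun n =>
    integral_translate_sub_mul_le hB mg hM pg (dψ n) (pψ n) (bψ n) j hτ
  refine le_trans (le_of_eq (integral_congr_ae (Eventually.of_forall fun x => ?_))) this
  simp only
  rw [mul_comm, sign_mul_self_eq_abs]

/-- The contraction between a solution and its translate passes the `L¹` modulus of `u₀` to time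
`t`; for a `C¹` function this modulus controls the derivative. -/
theorem IsViscousSolution.integral_abs_partialDeriv_le {d : ℕ} {f : Fin d → ℝ → ℝ}
    {μ : Measure (Space d)} {T ε : ℝ} {u₀ : Space d → ℝ} {v : Space d → ℝ → ℝ} {B : ℝ≥0}
    (hμ : IsLevyMeasure μ) (hf : ∀ j, ContDiff ℝ 1 (f j)) (hε : 0 ≤ ε)
    (hv : IsViscousSolution f μ T ε u₀ v) (hu₀ : EssBounded u₀) (pu : CellPeriodic u₀)
    (hB : variationBV u₀ ≤ (B : ℝ≥0∞)) {t : ℝ} (ht : t ∈ Ioo 0 T) (j : Fin d) :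
    ∫ x in cell d, |partialDeriv j (fun x => v x t) x| ≤ 2 * B := by
  obtain ⟨mu, M, hM⟩ := hu₀
  have hV := hv.contDiff_space t ht
  have hc : Continuous fun x => v x t := hV.continuous
  refine FracCL.integral_abs_partialDeriv_le (hV.of_le one_le_two) (hv.periodic t ht) j
    fun τ hτ => ?_
  have h1 := hv.distL1_translate_le hμ hf hε mu pu ht (EuclideanSpace.single j τ)
  have mt : AEStronglyMeasurable (fun x => u₀ (x + EuclideanSpace.single j τ)) volume :=
    mu.comp_measurePreserving (measurePreserving_add_right volume _)
  have hM' : ∀ᵐ x, |u₀ (x + EuclideanSpace.single j τ)| ≤ M :=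
    (measurePreserving_add_right volume _).quasiMeasurePreserving.ae hM
  have i1 : Integrable (fun x => u₀ (x + EuclideanSpace.single j τ) - u₀ x)
      (volume.restrict (cell d)) :=
    (Integrable.of_bound mt.restrict M (ae_restrict_of_ae hM')).sub
      (Integrable.of_bound mu.restrict M (ae_restrict_of_ae hM))
  have i2 : Integrable (fun x => v (x + EuclideanSpace.single j τ) t - v x t)
      (volume.restrict (cell d)) := by
    refine integrable_cell_of_continuous ((hc.comp (continuous_id.add continuous_const)).sub hc) ?_
    intro i x
    simp only
    rw [add_right_comm]
    exact congrArg₂ _ (hv.periodic t ht i _) (hv.periodic t ht i _)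
  rw [distL1_eq_ofReal i1.abs, distL1_eq_ofReal i2.abs, ENNReal.ofReal_le_ofReal_iff
    (integral_nonneg fun _ => abs_nonneg _)] at h1
  exact h1.trans (integral_abs_translate_sub_le hB mu hM pu j hτ.le)

/-! ### A periodic kernel -/

/-- The mass of `cos(s/2)^{2n}` over a period. -/
noncomputable def cosMass (n : ℕ) : ℝ := ∫ s in (0 : ℝ)..2 * Real.pi, Real.cos (s / 2) ^ (2 * n)

theorem cosMass_pos (n : ℕ) : 0 < cosMass n := by
  refine intervalIntegral.integral_pos Real.two_pi_pos (by fun_prop)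
    (fun s _ => (even_two_mul n).pow_nonneg _) ⟨0, ⟨le_rfl, Real.two_pi_pos.le⟩, by simp⟩

theorem cosMass_succ_le (n : ℕ) : cosMass (n + 1) ≤ cosMass n := by
  refine intervalIntegral.integral_mono Real.two_pi_pos.le
    (Continuous.intervalIntegrable (by fun_prop) _ _)
    (Continuous.intervalIntegrable (by fun_prop) _ _) fun s => ?_
  rw [mul_add, pow_add]
  refine mul_le_of_le_one_right ((even_two_mul n).pow_nonneg _) ?_
  simpa using Real.cos_sq_le_one (s / 2)

/-- This comes from integrating the derivative of `sin(s/2) cos(s/2)^{2n+1}` over a period. It is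
the second-moment identity of the kernel, and it shows that the kernel has width of order
`n^{-1/2}`. -/
theorem cosMass_succ_eq (n : ℕ) : cosMass (n + 1)
    = (2 * n + 1) * ∫ s in (0 : ℝ)..2 * Real.pi, Real.sin (s / 2) ^ 2 * Real.cos (s / 2) ^ (2 * n) := by
  have hd : ∀ s : ℝ, HasDerivAt (fun s : ℝ => Real.sin (s / 2) * Real.cos (s / 2) ^ (2 * n + 1))
      (1 / 2 * Real.cos (s / 2) ^ (2 * (n + 1))
        - (2 * n + 1) / 2 * (Real.sin (s / 2) ^ 2 * Real.cos (s / 2) ^ (2 * n))) s := by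
    intro s
    have h0 : HasDerivAt (fun s : ℝ => s / 2) (1 / 2) s := (hasDerivAt_id s).div_const 2
    refine (h0.sin.mul (h0.cos.pow (2 * n + 1))).congr_deriv ?_
    simp only [Pi.pow_apply, Nat.add_sub_cancel, Nat.cast_add, Nat.cast_mul, Nat.cast_ofNat,
      Nat.cast_one]
    ring
  have h := intervalIntegral.integral_eq_sub_of_hasDerivAt (a := 0) (b := 2 * Real.pi)
    (fun s _ => hd s) (Continuous.intervalIntegrable (by fun_prop) _ _)
  rw [intervalIntegral.integral_sub (Continuous.intervalIntegrable (by fun_prop) _ _)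
    (Continuous.intervalIntegrable (by fun_prop) _ _), intervalIntegral.integral_const_mul,
    intervalIntegral.integral_const_mul] at h
  simp only [zero_div, Real.sin_zero, zero_mul, sub_zero,
    mul_div_cancel_left₀ Real.pi two_ne_zero, Real.sin_pi] at h
  rw [cosMass]
  linarith

/-- Arithmetic-geometric mean inequality in the form used for the moments of the kernel. -/
theorem integral_abs_mul_le {a b : ℝ → ℝ} (ha : Continuous a) (hb : Continuous b) {A l : ℝ}
    (hl : 0 < l) (hA : ∫ s in (0 : ℝ)..2 * Real.pi, a s ^ 2 ≤ A / l ^ 2)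
    (hB : ∫ s in (0 : ℝ)..2 * Real.pi, b s ^ 2 ≤ A) :
    ∫ s in (0 : ℝ)..2 * Real.pi, |a s * b s| ≤ A / l := by
  have h1 : ∫ s in (0 : ℝ)..2 * Real.pi, |a s * b s|
      ≤ ∫ s in (0 : ℝ)..2 * Real.pi, (l / 2 * a s ^ 2 + 1 / (2 * l) * b s ^ 2) := by
    refine intervalIntegral.integral_mono Real.two_pi_pos.le
      (Continuous.intervalIntegrable (by fun_prop) _ _)
      (Continuous.intervalIntegrable (by fun_prop) _ _) fun s => ?_
    -- The weighted form `|ab| ≤ (l/2) a² + b²/(2l)`, with `l` balancing the two integrals, yields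
    -- the same bound as the Cauchy–Schwarz inequality.
    have h2 : 0 ≤ (l * |a s| - |b s|) ^ 2 / (2 * l) := by positivity
    have h3 : (l * |a s| - |b s|) ^ 2 / (2 * l)
        = l / 2 * |a s| ^ 2 + 1 / (2 * l) * |b s| ^ 2 - |a s| * |b s| := by
      field_simp; ring
    simp only [abs_mul]
    rw [sq_abs, sq_abs] at h3
    linarith
  refine h1.trans ?_
  rw [intervalIntegral.integral_add (Continuous.intervalIntegrable (by fun_prop) _ _)
    (Continuous.intervalIntegrable (by fun_prop) _ _), intervalIntegral.integral_const_mul,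
    intervalIntegral.integral_const_mul]
  have h4 := mul_le_mul_of_nonneg_left hA (by positivity : (0 : ℝ) ≤ l / 2)
  have h5 := mul_le_mul_of_nonneg_left hB (by positivity : (0 : ℝ) ≤ 1 / (2 * l))
  refine (add_le_add h4 h5).trans (le_of_eq ?_)
  field_simp; ring

/-- The one-dimensional kernel `cos(s/2)^{2n}`, normalised. -/
noncomputable def cosKernel (n : ℕ) (s : ℝ) : ℝ := Real.cos (s / 2) ^ (2 * n) / cosMass n

/-- The derivative of `cosKernel`. -/
noncomputable def cosKernelDeriv (n : ℕ) (s : ℝ) : ℝ :=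
  -(n * (Real.sin (s / 2) * Real.cos (s / 2) ^ (2 * n - 1)) / cosMass n)

theorem hasDerivAt_cosKernel (n : ℕ) (s : ℝ) :
    HasDerivAt (cosKernel n) (cosKernelDeriv n s) s := by
  have h0 : HasDerivAt (fun s : ℝ => s / 2) (1 / 2) s := (hasDerivAt_id s).div_const 2
  refine ((h0.cos.pow (2 * n)).div_const (cosMass n)).congr_deriv ?_
  rw [cosKernelDeriv]
  push_cast
  ring

theorem contDiff_cosKernel (n : ℕ) {m : WithTop ℕ∞} : ContDiff ℝ m (cosKernel n) :=
  ((Real.contDiff_cos.comp (contDiff_id.div_const 2)).pow _).div_const _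

theorem cosKernel_nonneg (n : ℕ) (s : ℝ) : 0 ≤ cosKernel n s :=
  div_nonneg ((even_two_mul n).pow_nonneg _) (cosMass_pos n).le

theorem cosKernel_neg (n : ℕ) (s : ℝ) : cosKernel n (-s) = cosKernel n s := by
  rw [cosKernel, neg_div, Real.cos_neg, cosKernel]

theorem cosKernel_add_two_pi (n : ℕ) (s : ℝ) : cosKernel n (s + 2 * Real.pi) = cosKernel n s := by
  rw [cosKernel, add_div, mul_div_cancel_left₀ Real.pi two_ne_zero, Real.cos_add_pi,
    (even_two_mul n).neg_pow, cosKernel]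

theorem setIntegral_Ioo_eq (g : ℝ → ℝ) :
    ∫ s in Ioo (0 : ℝ) (2 * Real.pi), g s = ∫ s in (0 : ℝ)..2 * Real.pi, g s := by
  rw [intervalIntegral.integral_of_le Real.two_pi_pos.le, integral_Ioc_eq_integral_Ioo]

theorem integral_cosKernel (n : ℕ) : ∫ s in Ioo (0 : ℝ) (2 * Real.pi), cosKernel n s = 1 := by
  rw [setIntegral_Ioo_eq]
  simp only [cosKernel]
  rw [intervalIntegral.integral_div]
  exact div_self (cosMass_pos n).ne'

/-- For `n = m + 1` the modulus of the derivative is, up to normalisation, `n` times the product of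
`|sin cos^m|` and `|cos^{m+1}|`; their squares integrate to `cosMass (m+1)/(2m+1)` and `cosMass
(m+1)`. The result `(m+1)/√(2m+1)` is at most `√(m+1)`. -/
theorem integral_abs_cosKernelDeriv_le (n : ℕ) :
    ∫ s in Ioo (0 : ℝ) (2 * Real.pi), |cosKernelDeriv n s| ≤ Real.sqrt n := by
  rw [setIntegral_Ioo_eq]
  rcases n with _ | m
  · simp [cosKernelDeriv]
  have hZ := cosMass_pos (m + 1)
  have hl : (0 : ℝ) < 2 * m + 1 := by positivity
  have h1 := integral_abs_mul_le (a := fun s => Real.sin (s / 2) * Real.cos (s / 2) ^ m)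
    (b := fun s => Real.cos (s / 2) ^ (m + 1)) (A := cosMass (m + 1)) (l := Real.sqrt (2 * m + 1))
    (by fun_prop) (by fun_prop) (Real.sqrt_pos.2 hl) (by
      rw [Real.sq_sqrt hl.le, le_div_iff₀ hl, cosMass_succ_eq, mul_comm]
      refine le_of_eq ?_
      congr 1
      refine intervalIntegral.integral_congr fun s _ => ?_
      ring) (by
      refine le_of_eq (intervalIntegral.integral_congr fun s _ => ?_)
      ring)
  have h2 : ∀ s, |cosKernelDeriv (m + 1) s| = ((m : ℝ) + 1) / cosMass (m + 1)
      * |Real.sin (s / 2) * Real.cos (s / 2) ^ m * Real.cos (s / 2) ^ (m + 1)| := by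
    intro s
    rw [cosKernelDeriv, abs_neg, abs_div, abs_mul, abs_of_pos hZ, mul_div_right_comm]
    congr 1
    · push_cast; rw [abs_of_nonneg (by positivity)]
    · congr 1
      rw [mul_assoc, ← pow_add]; congr 2; omega
  simp only [h2]
  rw [intervalIntegral.integral_const_mul]
  refine (mul_le_mul_of_nonneg_left h1 (by positivity)).trans ?_
  have e : ((m : ℝ) + 1) / cosMass (m + 1) * (cosMass (m + 1) / Real.sqrt (2 * m + 1))
      = (m + 1) / Real.sqrt (2 * m + 1) := by
    field_simp
  rw [e, div_le_iff₀ (Real.sqrt_pos.2 hl), ← Real.sqrt_mul (by positivity)]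
  refine Real.le_sqrt_of_sq_le ?_
  push_cast
  nlinarith [Nat.cast_nonneg (α := ℝ) m]

/-- The periodic first moment, with `|sin(s/2)|` as distance from the lattice of periods. It is
bounded by the square root of the second moment, which is at most `1/(2n+1)`. -/
theorem integral_abs_sin_mul_cosKernel_le (n : ℕ) :
    ∫ s in Ioo (0 : ℝ) (2 * Real.pi), |Real.sin (s / 2)| * cosKernel n s
      ≤ 1 / Real.sqrt (n + 1) := by
  rw [setIntegral_Ioo_eq]
  have hZ := cosMass_pos n
  have hl : (0 : ℝ) < 2 * n + 1 := by positivity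
  have h1 := integral_abs_mul_le (a := fun s => Real.sin (s / 2) * Real.cos (s / 2) ^ n)
    (b := fun s => Real.cos (s / 2) ^ n) (A := cosMass n) (l := Real.sqrt (2 * n + 1))
    (by fun_prop) (by fun_prop) (Real.sqrt_pos.2 hl) (by
      rw [Real.sq_sqrt hl.le, le_div_iff₀ hl]
      refine le_trans (le_of_eq ?_) (cosMass_succ_le n)
      rw [cosMass_succ_eq, mul_comm]
      congr 1
      refine intervalIntegral.integral_congr fun s _ => ?_
      ring) (by
      refine le_of_eq (intervalIntegral.integral_congr fun s _ => ?_)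
      ring)
  have h2 : ∀ s, |Real.sin (s / 2)| * cosKernel n s = (cosMass n)⁻¹
      * |Real.sin (s / 2) * Real.cos (s / 2) ^ n * Real.cos (s / 2) ^ n| := by
    intro s
    rw [cosKernel, mul_assoc, ← pow_add, ← two_mul, abs_mul,
      abs_of_nonneg ((even_two_mul n).pow_nonneg (Real.cos (s / 2)))]
    ring
  simp only [h2]
  rw [intervalIntegral.integral_const_mul]
  refine (mul_le_mul_of_nonneg_left h1 (by positivity)).trans ?_
  rw [div_eq_mul_inv (cosMass n), inv_mul_cancel_left₀ hZ.ne', one_div]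
  refine inv_anti₀ (Real.sqrt_pos.2 (by positivity)) (Real.sqrt_le_sqrt ?_)
  linarith [Nat.cast_nonneg (α := ℝ) n]

/-- The kernel `∏_j c_n cos(h_j/2)^{2n}` on the torus. -/
noncomputable def torusKernel {d : ℕ} (n : ℕ) (h : Space d) : ℝ := ∏ j, cosKernel n (h j)

theorem contDiff_torusKernel {d : ℕ} (n : ℕ) {m : WithTop ℕ∞} :
    ContDiff ℝ m (torusKernel (d := d) n) :=
  contDiff_prod fun i _ => (contDiff_cosKernel n).comp (EuclideanSpace.proj i : Space d →L[ℝ] ℝ).contDiff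

theorem torusKernel_nonneg {d : ℕ} (n : ℕ) (h : Space d) : 0 ≤ torusKernel n h :=
  Finset.prod_nonneg fun _ _ => cosKernel_nonneg n _

theorem torusKernel_neg {d : ℕ} (n : ℕ) (h : Space d) : torusKernel n (-h) = torusKernel n h :=
  Finset.prod_congr rfl fun j _ => cosKernel_neg n (h j)

theorem cellPeriodic_torusKernel {d : ℕ} (n : ℕ) : CellPeriodic (torusKernel (d := d) n) := by
  intro j x
  refine Finset.prod_congr rfl fun i _ => ?_
  by_cases h : i = j
  · subst h; simpa using cosKernel_add_two_pi n (x i)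
  · simp [h]

theorem partialDeriv_torusKernel {d : ℕ} (n : ℕ) (j : Fin d) (x : Space d) :
    partialDeriv j (torusKernel n) x
      = cosKernelDeriv n (x j) * ∏ i ∈ Finset.univ.erase j, cosKernel n (x i) := by
  refine partialDeriv_eq_of_hasDerivAt ((contDiff_torusKernel n (m := 1)).differentiable one_ne_zero)
    ?_
  have e1 : ∀ s : ℝ, torusKernel n (x + s • EuclideanSpace.single j (1 : ℝ))
      = cosKernel n (x j + s) * ∏ i ∈ Finset.univ.erase j, cosKernel n (x i) := by
    intro s
    rw [torusKernel, ← Finset.mul_prod_erase Finset.univ _ (Finset.mem_univ j)]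
    congr 1
    · simp
    · refine Finset.prod_congr rfl fun i hi => ?_
      simp [Finset.ne_of_mem_erase hi]
  rw [show (fun s : ℝ => torusKernel n (x + s • EuclideanSpace.single j (1 : ℝ))) = _ from funext e1]
  refine HasDerivAt.mul_const ?_ _
  have h2 := HasDerivAt.comp (0 : ℝ) (hasDerivAt_cosKernel n (x j + 0))
    ((hasDerivAt_id (0 : ℝ)).const_add (x j))
  simpa [Function.comp_def] using h2

theorem setIntegral_cell_prod {d : ℕ} (g : Fin d → ℝ → ℝ) :
    ∫ x in cell d, ∏ i, g i (x i) = ∏ i, ∫ s in Ioo (0 : ℝ) (2 * Real.pi), g i s := by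
  have h := (EuclideanSpace.volume_preserving_symm_measurableEquiv_toLp (Fin d)).setIntegral_preimage_emb
    (MeasurableEquiv.measurableEmbedding _) (fun y : Fin d → ℝ => ∏ i, g i (y i))
    (univ.pi fun _ : Fin d => Ioo (0 : ℝ) (2 * Real.pi))
  rw [cell_eq_preimage]
  refine Eq.trans h ?_
  rw [volume_pi, Measure.restrict_pi_pi]
  exact integral_fintype_prod_eq_prod g

theorem integral_torusKernel {d : ℕ} (n : ℕ) : ∫ x in cell d, torusKernel n x = 1 := by
  simp only [torusKernel]
  rw [setIntegral_cell_prod fun _ => cosKernel n]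
  exact Finset.prod_eq_one fun _ _ => integral_cosKernel n

/-- All factors except the `j`-th have mass one, so moments and derivatives of the product kernel
reduce to one dimension. -/
theorem integral_mul_prod_erase {d : ℕ} (n : ℕ) (g : ℝ → ℝ) (j : Fin d) :
    ∫ x in cell d, g (x j) * ∏ i ∈ Finset.univ.erase j, cosKernel n (x i)
      = ∫ s in Ioo (0 : ℝ) (2 * Real.pi), g s := by
  have h := setIntegral_cell_prod (Function.update (fun _ : Fin d => cosKernel n) j g)
  rw [← Finset.mul_prod_erase Finset.univ _ (Finset.mem_univ j), Finset.prod_eq_one, mul_one,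
    Function.update_self] at h
  · rw [← h]
    refine integral_congr_ae (Eventually.of_forall fun x => ?_)
    simp only
    rw [← Finset.mul_prod_erase Finset.univ _ (Finset.mem_univ j), Function.update_self]
    congr 1
    exact Finset.prod_congr rfl fun i hi => by
      rw [Function.update_of_ne (Finset.ne_of_mem_erase hi)]
  · intro i hi
    rw [Function.update_of_ne (Finset.ne_of_mem_erase hi)]
    exact integral_cosKernel n

theorem integral_abs_partialDeriv_torusKernel_le {d : ℕ} (n : ℕ) (j : Fin d) :
    ∫ x in cell d, |partialDeriv j (torusKernel n) x| ≤ Real.sqrt n := by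
  refine le_trans (le_of_eq ?_) (integral_abs_cosKernelDeriv_le n)
  rw [← integral_mul_prod_erase n (fun s => |cosKernelDeriv n s|) j]
  refine integral_congr_ae (Eventually.of_forall fun x => ?_)
  simp only
  rw [partialDeriv_torusKernel, abs_mul,
    abs_of_nonneg (Finset.prod_nonneg fun i _ => cosKernel_nonneg n (x i))]

theorem integral_abs_sin_mul_torusKernel_le {d : ℕ} (n : ℕ) (j : Fin d) :
    ∫ x in cell d, |Real.sin (x j / 2)| * torusKernel n x ≤ 1 / Real.sqrt (n + 1) := by
  refine le_trans (le_of_eq ?_) (integral_abs_sin_mul_cosKernel_le n)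
  rw [← integral_mul_prod_erase n (fun s => |Real.sin (s / 2)| * cosKernel n s) j]
  refine integral_congr_ae (Eventually.of_forall fun x => ?_)
  simp only
  rw [torusKernel, ← Finset.mul_prod_erase Finset.univ _ (Finset.mem_univ j), mul_assoc]

theorem exists_taylorBound_torusKernel (d n : ℕ) :
    ∃ A, TaylorBound A (torusKernel (d := d) n) := by
  have h2 : ContDiff ℝ 2 (torusKernel (d := d) n) := contDiff_torusKernel n
  obtain ⟨A, hA⟩ := exists_bound_of_periodic
    (fun j => periodic_fderiv (periodic_fderiv (cellPeriodic_torusKernel (d := d) n j)))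
    ((h2.fderiv_right (m := 1) (by norm_num)).continuous_fderiv one_ne_zero)
  exact ⟨A, taylorBound_of_fderiv_two h2 hA⟩

/-! ### Bounded measurable versions of entropy solutions -/

theorem levyAdjointSmall_comp_sub {d : ℕ} (μ : Measure (Space d)) (r : ℝ) (Ω : Space d → ℝ)
    (y x : Space d) : levyAdjointSmall μ r (fun x => Ω (x - y)) x = levyAdjointSmall μ r Ω (x - y) := by
  unfold levyAdjointSmall compensator
  simp only [fderiv_comp_sub, sub_right_comm]

/-- Changing `u` on a null set must not alter the jump operator, although `μ` may be singular. For
every fixed jump `z` the translate of a null set is null, and Fubini exchanges "for every `z`,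
almost every point" with "almost every point, `μ`-almost every `z`". -/
theorem ae_levyLarge_eq {d : ℕ} {μ : Measure (Space d)} (hμ : IsLevyMeasure μ) {r : ℝ} (hr : 0 < r)
    {I : Set ℝ} {u U : Space d → ℝ → ℝ} (h : ∀ᵐ p : Space d × ℝ, p.2 ∈ I → u p.1 p.2 = U p.1 p.2) :
    ∀ᵐ p : Space d × ℝ, p.2 ∈ I → u p.1 p.2 = U p.1 p.2 ∧
      levyLarge μ r (fun x => u x p.2) p.1 = levyLarge μ r (fun x => U x p.2) p.1 := by
  have hfin := hμ.isFiniteMeasure_large hr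
  -- The exceptional set is enlarged to a measurable null set, as Fubini requires.
  set S := toMeasurable volume {p : Space d × ℝ | ¬(p.2 ∈ I → u p.1 p.2 = U p.1 p.2)} with hS
  have mS : MeasurableSet S := measurableSet_toMeasurable _ _
  have S0 : ∀ᵐ p : Space d × ℝ, p ∉ S := by
    rw [ae_iff]
    simp only [not_not, Set.ofPred_mem_eq, hS, measure_toMeasurable]
    exact h
  have hSu : ∀ p ∉ S, p.2 ∈ I → u p.1 p.2 = U p.1 p.2 := fun p hp => by
    by_contra hcon
    exact hp (subset_toMeasurable _ _ hcon)
  have hz : ∀ z : Space d, ∀ᵐ p : Space d × ℝ, (p.1 + z, p.2) ∉ S := fun z =>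
    ((measurePreserving_add_right (volume : Measure (Space d)) z).prod
      (MeasurePreserving.id (volume : Measure ℝ))).quasiMeasurePreserving.ae S0
  have hpz : ∀ᵐ p : Space d × ℝ, ∀ᵐ z ∂μ.restrict {z | r < ‖z‖}, (p.1 + z, p.2) ∉ S := by
    refine (Measure.ae_ae_comm (p := fun (p : Space d × ℝ) (z : Space d) => (p.1 + z, p.2) ∉ S)
      ?_).2 (ae_of_all _ hz)
    have hm : Measurable fun q : (Space d × ℝ) × Space d => (q.1.1 + q.2, q.1.2) := by fun_prop
    exact (hm mS).compl
  filter_upwards [S0, hpz] with p hp hp2 hI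
  have h1 := hSu p hp hI
  refine ⟨h1, integral_congr_ae ?_⟩
  filter_upwards [hp2] with z hz
  rw [h1, hSu _ hz hI]

/-- A bounded measurable function which is almost everywhere equal to an entropy solution, together
with the entropy inequality for the test functions `Ω(x - y) θ(t)`. -/
structure IsBoundedEntropySolution {d : ℕ} (f : Fin d → ℝ → ℝ) (μ : Measure (Space d)) (T M : ℝ)
    (U : Space d → ℝ → ℝ) : Prop where
  measurable : Measurable fun p : Space d × ℝ => U p.1 p.2
  bounded : ∀ x t, |U x t| ≤ M
  periodic : ∀ t, AECellPeriodic fun x => U x t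
  entropy : ∀ (k r : ℝ) (y : Space d) (Ω : Space d → ℝ) (θ : ℝ → ℝ) (a b A : ℝ), 0 < r → r < 1 →
    ContDiff ℝ ∞ Ω → CellPeriodic Ω → (∀ x, 0 ≤ Ω x) → TaylorBound A Ω →
    ContDiff ℝ ∞ θ → (∀ t, 0 ≤ θ t) → 0 < a → b < T → (∀ t, t ∉ Icc a b → θ t = 0) →
    0 ≤ ∫ t in Ioo 0 T, ∫ x in cell d, (|U x t - k| * Ω (x - y) * deriv θ t
      + θ t * doubledFlux f μ r Ω (x - y) (U x t) k (levyLarge μ r (fun x => U x t) x))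

theorem exists_bound_of_eq_zero_off_Icc {g : ℝ → ℝ} (hg : Continuous g) {a b : ℝ}
    (h0 : ∀ t, t ∉ Icc a b → g t = 0) : ∃ C, 0 ≤ C ∧ ∀ t, |g t| ≤ C := by
  obtain ⟨C, hC⟩ := isCompact_Icc.exists_bound_of_continuousOn (hg.continuousOn (s := Icc a b))
  refine ⟨|C|, abs_nonneg C, fun t => ?_⟩
  by_cases ht : t ∈ Icc a b
  · exact (hC t ht).trans (le_abs_self C)
  · rw [h0 t ht, abs_zero]; exact abs_nonneg C

theorem deriv_eq_zero_off_Icc {g : ℝ → ℝ} {a b : ℝ} (h0 : ∀ t, t ∉ Icc a b → g t = 0) (t : ℝ)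
    (ht : t ∉ Icc a b) : deriv g t = 0 := by
  have : g =ᶠ[𝓝 t] fun _ => 0 := by
    filter_upwards [isClosed_Icc.isOpen_compl.mem_nhds ht] with s hs
    exact h0 s hs
  rw [this.deriv_eq]; simp

theorem entropyIntegrand_product {d : ℕ} (f : Fin d → ℝ → ℝ) (μ : Measure (Space d)) (k r : ℝ)
    (y : Space d) {Ω : Space d → ℝ} (hΩ : Differentiable ℝ Ω) (θ : ℝ → ℝ)
    (u : Space d → ℝ → ℝ) (p : Space d × ℝ) :
    entropyIntegrand f μ k r u (fun x t => Ω (x - y) * θ t) p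
      = |u p.1 p.2 - k| * Ω (p.1 - y) * deriv θ p.2
        + θ p.2 * doubledFlux f μ r Ω (p.1 - y) (u p.1 p.2) k
          (levyLarge μ r (fun x => u x p.2) p.1) := by
  have hΩy : Differentiable ℝ fun x => Ω (x - y) := hΩ.comp (differentiable_id.sub_const y)
  have h1 : ∀ w, fderiv ℝ (fun x => Ω (x - y) * θ p.2) p.1 w = fderiv ℝ Ω (p.1 - y) w * θ p.2 := by
    intro w
    rw [fderiv_mul_const (hΩy p.1), fderiv_comp_sub]
    simp [mul_comm]
  have h2 : ∀ j, partialDeriv j (fun x => Ω (x - y) * θ p.2) p.1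
      = partialDeriv j Ω (p.1 - y) * θ p.2 := fun j => h1 _
  have h3 := levyAdjointSmall_mul_const μ r (θ p.2) (fun x => Ω (x - y)) hΩy p.1
  rw [levyAdjointSmall_comp_sub] at h3
  have h4 : deriv (fun t => Ω (p.1 - y) * θ t) p.2 = Ω (p.1 - y) * deriv θ p.2 := by
    simp
  unfold entropyIntegrand doubledFlux
  simp only [h1, h2, h3, h4]
  have h5 : ∑ j, entropyFlux f j (u p.1 p.2) k * (partialDeriv j Ω (p.1 - y) * θ p.2)
      = θ p.2 * ∑ j, entropyFlux f j (u p.1 p.2) k * partialDeriv j Ω (p.1 - y) := by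
    rw [Finset.mul_sum]
    exact Finset.sum_congr rfl fun j _ => by ring
  rw [h5]
  simp only [eta]
  ring

theorem isTestFunction_product {d : ℕ} {T : ℝ} (y : Space d) {Ω : Space d → ℝ} {θ : ℝ → ℝ}
    {a b : ℝ} (hΩ : ContDiff ℝ ∞ Ω) (pΩ : CellPeriodic Ω) (h0 : ∀ x, 0 ≤ Ω x)
    (hθ : ContDiff ℝ ∞ θ) (θ0 : ∀ t, 0 ≤ θ t) (ha : 0 < a) (hb : b < T)
    (sθ : ∀ t, t ∉ Icc a b → θ t = 0) : IsTestFunction T fun x t => Ω (x - y) * θ t where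
  smooth := (hΩ.comp (contDiff_fst.sub contDiff_const)).mul (hθ.comp contDiff_snd)
  periodic t := fun j x => by
    simp only
    rw [add_sub_right_comm, pΩ j]
  support := ⟨a, b, ha, hb, fun x t ht => by rw [sθ t ht, mul_zero]⟩
  nonneg x t := mul_nonneg (h0 _) (θ0 t)

/-- The integrand for `U` is everywhere defined, measurable and bounded, so the space-time integral
may be written as an iterated one; for `u` itself only almost everywhere statements are available.
-/
theorem IsEntropySolution.entropy_of_ae_eq {d : ℕ} {f : Fin d → ℝ → ℝ} {μ : Measure (Space d)}
    {T M : ℝ} {u₀ : Space d → ℝ} {u U : Space d → ℝ → ℝ} (hf : ∀ j, ContDiff ℝ 1 (f j))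
    (hμ : IsLevyMeasure μ) (hu : IsEntropySolution f μ T u₀ u)
    (mU : Measurable fun p : Space d × ℝ => U p.1 p.2) (bU : ∀ x t, |U x t| ≤ M)
    (h : ∀ᵐ p : Space d × ℝ, p.2 ∈ Ioo 0 T → u p.1 p.2 = U p.1 p.2)
    {k r : ℝ} (y : Space d) {Ω : Space d → ℝ} {θ : ℝ → ℝ} {a b A : ℝ} (hr : 0 < r) (r1 : r < 1)
    (hΩ : ContDiff ℝ ∞ Ω) (pΩ : CellPeriodic Ω) (h0 : ∀ x, 0 ≤ Ω x) (tΩ : TaylorBound A Ω)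
    (hθ : ContDiff ℝ ∞ θ) (θ0 : ∀ t, 0 ≤ θ t) (ha : 0 < a) (hb : b < T)
    (sθ : ∀ t, t ∉ Icc a b → θ t = 0) :
    0 ≤ ∫ t in Ioo 0 T, ∫ x in cell d, (|U x t - k| * Ω (x - y) * deriv θ t
      + θ t * doubledFlux f μ r Ω (x - y) (U x t) k (levyLarge μ r (fun x => U x t) x)) := by
  have hent := hu.entropy k r hr _ (isTestFunction_product (T := T) y hΩ pΩ h0 hθ θ0 ha hb sθ)
  have hΩ1 : ContDiff ℝ 1 Ω := hΩ.of_le (by exact_mod_cast le_top)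
  have hΩd := hΩ1.differentiable one_ne_zero
  have hθ1 : ContDiff ℝ 1 θ := hθ.of_le (by exact_mod_cast le_top)
  have cθ' : Continuous (deriv θ) := hθ1.continuous_deriv le_rfl
  have mL := measurable_levyLarge hμ hr mU
  set G : Space d × ℝ → ℝ := fun p => |U p.1 p.2 - k| * Ω (p.1 - y) * deriv θ p.2
      + θ p.2 * doubledFlux f μ r Ω (p.1 - y) (U p.1 p.2) k
        (levyLarge μ r (fun x => U x p.2) p.1) with hG
  have mG : Measurable G := by
    refine Measurable.add ?_ ((hθ.continuous.measurable.comp measurable_snd).mul ?_)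
    · exact ((mU.sub_const k).abs.mul (hΩ.continuous.measurable.comp
        (measurable_fst.sub_const y))).mul (cθ'.measurable.comp measurable_snd)
    · exact measurable_doubledFlux hf hμ r1 hΩ1 tΩ (measurable_fst.sub_const y) mU
        measurable_const mL
  obtain ⟨N, hN⟩ := exists_bound_of_periodic pΩ hΩ.continuous
  obtain ⟨C₁, hC₁0, hC₁⟩ := exists_bound_of_eq_zero_off_Icc hθ.continuous sθ
  obtain ⟨C₂, hC₂0, hC₂⟩ := exists_bound_of_eq_zero_off_Icc cθ' (deriv_eq_zero_off_Icc sθ)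
  have hM : 0 ≤ M := (abs_nonneg _).trans (bU 0 0)
  have hN0 : 0 ≤ N := (norm_nonneg _).trans (hN 0)
  obtain ⟨C₃, hC₃⟩ := exists_bound_doubledFlux hf hμ r1 hΩ1 pΩ tΩ (max M |k|)
    ((M + M) * (μ {z : Space d | r < ‖z‖}).toReal) (hM.trans (le_max_left _ _)) (by positivity)
  have bG : ∀ p, |G p| ≤ (M + |k|) * N * C₂ + C₁ * C₃ := by
    intro p
    refine (abs_add_le _ _).trans (add_le_add ?_ ?_)
    · rw [abs_mul, abs_mul, abs_abs]
      exact mul_le_mul (mul_le_mul ((abs_sub _ _).trans (add_le_add (bU _ _) le_rfl)) (hN _)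
        (abs_nonneg _) (by positivity)) (hC₂ _) (abs_nonneg _) (by positivity)
    · rw [abs_mul]
      exact mul_le_mul (hC₁ _) (hC₃ _ _ _ _ ((bU _ _).trans (le_max_left _ _)) (le_max_right _ _)
        (hμ.abs_levyLarge_le (fun x => bU x _) hr _)) (abs_nonneg _) hC₁0
  have hae : ∫ p in cell d ×ˢ Ioo 0 T, entropyIntegrand f μ k r u (fun x t => Ω (x - y) * θ t) p
      = ∫ p in cell d ×ˢ Ioo 0 T, G p := by
    refine integral_congr_ae ((ae_restrict_iff' ((measurableSet_cell d).prod
      measurableSet_Ioo)).2 ?_)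
    filter_upwards [ae_levyLarge_eq hμ hr h] with p hp hmem
    obtain ⟨h1, h2⟩ := hp hmem.2
    rw [entropyIntegrand_product f μ k r y hΩd, h1, h2]
  rw [hae, show (volume : Measure (Space d × ℝ)) = volume.prod volume from rfl,
    ← Measure.prod_restrict, integral_prod _ (integrable_of_bounded mG bG),
    integral_swap_of_bounded (F := fun x t => G (x, t)) mG fun x t => bG (x, t)] at hent
  exact hent

theorem IsEntropySolution.exists_isBoundedEntropySolution {d : ℕ} {f : Fin d → ℝ → ℝ}
    {μ : Measure (Space d)} {T : ℝ} {u₀ : Space d → ℝ} {u : Space d → ℝ → ℝ}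
    (hf : ∀ j, ContDiff ℝ 1 (f j)) (hμ : IsLevyMeasure μ) (hu : IsEntropySolution f μ T u₀ u) :
    ∃ (M : ℝ) (U : Space d → ℝ → ℝ), (∀ M', M ≤ M' → IsBoundedEntropySolution f μ T M' U) ∧
      ∀ᵐ t ∂volume.restrict (Ioo 0 T), (fun x => u x t) =ᵐ[volume] fun x => U x t := by
  obtain ⟨M, hM⟩ := hu.bounded
  obtain ⟨u', mu', huu'⟩ := hu.measurable
  set M' := |M| with hM'
  have hprod : (volume : Measure (Space d × ℝ)).restrict (univ ×ˢ Icc 0 T)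
      = (volume : Measure (Space d)).prod (volume.restrict (Icc 0 T)) := by
    rw [show (volume : Measure (Space d × ℝ)) = volume.prod volume from rfl,
      ← Measure.prod_restrict, Measure.restrict_univ]
  rw [hprod] at huu'
  have hswap : ∀ᵐ t ∂volume.restrict (Icc 0 T), ∀ᵐ x : Space d, u x t = u' (x, t) := by
    have h1 : ∀ᵐ q ∂(volume.restrict (Icc 0 T)).prod (volume : Measure (Space d)),
        u q.2 q.1 = u' (q.2, q.1) := by
      have := (Measure.measurePreserving_swap (μ := volume.restrict (Icc 0 T))
        (ν := (volume : Measure (Space d)))).quasiMeasurePreserving.ae huu'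
      filter_upwards [this] with q hq using hq
    exact Measure.ae_ae_of_ae_prod h1
  -- Truncation at the essential bound changes nothing almost everywhere and makes the bound hold at
  -- every point.
  set W : Space d → ℝ → ℝ := fun x t => max (-M') (min M' (u' (x, t))) with hW
  have hgood : ∀ᵐ t ∂volume.restrict (Ioo 0 T), (fun x => u x t) =ᵐ[volume] fun x => W x t := by
    have h2 := ae_restrict_of_ae_restrict_of_subset Ioo_subset_Icc_self hswap
    filter_upwards [h2, ae_restrict_mem measurableSet_Ioo] with t ht hmem
    filter_upwards [ht, hM t (Ioo_subset_Icc_self hmem)] with x hx hx2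
    have := abs_le.1 (hx2.trans (le_abs_self M))
    simp only [hW]
    rw [← hx, min_eq_right this.2, max_eq_right this.1]
  set S := toMeasurable (volume.restrict (Ioo 0 T))
    {t | ¬((fun x => u x t) =ᵐ[volume] fun x => W x t)} with hS
  have mS : MeasurableSet S := measurableSet_toMeasurable _ _
  have S0 : ∀ᵐ t ∂volume.restrict (Ioo 0 T), t ∉ S := by
    rw [ae_iff]
    simp only [not_not, Set.ofPred_mem_eq, hS, measure_toMeasurable]
    exact hgood
  have hSW : ∀ t ∉ S, (fun x => u x t) =ᵐ[volume] fun x => W x t := fun t ht => by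
    by_contra hcon
    exact ht (subset_toMeasurable _ _ hcon)
  have mSc : MeasurableSet (Ioo 0 T \ S) := measurableSet_Ioo.diff mS
  classical
  -- At exceptional times the function is set to zero, so that every slice, and not only almost
  -- every one, agrees almost everywhere with a periodic function.
  set U : Space d → ℝ → ℝ := fun x t => if t ∈ Ioo 0 T \ S then W x t else 0 with hU
  have mW : Measurable fun p : Space d × ℝ => W p.1 p.2 :=
    measurable_const.max (measurable_const.min mu'.measurable)
  have mU : Measurable fun p : Space d × ℝ => U p.1 p.2 :=
    Measurable.ite (measurable_snd mSc) mW measurable_const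
  have bU : ∀ x t, |U x t| ≤ M' := by
    intro x t
    have h0 : 0 ≤ M' := abs_nonneg M
    simp only [hU]
    split_ifs with h
    · exact abs_le.2 ⟨le_max_left _ _, max_le (by linarith) (min_le_left _ _)⟩
    · simpa using h0
  have hUt : ∀ᵐ t ∂volume.restrict (Ioo 0 T), (fun x => u x t) =ᵐ[volume] fun x => U x t := by
    filter_upwards [S0, ae_restrict_mem measurableSet_Ioo] with t ht hmem
    have : (fun x => U x t) = fun x => W x t := by
      ext x; simp only [hU]; rw [if_pos ⟨hmem, ht⟩]
    rw [this]
    exact hSW t ht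
  have hUp : ∀ᵐ p : Space d × ℝ, p.2 ∈ Ioo 0 T → u p.1 p.2 = U p.1 p.2 := by
    have h1 : ∀ᵐ p ∂(volume : Measure (Space d)).prod (volume.restrict (Ioo 0 T)),
        u' p = U p.1 p.2 := by
      have h3 : ∀ᵐ q ∂(volume.restrict (Ioo 0 T)).prod (volume : Measure (Space d)),
          u' (q.2, q.1) = U q.2 q.1 := by
        have hm : MeasurableSet {q : ℝ × Space d | u' (q.2, q.1) = U q.2 q.1} :=
          measurableSet_eq_fun (mu'.measurable.comp measurable_swap) (mU.comp measurable_swap)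
        refine (Measure.ae_prod_iff_ae_ae hm).2 ?_
        filter_upwards [hUt, ae_restrict_of_ae_restrict_of_subset Ioo_subset_Icc_self hswap]
          with t h4 h5
        filter_upwards [h4, h5] with x h6 h7
        rw [← h7, h6]
      filter_upwards [(Measure.measurePreserving_swap (μ := (volume : Measure (Space d)))
        (ν := volume.restrict (Ioo 0 T))).quasiMeasurePreserving.ae h3] with p hp using hp
    have hprod' : (volume : Measure (Space d × ℝ)).restrict (univ ×ˢ Ioo 0 T)
        = (volume : Measure (Space d)).prod (volume.restrict (Ioo 0 T)) := by
      rw [show (volume : Measure (Space d × ℝ)) = volume.prod volume from rfl,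
        ← Measure.prod_restrict, Measure.restrict_univ]
    rw [← hprod'] at h1
    have h1' := (ae_restrict_iff' (MeasurableSet.univ.prod measurableSet_Ioo)).1 h1
    have h2 : ∀ᵐ p : Space d × ℝ, p.2 ∈ Icc 0 T → u p.1 p.2 = u' p := by
      rw [← hprod] at huu'
      have := (ae_restrict_iff' (MeasurableSet.univ.prod measurableSet_Icc)).1 huu'
      filter_upwards [this] with p hp h using hp ⟨trivial, h⟩
    filter_upwards [h1', h2] with p hp1 hp2 hp
    rw [hp2 (Ioo_subset_Icc_self hp), hp1 ⟨trivial, hp⟩]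
  -- Every larger bound is admitted, so that later one constant can serve both solutions.
  refine ⟨M', U, fun M'' hM'' => ⟨mU, fun x t => (bU x t).trans hM'', fun t => ?_, ?_⟩, hUt⟩
  · by_cases h : t ∈ Ioo 0 T \ S
    · refine ⟨fun x => u x t, hu.periodic t (Ioo_subset_Icc_self h.1), ?_⟩
      have : (fun x => U x t) = fun x => W x t := by
        ext x; simp only [hU]; rw [if_pos h]
      rw [this]
      exact (hSW t h.2).symm
    · have : (fun x => U x t) = fun _ => 0 := by
        ext x; simp only [hU]; rw [if_neg h]
      rw [this]
      exact (cellPeriodic_const 0).aeCellPeriodic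
  · intro k r y Ω θ a b A hr r1 hΩ pΩ h0 tΩ hθ θ0 ha hb sθ
    exact hu.entropy_of_ae_eq hf hμ mU bU hUp y hr r1 hΩ pΩ h0 tΩ hθ θ0 ha hb sθ

/-! ### Doubling the variables -/

/-- A family `V(·,s)` of smooth functions with uniform bounds, whose time derivative on `[a,b]`
is the right-hand side `D` of the viscous equation. -/
structure IsBoundedClassicalSolution {d : ℕ} (f : Fin d → ℝ → ℝ) (μ : Measure (Space d))
    (ε a b M A L K : ℝ) (V D : Space d → ℝ → ℝ) : Prop where
  measurable : Measurable fun p : Space d × ℝ => V p.1 p.2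
  measurable_deriv : Measurable fun p : Space d × ℝ => D p.1 p.2
  bounded : ∀ y s, |V y s| ≤ M
  bounded_deriv : ∀ y s, |D y s| ≤ L
  contDiff : ∀ s, ContDiff ℝ 2 fun y => V y s
  periodic : ∀ s, CellPeriodic fun y => V y s
  taylorBound : ∀ s, TaylorBound A fun y => V y s
  equation : ∀ y s, D y s = viscousRHS f μ ε (fun y => V y s) y
  hasDerivAt : ∀ y, ∀ s ∈ Icc a b, HasDerivAt (V y) (D y s) s
  continuousOn_deriv : ∀ y, ContinuousOn (D y) (Icc a b)
  variation : ∀ s j, ∫ y in cell d, |partialDeriv j (fun y => V y s) y| ≤ K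

theorem IsViscousSolution.exists_isBoundedClassicalSolution {d : ℕ} {f : Fin d → ℝ → ℝ}
    {μ : Measure (Space d)} {T ε K : ℝ} {u₀ : Space d → ℝ} {v : Space d → ℝ → ℝ}
    (hv : IsViscousSolution f μ T ε u₀ v) {a b : ℝ} (ha : 0 < a) (hab : a ≤ b) (hb : b < T)
    (hK : ∀ t ∈ Ioo 0 T, ∀ j, ∫ y in cell d, |partialDeriv j (fun y => v y t) y| ≤ K) :
    ∃ (M A L : ℝ) (V D : Space d → ℝ → ℝ), 0 ≤ A ∧
      (∀ M', M ≤ M' → IsBoundedClassicalSolution f μ ε a b M' A L K V D) ∧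
      ∀ y, ∀ s ∈ Icc a b, V y s = v y s := by
  obtain ⟨a', ha', haa'⟩ := exists_between ha
  obtain ⟨b', hbb', hb'⟩ := exists_between hb
  obtain ⟨M, hM⟩ := hv.exists_bound ha' hb'
  obtain ⟨L, hL⟩ := hv.exists_bound_deriv ha' hb'
  obtain ⟨A, hA⟩ := hv.exists_taylorBound ha' hb'
  -- Time is frozen outside a window slightly larger than `[a,b]`. All bounds and the spatial
  -- equation then hold for every `s`, while on `[a,b]` the two-sided time derivative is still the
  -- original one.
  set c : ℝ → ℝ := fun s => max a' (min b' s) with hc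
  have hcc : Continuous c := continuous_const.max (continuous_const.min continuous_id)
  have hcm : ∀ s, c s ∈ Icc a' b' := fun s =>
    ⟨le_max_left _ _, max_le (haa'.le.trans (hab.trans hbb'.le)) (min_le_left _ _)⟩
  have hsub : Icc a' b' ⊆ Ioo 0 T := fun t ht => ⟨ha'.trans_le ht.1, ht.2.trans_lt hb'⟩
  have hce : ∀ s ∈ Icc a' b', c s = s := fun s hs => by
    simp only [hc, min_eq_right hs.2, max_eq_right hs.1]
  have hIcc : Icc a b ⊆ Icc a' b' := Icc_subset_Icc haa'.le hbb'.le
  have hcp : Continuous fun p : Space d × ℝ => (p.1, c p.2) := by fun_prop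
  have cV : Continuous fun p : Space d × ℝ => v p.1 (c p.2) :=
    hv.continuous.comp_continuous hcp fun p => ⟨trivial, hsub (hcm _)⟩
  have cD : Continuous fun p : Space d × ℝ => deriv (v p.1) (c p.2) :=
    hv.continuous_time.comp_continuous hcp fun p => ⟨trivial, hsub (hcm _)⟩
  refine ⟨M, |A|, L, fun y s => v y (c s), fun y s => deriv (v y) (c s), abs_nonneg A, fun M' hM' =>
    { measurable := cV.measurable
      measurable_deriv := cD.measurable
      bounded := fun y s => (hM y _ (hcm s)).trans hM'
      bounded_deriv := fun y s => hL y _ (hcm s)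
      contDiff := fun s => hv.contDiff_space _ (hsub (hcm s))
      periodic := fun s => hv.periodic _ (hsub (hcm s))
      taylorBound := fun s y z => (hA _ (hcm s) y z).trans (by gcongr; exact le_abs_self A)
      equation := fun y s => hv.deriv_eq y (hsub (hcm s))
      hasDerivAt := fun y s hs => ?_
      continuousOn_deriv := fun y => ?_
      variation := fun s j => hK _ (hsub (hcm s)) j }, fun y s hs => ?_⟩
  · rw [hce s (hIcc hs)]
    refine (hv.differentiable_time y s (hsub (hIcc hs))).hasDerivAt.congr_of_eventuallyEq ?_
    filter_upwards [Icc_mem_nhds (haa'.trans_le hs.1) (hs.2.trans_lt hbb')] with t ht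
    rw [hce t ht]
  · exact (cD.comp (f := fun s : ℝ => (y, s)) (by fun_prop)).continuousOn
  · exact congrArg (v y) (hce s (hIcc hs))

/-- Used to bring a time integration inside or outside the two space integrations. -/
theorem integral_rotate_of_bounded {α β γ : Type*} [MeasurableSpace α] [MeasurableSpace β]
    [MeasurableSpace γ] {l : Measure α} [IsFiniteMeasure l] {m : Measure β} [IsFiniteMeasure m]
    {n : Measure γ} [IsFiniteMeasure n] {F : α → β → γ → ℝ}
    (hF : Measurable fun p : α × β × γ => F p.1 p.2.1 p.2.2) {C : ℝ}
    (hC : ∀ a b c, |F a b c| ≤ C) :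
    ∫ a, ∫ b, ∫ c, F a b c ∂n ∂m ∂l = ∫ c, ∫ a, ∫ b, F a b c ∂m ∂l ∂n := by
  have h1 : ∀ a, ∫ b, ∫ c, F a b c ∂n ∂m = ∫ c, ∫ b, F a b c ∂m ∂n := fun a =>
    integral_swap_of_bounded (hF.comp (f := fun q : β × γ => (a, q.1, q.2)) (by fun_prop)) (hC a)
  simp only [h1]
  refine integral_swap_of_bounded (F := fun a c => ∫ b, F a b c ∂m)
    (measurable_integral_right (F := fun (q : α × γ) b => F q.1 b q.2) ?_)
    fun a c => abs_integral_le_of_bounded fun b => hC a b c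
  exact hF.comp (f := fun q : (α × γ) × β => (q.1.1, q.2, q.1.2)) (by fun_prop)

theorem integral_integral_add_of_bounded {α β : Type*} [MeasurableSpace α] [MeasurableSpace β]
    {m : Measure α} [IsFiniteMeasure m] {n : Measure β} [IsFiniteMeasure n] {P Q : α → β → ℝ}
    (mP : Measurable (Function.uncurry P)) (mQ : Measurable (Function.uncurry Q)) {C C' : ℝ}
    (bP : ∀ x y, |P x y| ≤ C) (bQ : ∀ x y, |Q x y| ≤ C') (c c' : ℝ) :
    ∫ x, ∫ y, (P x y * c + c' * Q x y) ∂n ∂m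
      = c * (∫ x, ∫ y, P x y ∂n ∂m) + c' * ∫ x, ∫ y, Q x y ∂n ∂m := by
  have e1 : ∀ x, ∫ y, (P x y * c + c' * Q x y) ∂n = c * (∫ y, P x y ∂n) + c' * ∫ y, Q x y ∂n := by
    intro x
    have i1 : Integrable (P x) n := integrable_of_bounded (mP.comp measurable_prodMk_left) (bP x)
    have i2 : Integrable (Q x) n := integrable_of_bounded (mQ.comp measurable_prodMk_left) (bQ x)
    rw [integral_add (i1.mul_const _) (i2.const_mul _), integral_mul_const, integral_const_mul, mul_comm c]
  simp only [e1]
  rw [integral_add ((integrable_of_bounded (measurable_integral_right mP)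
      fun x => abs_integral_le_of_bounded (bP x)).const_mul _)
    ((integrable_of_bounded (measurable_integral_right mQ)
      fun x => abs_integral_le_of_bounded (bQ x)).const_mul _),
    integral_const_mul, integral_const_mul]

theorem integral_rotate_add_of_bounded {α β γ : Type*} [MeasurableSpace α] [MeasurableSpace β]
    [MeasurableSpace γ] {l : Measure α} [IsFiniteMeasure l] {m : Measure β} [IsFiniteMeasure m]
    {n : Measure γ} [IsFiniteMeasure n] {P Q : α → β → γ → ℝ} {g h : α → ℝ} (mg : Measurable g)
    (mh : Measurable h)
    (mP : Measurable fun p : α × β × γ => P p.1 p.2.1 p.2.2)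
    (mQ : Measurable fun p : α × β × γ => Q p.1 p.2.1 p.2.2) {C C' G H : ℝ}
    (bP : ∀ a b c, |P a b c| ≤ C) (bQ : ∀ a b c, |Q a b c| ≤ C') (bg : ∀ a, |g a| ≤ G)
    (bh : ∀ a, |h a| ≤ H) :
    Integrable (fun a => g a * (∫ b, ∫ c, P a b c ∂n ∂m) + h a * ∫ b, ∫ c, Q a b c ∂n ∂m) l ∧
    ∫ c, ∫ a, ∫ b, (P a b c * g a + h a * Q a b c) ∂m ∂l ∂n
      = ∫ a, (g a * (∫ b, ∫ c, P a b c ∂n ∂m) + h a * ∫ b, ∫ c, Q a b c ∂n ∂m) ∂l := by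
  have e : ∀ a, ∫ b, ∫ c, (P a b c * g a + h a * Q a b c) ∂n ∂m
      = g a * (∫ b, ∫ c, P a b c ∂n ∂m) + h a * ∫ b, ∫ c, Q a b c ∂n ∂m := fun a =>
    integral_integral_add_of_bounded (P := P a) (Q := Q a) (mP.comp measurable_prodMk_left)
      (mQ.comp measurable_prodMk_left) (bP a) (bQ a) _ _
  have mF : Measurable fun p : α × β × γ =>
      P p.1 p.2.1 p.2.2 * g p.1 + h p.1 * Q p.1 p.2.1 p.2.2 :=
    (mP.mul (mg.comp measurable_fst)).add ((mh.comp measurable_fst).mul mQ)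
  have bF : ∀ a b c, |P a b c * g a + h a * Q a b c| ≤ C * G + H * C' := by
    intro a b c
    refine (abs_add_le _ _).trans (add_le_add ?_ ?_)
    · rw [abs_mul]
      exact mul_le_mul (bP a b c) (bg a) (abs_nonneg _) ((abs_nonneg _).trans (bP a b c))
    · rw [abs_mul]
      exact mul_le_mul (bh a) (bQ a b c) (abs_nonneg _) ((abs_nonneg _).trans (bh a))
  constructor
  · simp only [← e]
    exact integrable_of_bounded (measurable_integral_right (F := fun a b =>
      ∫ c, (P a b c * g a + h a * Q a b c) ∂n)
      (measurable_integral_right (F := fun (p : α × β) c =>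
        P p.1 p.2 c * g p.1 + h p.1 * Q p.1 p.2 c)
        (mF.comp (f := fun p : (α × β) × γ => (p.1.1, p.1.2, p.2)) (by fun_prop))))
      fun a => abs_integral_le_of_bounded fun b => abs_integral_le_of_bounded (bF a b)
  · rw [← integral_rotate_of_bounded mF bF]
    exact integral_congr_ae (ae_of_all _ e)

section Doubling

variable {d : ℕ} {f : Fin d → ℝ → ℝ} {μ : Measure (Space d)} {T ε a b M A L K : ℝ}
  {U V D : Space d → ℝ → ℝ} {Ω : Space d → ℝ} {A' N r : ℝ}

/-- The doubled distance `∬ |U(x,t) - V(y,s)| Ω(x - y) dx dy`. -/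
noncomputable def doubledDist (Ω : Space d → ℝ) (U V : Space d → ℝ → ℝ) (t s : ℝ) : ℝ :=
  ∫ x in cell d, ∫ y in cell d, |U x t - V y s| * Ω (x - y)

/-- The contribution `∬ sgn(V - U) ∂_s V Ω(x - y) dx dy` of the time derivative of `V`. -/
noncomputable def doubledDistDeriv (Ω : Space d → ℝ) (U V D : Space d → ℝ → ℝ) (t s : ℝ) : ℝ :=
  ∫ x in cell d, ∫ y in cell d, Real.sign (V y s - U x t) * D y s * Ω (x - y)

/-- The bound for the growth of the doubled distance. -/
noncomputable def doublingRate (μ : Measure (Space d)) (ε M A K A' N r : ℝ) (Ω : Space d → ℝ) : ℝ :=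
  ε * ∑ j, K * (∫ x in cell d, |partialDeriv j Ω x|)
    + levyMoment μ r * ((2 * M * A' + A * N) * (volume.restrict (cell d)).real univ ^ 2)

theorem measurable_doubledDist (mU : Measurable fun p : Space d × ℝ => U p.1 p.2)
    (mV : Measurable fun p : Space d × ℝ => V p.1 p.2) (mΩ : Measurable Ω) :
    Measurable fun q : ℝ × ℝ => doubledDist Ω U V q.1 q.2 := by
  refine measurable_integral_right (F := fun (q : ℝ × ℝ) x =>
    ∫ y in cell d, |U x q.1 - V y q.2| * Ω (x - y)) ?_
  refine measurable_integral_right (F := fun (q : (ℝ × ℝ) × Space d) y =>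
    |U q.2 q.1.1 - V y q.1.2| * Ω (q.2 - y)) ?_
  have m1 : Measurable fun q : ((ℝ × ℝ) × Space d) × Space d => U q.1.2 q.1.1.1 :=
    mU.comp (f := fun q : ((ℝ × ℝ) × Space d) × Space d => (q.1.2, q.1.1.1)) (by fun_prop)
  have m2 : Measurable fun q : ((ℝ × ℝ) × Space d) × Space d => V q.2 q.1.1.2 :=
    mV.comp (f := fun q : ((ℝ × ℝ) × Space d) × Space d => (q.2, q.1.1.2)) (by fun_prop)
  exact (m1.sub m2).abs.mul (mΩ.comp (by fun_prop))

theorem measurable_doubledDistDeriv (mU : Measurable fun p : Space d × ℝ => U p.1 p.2)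
    (mV : Measurable fun p : Space d × ℝ => V p.1 p.2)
    (mD : Measurable fun p : Space d × ℝ => D p.1 p.2) (mΩ : Measurable Ω) :
    Measurable fun q : ℝ × ℝ => doubledDistDeriv Ω U V D q.1 q.2 := by
  refine measurable_integral_right (F := fun (q : ℝ × ℝ) x =>
    ∫ y in cell d, Real.sign (V y q.2 - U x q.1) * D y q.2 * Ω (x - y)) ?_
  refine measurable_integral_right (F := fun (q : (ℝ × ℝ) × Space d) y =>
    Real.sign (V y q.1.2 - U q.2 q.1.1) * D y q.1.2 * Ω (q.2 - y)) ?_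
  have m1 : Measurable fun q : ((ℝ × ℝ) × Space d) × Space d => U q.1.2 q.1.1.1 :=
    mU.comp (f := fun q : ((ℝ × ℝ) × Space d) × Space d => (q.1.2, q.1.1.1)) (by fun_prop)
  have m2 : Measurable fun q : ((ℝ × ℝ) × Space d) × Space d => V q.2 q.1.1.2 :=
    mV.comp (f := fun q : ((ℝ × ℝ) × Space d) × Space d => (q.2, q.1.1.2)) (by fun_prop)
  have m3 : Measurable fun q : ((ℝ × ℝ) × Space d) × Space d => D q.2 q.1.1.2 :=
    mD.comp (f := fun q : ((ℝ × ℝ) × Space d) × Space d => (q.2, q.1.1.2)) (by fun_prop)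
  exact ((measurable_sign.comp (m2.sub m1)).mul m3).mul (mΩ.comp (by fun_prop))

theorem abs_doubledDist_le (bU : ∀ x t, |U x t| ≤ M) (bV : ∀ x t, |V x t| ≤ M)
    (bΩ : ∀ x, |Ω x| ≤ N) (t s : ℝ) : |doubledDist Ω U V t s|
      ≤ (M + M) * N * (volume.restrict (cell d)).real univ * (volume.restrict (cell d)).real univ := by
  have hM : 0 ≤ M := (abs_nonneg _).trans (bU 0 0)
  refine abs_integral_le_of_bounded fun x => abs_integral_le_of_bounded fun y => ?_
  rw [abs_mul, abs_abs]
  exact mul_le_mul ((abs_sub _ _).trans (add_le_add (bU _ _) (bV _ _))) (bΩ _) (abs_nonneg _)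
    (by positivity)

theorem abs_doubledDistDeriv_le (bD : ∀ x t, |D x t| ≤ L) (bΩ : ∀ x, |Ω x| ≤ N) (t s : ℝ) :
    |doubledDistDeriv Ω U V D t s|
      ≤ L * N * (volume.restrict (cell d)).real univ * (volume.restrict (cell d)).real univ := by
  have hL : 0 ≤ L := (abs_nonneg _).trans (bD 0 0)
  refine abs_integral_le_of_bounded fun x => abs_integral_le_of_bounded fun y => ?_
  rw [abs_mul, abs_mul]
  refine mul_le_mul ?_ (bΩ _) (abs_nonneg _) hL
  exact (mul_le_of_le_one_left (abs_nonneg _) (abs_sign_le_one _)).trans (bD _ _)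

/-- The spatial estimate, at fixed times. -/
theorem IsBoundedEntropySolution.integral_doubledFlux_le (hμ : IsLevyMeasure μ)
    (hf : ∀ j, ContDiff ℝ 1 (f j)) (hε : 0 ≤ ε) (hU : IsBoundedEntropySolution f μ T M U)
    (hV : IsBoundedClassicalSolution f μ ε a b M A L K V D) (hΩ : ContDiff ℝ ∞ Ω)
    (pΩ : CellPeriodic Ω) (h0 : ∀ x, 0 ≤ Ω x) (bΩ : ∀ x, |Ω x| ≤ N) (tΩ : TaylorBound A' Ω)
    (r0 : 0 < r) (r1 : r < 1) (t s : ℝ) :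
    ∫ x in cell d, ∫ y in cell d,
        doubledFlux f μ r Ω (x - y) (U x t) (V y s) (levyLarge μ r (fun x => U x t) x)
      ≤ doublingRate μ ε M A K A' N r Ω - doubledDistDeriv Ω U V D t s := by
  have hΩ1 : ContDiff ℝ 1 Ω := hΩ.of_le (by exact_mod_cast le_top)
  have mU : Measurable fun x => U x t := hU.measurable.comp measurable_prodMk_right
  have mV : Measurable fun x => V x s := hV.measurable.comp measurable_prodMk_right
  have mD : Measurable fun x => D x s := hV.measurable_deriv.comp measurable_prodMk_right
  have h := hμ.integral_integral_doubledFlux_add_le hf hε mU (hU.periodic t) (hV.contDiff s)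
    (hV.periodic s) hΩ1 pΩ h0 (fun x => hU.bounded x t) (fun x => hV.bounded x s) bΩ
    (hV.taylorBound s) tΩ r0 r1 mD (fun y => hV.bounded_deriv y s) (fun y => hV.equation y s)
  have hM : 0 ≤ M := (abs_nonneg _).trans (hU.bounded 0 0)
  have hL : 0 ≤ L := (abs_nonneg _).trans (hV.bounded_deriv 0 0)
  obtain ⟨C, hC⟩ := exists_bound_doubledFlux hf hμ r1 hΩ1 pΩ tΩ M
    ((M + M) * (μ {z : Space d | r < ‖z‖}).toReal) hM (by positivity)
  have hC' : ∀ x y, |doubledFlux f μ r Ω (x - y) (U x t) (V y s)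
      (levyLarge μ r (fun x => U x t) x)| ≤ C := fun x y =>
    hC _ _ _ _ (hU.bounded _ _) (hV.bounded _ _)
      (hμ.abs_levyLarge_le (fun x => hU.bounded x t) r0 _)
  have hC2 : ∀ x y, |Real.sign (V y s - U x t) * D y s * Ω (x - y)| ≤ L * N := by
    intro x y
    rw [abs_mul, abs_mul]
    refine mul_le_mul ?_ (bΩ _) (abs_nonneg _) hL
    exact (mul_le_of_le_one_left (abs_nonneg _) (abs_sign_le_one _)).trans (hV.bounded_deriv _ _)
  have mL := hμ.measurable_levyLarge r0 mU
  have m1 : Measurable (Function.uncurry fun x y => doubledFlux f μ r Ω (x - y) (U x t)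
      (V y s) (levyLarge μ r (fun x => U x t) x)) :=
    measurable_doubledFlux hf hμ r1 hΩ1 tΩ (measurable_fst.sub measurable_snd)
      (mU.comp measurable_fst) (mV.comp measurable_snd) (mL.comp measurable_fst)
  have m2 : Measurable (Function.uncurry fun x y =>
      Real.sign (V y s - U x t) * D y s * Ω (x - y)) :=
    ((measurable_sign.comp ((mV.comp measurable_snd).sub (mU.comp measurable_fst))).mul
      (mD.comp measurable_snd)).mul (hΩ.continuous.measurable.comp (by fun_prop))
  have e := integral_integral_add_of_bounded (m := volume.restrict (cell d))
    (n := volume.restrict (cell d)) m1 m2 hC' hC2 1 1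
  simp only [mul_one, one_mul] at e
  rw [e] at h
  have h2 : ε * ∑ j, (∫ y in cell d, |partialDeriv j (fun y => V y s) y|)
        * (∫ x in cell d, |partialDeriv j Ω x|)
      ≤ ε * ∑ j, K * (∫ x in cell d, |partialDeriv j Ω x|) :=
    mul_le_mul_of_nonneg_left (Finset.sum_le_sum fun j _ => mul_le_mul_of_nonneg_right
      (hV.variation s j) (integral_nonneg fun _ => abs_nonneg _)) hε
  unfold doublingRate doubledDistDeriv
  linarith

/-- The entropy inequality integrated in the second space variable. -/
theorem IsBoundedEntropySolution.integral_doubledDist_nonneg (hμ : IsLevyMeasure μ)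
    (hf : ∀ j, ContDiff ℝ 1 (f j)) (hε : 0 ≤ ε) (hU : IsBoundedEntropySolution f μ T M U)
    (hV : IsBoundedClassicalSolution f μ ε a b M A L K V D) (hΩ : ContDiff ℝ ∞ Ω)
    (pΩ : CellPeriodic Ω) (h0 : ∀ x, 0 ≤ Ω x) (bΩ : ∀ x, |Ω x| ≤ N) (tΩ : TaylorBound A' Ω)
    (r0 : 0 < r) (r1 : r < 1) {θ : ℝ → ℝ} {p q : ℝ} (hθ : ContDiff ℝ ∞ θ) (θ0 : ∀ t, 0 ≤ θ t)
    (hp : 0 < p) (hq : q < T) (sθ : ∀ t, t ∉ Icc p q → θ t = 0) (s : ℝ) :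
    0 ≤ ∫ t in Ioo 0 T, (deriv θ t * doubledDist Ω U V t s
      + θ t * (doublingRate μ ε M A K A' N r Ω - doubledDistDeriv Ω U V D t s)) := by
  have hΩ1 : ContDiff ℝ 1 Ω := hΩ.of_le (by exact_mod_cast le_top)
  have mΩ : Measurable Ω := hΩ.continuous.measurable
  have hθ1 : ContDiff ℝ 1 θ := hθ.of_le (by exact_mod_cast le_top)
  have cθ' : Continuous (deriv θ) := hθ1.continuous_deriv le_rfl
  have hM : 0 ≤ M := (abs_nonneg _).trans (hU.bounded 0 0)
  have hN : 0 ≤ N := (abs_nonneg _).trans (bΩ 0)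
  have mL := measurable_levyLarge hμ r0 hU.measurable
  obtain ⟨C₁, hC₁0, hC₁⟩ := exists_bound_of_eq_zero_off_Icc hθ.continuous sθ
  obtain ⟨C₂, hC₂0, hC₂⟩ := exists_bound_of_eq_zero_off_Icc cθ' (deriv_eq_zero_off_Icc sθ)
  obtain ⟨C, hC⟩ := exists_bound_doubledFlux hf hμ r1 hΩ1 pΩ tΩ M
    ((M + M) * (μ {z : Space d | r < ‖z‖}).toReal) hM (by positivity)
  set P : ℝ → Space d → Space d → ℝ := fun t x y => |U x t - V y s| * Ω (x - y) with hP
  set Q : ℝ → Space d → Space d → ℝ := fun t x y =>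
    doubledFlux f μ r Ω (x - y) (U x t) (V y s) (levyLarge μ r (fun x => U x t) x) with hQ
  have m1 : Measurable fun p : ℝ × Space d × Space d => U p.2.1 p.1 :=
    hU.measurable.comp (f := fun p : ℝ × Space d × Space d => (p.2.1, p.1)) (by fun_prop)
  have m2 : Measurable fun p : ℝ × Space d × Space d => V p.2.2 s :=
    hV.measurable.comp (f := fun p : ℝ × Space d × Space d => (p.2.2, s)) (by fun_prop)
  have m3 : Measurable fun p : ℝ × Space d × Space d => levyLarge μ r (fun x => U x p.1) p.2.1 :=
    mL.comp (f := fun p : ℝ × Space d × Space d => (p.2.1, p.1)) (by fun_prop)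
  have m4 : Measurable fun p : ℝ × Space d × Space d => p.2.1 - p.2.2 := by fun_prop
  have mP : Measurable fun p : ℝ × Space d × Space d => P p.1 p.2.1 p.2.2 :=
    (m1.sub m2).abs.mul (mΩ.comp m4)
  have mQ : Measurable fun p : ℝ × Space d × Space d => Q p.1 p.2.1 p.2.2 :=
    measurable_doubledFlux hf hμ r1 hΩ1 tΩ m4 m1 m2 m3
  have bP : ∀ t x y, |P t x y| ≤ (M + M) * N := by
    intro t x y
    rw [hP, abs_mul, abs_abs]
    exact mul_le_mul ((abs_sub _ _).trans (add_le_add (hU.bounded _ _) (hV.bounded _ _))) (bΩ _)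
      (abs_nonneg _) (by positivity)
  have bQ : ∀ t x y, |Q t x y| ≤ C := fun t x y => hC _ _ _ _ (hU.bounded _ _) (hV.bounded _ _)
    (hμ.abs_levyLarge_le (fun x => hU.bounded x t) r0 _)
  -- For each fixed `y` and `s` the number `V y s` is an admissible Kružkov constant; integrating
  -- over `y` afterwards doubles the space variable.
  have h1 : 0 ≤ ∫ y in cell d, ∫ t in Ioo 0 T, ∫ x in cell d,
      (P t x y * deriv θ t + θ t * Q t x y) :=
    integral_nonneg fun y => hU.entropy (V y s) r y Ω θ p q A' r0 r1 hΩ pΩ h0 tΩ hθ θ0 hp hq sθ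
  obtain ⟨hi, he⟩ := integral_rotate_add_of_bounded (l := volume.restrict (Ioo 0 T))
    (m := volume.restrict (cell d)) (n := volume.restrict (cell d)) cθ'.measurable
    hθ.continuous.measurable mP mQ bP bQ hC₂ hC₁
  rw [he] at h1
  refine h1.trans ?_
  have mJ := (measurable_doubledDist hU.measurable hV.measurable mΩ).comp
    (measurable_prodMk_right (y := s))
  have mG := (measurable_doubledDistDeriv hU.measurable hV.measurable hV.measurable_deriv mΩ).comp
    (measurable_prodMk_right (y := s))
  refine integral_mono hi ?_ ?_
  · refine Integrable.add ?_ ?_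
    · exact (integrable_of_bounded mJ fun t => abs_doubledDist_le hU.bounded hV.bounded bΩ t s).bdd_mul
        cθ'.aestronglyMeasurable (ae_of_all _ hC₂)
    · exact ((integrable_const _).sub (integrable_of_bounded mG fun t =>
        abs_doubledDistDeriv_le hV.bounded_deriv bΩ t s)).bdd_mul
        hθ.continuous.aestronglyMeasurable (ae_of_all _ hC₁)
  · intro t
    exact add_le_add le_rfl (mul_le_mul_of_nonneg_left
      (hU.integral_doubledFlux_le hμ hf hε hV hΩ pΩ h0 bΩ tΩ r0 r1 t s) (θ0 t))

end Doubling

/-! ### Doubling the time variable -/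

section DoublingInTime

variable {d : ℕ} {f : Fin d → ℝ → ℝ} {μ : Measure (Space d)} {T ε a b M A L K : ℝ}
  {U V D : Space d → ℝ → ℝ} {Ω : Space d → ℝ} {A' N r : ℝ}

/-- Integration by parts in the time variable of `V`. -/
theorem IsBoundedClassicalSolution.integral_deriv_mul_doubledDist
    (hV : IsBoundedClassicalSolution f μ ε a b M A L K V D) (hab : a ≤ b)
    (mU : Measurable fun p : Space d × ℝ => U p.1 p.2) (bU : ∀ x t, |U x t| ≤ M)
    (cΩ : Continuous Ω) (bΩ : ∀ x, |Ω x| ≤ N) {β : ℝ → ℝ} (hβ : ContDiff ℝ 1 β) {C C' : ℝ}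
    (bβ : ∀ t, |β t| ≤ C) (bβ' : ∀ t, |deriv β t| ≤ C') {t : ℝ} (ha : β (t - a) = 0)
    (hb : β (t - b) = 0) :
    ∫ s in Icc a b, doubledDist Ω U V t s * deriv β (t - s)
      = ∫ s in Icc a b, doubledDistDeriv Ω U V D t s * β (t - s) := by
  have cβ' : Continuous (deriv β) := hβ.continuous_deriv le_rfl
  have mβ : Measurable fun p : Space d × Space d × ℝ => β (t - p.2.2) :=
    hβ.continuous.measurable.comp (by fun_prop)
  have mβ' : Measurable fun p : Space d × Space d × ℝ => deriv β (t - p.2.2) :=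
    cβ'.measurable.comp (by fun_prop)
  have m1 : Measurable fun p : Space d × Space d × ℝ => U p.1 t :=
    mU.comp (f := fun p : Space d × Space d × ℝ => (p.1, t)) (by fun_prop)
  have m2 : Measurable fun p : Space d × Space d × ℝ => V p.2.1 p.2.2 :=
    hV.measurable.comp (f := fun p : Space d × Space d × ℝ => (p.2.1, p.2.2)) (by fun_prop)
  have m3 : Measurable fun p : Space d × Space d × ℝ => D p.2.1 p.2.2 :=
    hV.measurable_deriv.comp (f := fun p : Space d × Space d × ℝ => (p.2.1, p.2.2)) (by fun_prop)
  have mΩ : Measurable fun p : Space d × Space d × ℝ => Ω (p.1 - p.2.1) :=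
    cΩ.measurable.comp (by fun_prop)
  have hM : 0 ≤ M := (abs_nonneg _).trans (bU 0 0)
  have hN : 0 ≤ N := (abs_nonneg _).trans (bΩ 0)
  have hL : 0 ≤ L := (abs_nonneg _).trans (hV.bounded_deriv 0 0)
  have r1 := integral_rotate_of_bounded (l := volume.restrict (cell d))
    (m := volume.restrict (cell d)) (n := volume.restrict (Icc a b))
    (F := fun x y s => |U x t - V y s| * Ω (x - y) * deriv β (t - s)) (C := (M + M) * N * C')
    (((m1.sub m2).abs.mul mΩ).mul mβ') (fun x y s => by
      rw [abs_mul, abs_mul, abs_abs]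
      exact mul_le_mul (mul_le_mul ((abs_sub _ _).trans (add_le_add (bU _ _) (hV.bounded _ _)))
        (bΩ _) (abs_nonneg _) (by positivity)) (bβ' _) (abs_nonneg _) (by positivity))
  have r2 := integral_rotate_of_bounded (l := volume.restrict (cell d))
    (m := volume.restrict (cell d)) (n := volume.restrict (Icc a b))
    (F := fun x y s => Real.sign (V y s - U x t) * D y s * Ω (x - y) * β (t - s))
    (C := L * N * C)
    ((((measurable_sign.comp (m2.sub m1)).mul m3).mul mΩ).mul mβ) (fun x y s => by
      rw [abs_mul, abs_mul, abs_mul]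
      refine mul_le_mul (mul_le_mul ?_ (bΩ _) (abs_nonneg _) hL) (bβ _) (abs_nonneg _)
        (by positivity)
      exact (mul_le_of_le_one_left (abs_nonneg _) (abs_sign_le_one _)).trans
        (hV.bounded_deriv _ _))
  simp only [integral_mul_const] at r1 r2
  unfold doubledDist doubledDistDeriv
  rw [← r1, ← r2]
  refine integral_congr_ae (ae_of_all _ fun x => integral_congr_ae (ae_of_all _ fun y => ?_))
  simp only
  have hψ : ∀ s, HasDerivAt (fun s => β (t - s)) (-deriv β (t - s)) s := fun s => by
    have h1 := ((hβ.differentiable one_ne_zero) (t - s)).hasDerivAt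
    have h2 := HasDerivAt.comp s h1 ((hasDerivAt_id s).const_sub t)
    simpa [Function.comp_def] using h2
  -- The weight `β(t - s)` vanishes at both ends of `[a,b]`, so integration by parts in `s` for `|V
  -- - U|` has no boundary terms.
  have key := abs_mul_sub_abs_mul_eq_integral (c := fun s => V y s - U x t) (c' := D y)
    (ψ := fun s => β (t - s)) (ψ' := fun s => -deriv β (t - s)) hab
    (fun s hs => (hV.hasDerivAt y s hs).sub_const _) (hV.continuousOn_deriv y)
    (fun s _ => hψ s) (by fun_prop)
  simp only [ha, hb, mul_zero, sub_zero, mul_neg, integral_neg] at key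
  have e1 : ∫ s in Icc a b, |U x t - V y s| * Ω (x - y) * deriv β (t - s)
      = (∫ s in Icc a b, |V y s - U x t| * deriv β (t - s)) * Ω (x - y) := by
    rw [← integral_mul_const]
    refine integral_congr_ae (ae_of_all _ fun s => ?_)
    simp only
    rw [abs_sub_comm]; ring
  have e2 : ∫ s in Icc a b, Real.sign (V y s - U x t) * D y s * Ω (x - y) * β (t - s)
      = (∫ s in Icc a b, Real.sign (V y s - U x t) * D y s * β (t - s)) * Ω (x - y) := by
    rw [← integral_mul_const]
    refine integral_congr_ae (ae_of_all _ fun s => ?_)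
    simp only
    ring
  rw [e1, e2]
  congr 1
  linarith

/-- The doubled inequality, with the weight `α(t) β(t - s)`. -/
theorem IsBoundedEntropySolution.integral_integral_doubledDist_nonneg (hμ : IsLevyMeasure μ)
    (hf : ∀ j, ContDiff ℝ 1 (f j)) (hε : 0 ≤ ε) (hU : IsBoundedEntropySolution f μ T M U)
    (hV : IsBoundedClassicalSolution f μ ε a b M A L K V D) (hab : a ≤ b) (hΩ : ContDiff ℝ ∞ Ω)
    (pΩ : CellPeriodic Ω) (h0 : ∀ x, 0 ≤ Ω x) (bΩ : ∀ x, |Ω x| ≤ N) (tΩ : TaylorBound A' Ω)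
    (r0 : 0 < r) (r1 : r < 1) {α β : ℝ → ℝ} {p q τ : ℝ} (hα : ContDiff ℝ ∞ α)
    (α0 : ∀ t, 0 ≤ α t) (hp : 0 < p) (hq : q < T) (sα : ∀ t, t ∉ Icc p q → α t = 0)
    (hβ : ContDiff ℝ ∞ β) (β0 : ∀ t, 0 ≤ β t) (sβ : ∀ t, t ∉ Icc 0 τ → β t = 0)
    (hap : a + τ < p) (hqb : q < b) :
    0 ≤ ∫ t in Ioo 0 T, ∫ s in Icc a b, (deriv α t * doubledDist Ω U V t s
      + α t * doublingRate μ ε M A K A' N r Ω) * β (t - s) := by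
  set C₁ := doublingRate μ ε M A K A' N r Ω with hC₁
  have mΩ : Measurable Ω := hΩ.continuous.measurable
  have hα1 : ContDiff ℝ 1 α := hα.of_le (by exact_mod_cast le_top)
  have hβ1 : ContDiff ℝ 1 β := hβ.of_le (by exact_mod_cast le_top)
  have cα' : Continuous (deriv α) := hα1.continuous_deriv le_rfl
  have cβ' : Continuous (deriv β) := hβ1.continuous_deriv le_rfl
  obtain ⟨c₁, c₁0, bα⟩ := exists_bound_of_eq_zero_off_Icc hα.continuous sα
  obtain ⟨c₂, c₂0, bα'⟩ := exists_bound_of_eq_zero_off_Icc cα' (deriv_eq_zero_off_Icc sα)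
  obtain ⟨c₃, c₃0, bβ⟩ := exists_bound_of_eq_zero_off_Icc hβ.continuous sβ
  obtain ⟨c₄, c₄0, bβ'⟩ := exists_bound_of_eq_zero_off_Icc cβ' (deriv_eq_zero_off_Icc sβ)
  have mJ := measurable_doubledDist hU.measurable hV.measurable mΩ
  have mG := measurable_doubledDistDeriv hU.measurable hV.measurable hV.measurable_deriv mΩ
  obtain ⟨j₀, hj⟩ : ∃ C, ∀ t s, |doubledDist Ω U V t s| ≤ C :=
    ⟨_, abs_doubledDist_le hU.bounded hV.bounded bΩ⟩
  obtain ⟨g₀, hg⟩ : ∃ C, ∀ t s, |doubledDistDeriv Ω U V D t s| ≤ C :=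
    ⟨_, abs_doubledDistDeriv_le hV.bounded_deriv bΩ⟩
  generalize hJJ : doubledDist Ω U V = J at mJ hj ⊢
  have hnonneg : ∀ s, 0 ≤ ∫ t in Ioo 0 T,
      ((deriv α t * β (t - s) + α t * deriv β (t - s)) * J t s
        + α t * β (t - s) * (C₁ - doubledDistDeriv Ω U V D t s)) := by
    intro s
    have hβs : ContDiff ℝ ∞ fun t => β (t - s) := hβ.comp (contDiff_id.sub contDiff_const)
    -- The time test function `t ↦ α(t) β(t - s)` depends on the parameter `s`.
    have h := hU.integral_doubledDist_nonneg hμ hf hε hV hΩ pΩ h0 bΩ tΩ r0 r1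
      (θ := fun t => α t * β (t - s)) (hα.mul hβs) (fun t => mul_nonneg (α0 t) (β0 _)) hp hq
      (fun t ht => by rw [sα t ht, zero_mul]) s
    have hd : ∀ t, deriv (fun t => α t * β (t - s)) t
        = deriv α t * β (t - s) + α t * deriv β (t - s) := by
      intro t
      rw [deriv_fun_mul (hα1.differentiable one_ne_zero t)
        (hβs.contDiffAt.differentiableAt (by simp)), deriv_comp_sub_const]
    simp only [hd, hJJ] at h
    exact h
  generalize hGG : doubledDistDeriv Ω U V D = G at mG hg hnonneg
  have m1 : Measurable fun p : ℝ × ℝ => α p.1 := hα.continuous.measurable.comp measurable_fst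
  have m2 : Measurable fun p : ℝ × ℝ => deriv α p.1 := cα'.measurable.comp measurable_fst
  have m3 : Measurable fun p : ℝ × ℝ => β (p.1 - p.2) :=
    hβ.continuous.measurable.comp (by fun_prop)
  have m4 : Measurable fun p : ℝ × ℝ => deriv β (p.1 - p.2) := cβ'.measurable.comp (by fun_prop)
  set R : ℝ → ℝ → ℝ := fun t s => (deriv α t * β (t - s) + α t * deriv β (t - s)) * J t s
        + α t * β (t - s) * (C₁ - G t s) with hR
  have mR : Measurable fun p : ℝ × ℝ => R p.1 p.2 :=
    (((m2.mul m3).add (m1.mul m4)).mul mJ).add ((m1.mul m3).mul (measurable_const.sub mG))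
  have bR : ∀ t s, |R t s| ≤ (c₂ * c₃ + c₁ * c₄) * j₀ + c₁ * c₃ * (|C₁| + g₀) := by
    intro t s
    refine (abs_add_le _ _).trans (add_le_add ?_ ?_)
    · rw [abs_mul]
      refine mul_le_mul ((abs_add_le _ _).trans (add_le_add ?_ ?_)) (hj t s) (abs_nonneg _)
        (by positivity)
      · rw [abs_mul]; exact mul_le_mul (bα' t) (bβ _) (abs_nonneg _) c₂0
      · rw [abs_mul]; exact mul_le_mul (bα t) (bβ' _) (abs_nonneg _) c₁0
    · rw [abs_mul, abs_mul]
      exact mul_le_mul (mul_le_mul (bα t) (bβ _) (abs_nonneg _) c₁0)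
        ((abs_sub _ _).trans (add_le_add le_rfl (hg t s))) (abs_nonneg _) (by positivity)
  have hsum : 0 ≤ ∫ s in Icc a b, ∫ t in Ioo 0 T, R t s := integral_nonneg fun s => hnonneg s
  rw [integral_swap_of_bounded (F := fun s t => R t s) (mR.comp measurable_swap)
    fun s t => bR t s] at hsum
  refine hsum.trans (le_of_eq (integral_congr_ae (ae_of_all _ fun t => ?_)))
  simp only
  by_cases ht : t ∈ Icc p q
  swap
  · simp only [hR, sα t ht, deriv_eq_zero_off_Icc sα t ht, zero_mul, add_zero]
  -- Since `a + τ < p ≤ t ≤ q < b`, the support `[t - τ, t]` of `s ↦ β(t - s)` lies strictly inside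
  -- `(a,b)`.
  have ha0 : β (t - a) = 0 := sβ _ fun h => by linarith [h.2, ht.1]
  have hb0 : β (t - b) = 0 := sβ _ fun h => by linarith [h.1, ht.2]
  have hparts := hV.integral_deriv_mul_doubledDist hab hU.measurable hU.bounded hΩ.continuous bΩ
    hβ1 bβ bβ' ha0 hb0
  rw [hJJ, hGG] at hparts
  have mJt : Measurable (J t) := mJ.comp measurable_prodMk_left
  have mGt : Measurable (G t) := mG.comp measurable_prodMk_left
  have cβt : Continuous fun s => β (t - s) := hβ.continuous.comp (by fun_prop)
  have cβt' : Continuous fun s => deriv β (t - s) := cβ'.comp (by fun_prop)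
  have i0 : Integrable (J t) (volume.restrict (Icc a b)) := integrable_of_bounded mJt (hj t)
  have i1 : Integrable (fun s => J t s * deriv β (t - s)) (volume.restrict (Icc a b)) :=
    i0.mul_bdd (c := c₄) cβt'.aestronglyMeasurable (ae_of_all _ fun s => bβ' _)
  have i2 : Integrable (fun s => G t s * β (t - s)) (volume.restrict (Icc a b)) :=
    (integrable_of_bounded mGt (hg t)).mul_bdd (c := c₃) cβt.aestronglyMeasurable
      (ae_of_all _ fun s => bβ _)
  have i3 : Integrable (fun s => (deriv α t * J t s + α t * C₁) * β (t - s))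
      (volume.restrict (Icc a b)) :=
    ((i0.const_mul _).add (integrable_const _)).mul_bdd (c := c₃) cβt.aestronglyMeasurable
      (ae_of_all _ fun s => bβ _)
  -- The singular factor `β'(t - s)` coming from the test function of `U` cancels, after integration
  -- in `s`, against the time derivative of `V`.
  have e : ∀ s, R t s = (deriv α t * J t s + α t * C₁) * β (t - s)
      + α t * (J t s * deriv β (t - s) - G t s * β (t - s)) := fun s => by
    simp only [hR]; ring
  simp only [e]
  rw [integral_add i3 (by exact (i1.sub i2).const_mul _), integral_const_mul, integral_sub i1 i2, hparts,
    sub_self, mul_zero, add_zero]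

end DoublingInTime

/-! ### Growth of the doubled distance -/

/-- A smooth monotone step from `0` to `1` on `[0,τ]`. -/
noncomputable def ramp (τ t : ℝ) : ℝ := Real.smoothTransition (t / τ)

theorem contDiff_ramp (τ : ℝ) {m : ℕ∞} : ContDiff ℝ m (ramp τ) :=
  Real.smoothTransition.contDiff.comp (contDiff_id.div_const τ)

theorem contDiff_deriv_ramp (τ : ℝ) : ContDiff ℝ ∞ (deriv (ramp τ)) :=
  ((contDiff_infty_iff_deriv).1 (contDiff_ramp τ (m := ⊤))).2

theorem ramp_mono {τ : ℝ} (hτ : 0 < τ) : Monotone (ramp τ) := fun _ _ h =>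
  Real.smoothTransition.monotone (div_le_div_of_nonneg_right h hτ.le)

theorem ramp_nonneg (τ t : ℝ) : 0 ≤ ramp τ t := Real.smoothTransition.nonneg _

theorem ramp_le_one (τ t : ℝ) : ramp τ t ≤ 1 := Real.smoothTransition.le_one _

theorem ramp_of_nonpos {τ t : ℝ} (hτ : 0 < τ) (ht : t ≤ 0) : ramp τ t = 0 :=
  Real.smoothTransition.zero_of_nonpos (div_nonpos_of_nonpos_of_nonneg ht hτ.le)

theorem ramp_of_ge {τ t : ℝ} (hτ : 0 < τ) (ht : τ ≤ t) : ramp τ t = 1 :=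
  Real.smoothTransition.one_of_one_le ((one_le_div hτ).2 ht)

theorem ramp_sub_ramp_eq_zero {τ a b t : ℝ} (hτ : 0 < τ) (hab : a ≤ b) (ht : t ∉ Icc a (b + τ)) :
    ramp τ (t - a) - ramp τ (t - b) = 0 := by
  rcases lt_or_ge t a with h1 | h1
  · rw [ramp_of_nonpos hτ (by linarith), ramp_of_nonpos hτ (by linarith), sub_zero]
  · have h2 : b + τ < t := by
      by_contra hcon
      exact ht ⟨h1, not_lt.1 hcon⟩
    rw [ramp_of_ge hτ (by linarith), ramp_of_ge hτ (by linarith), sub_self]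

theorem deriv_ramp_nonneg {τ : ℝ} (hτ : 0 < τ) (t : ℝ) : 0 ≤ deriv (ramp τ) t :=
  (ramp_mono hτ).deriv_nonneg

theorem deriv_ramp_eq_zero {τ : ℝ} (hτ : 0 < τ) (t : ℝ) (ht : t ∉ Icc 0 τ) :
    deriv (ramp τ) t = 0 := by
  rcases lt_or_ge t 0 with h | h
  · have : ramp τ =ᶠ[𝓝 t] fun _ => 0 := by
      filter_upwards [gt_mem_nhds h] with s hs using ramp_of_nonpos hτ hs.le
    rw [this.deriv_eq]; simp
  · have h2 : τ < t := by
      by_contra hcon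
      exact ht ⟨h, not_lt.1 hcon⟩
    have : ramp τ =ᶠ[𝓝 t] fun _ => 1 := by
      filter_upwards [lt_mem_nhds h2] with s hs using ramp_of_ge hτ hs.le
    rw [this.deriv_eq]; simp

theorem hasDerivAt_ramp (τ t : ℝ) : HasDerivAt (ramp τ) (deriv (ramp τ) t) t :=
  ((contDiff_ramp τ (m := 1)).differentiable one_ne_zero t).hasDerivAt

theorem continuous_deriv_ramp (τ : ℝ) : Continuous (deriv (ramp τ)) :=
  (contDiff_deriv_ramp τ).continuous

theorem setIntegral_deriv_ramp_sub {τ : ℝ} (hτ : 0 < τ) {a p q : ℝ} (hp : p ≤ a)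
    (hq : a + τ ≤ q) : ∫ t in Icc p q, deriv (ramp τ) (t - a) = 1 := by
  have hd : ∀ t, HasDerivAt (fun t => ramp τ (t - a)) (deriv (ramp τ) (t - a)) t := fun t => by
    have h2 := HasDerivAt.comp t (hasDerivAt_ramp τ (t - a)) ((hasDerivAt_id t).sub_const a)
    simpa [Function.comp_def] using h2
  have h := intervalIntegral.integral_eq_sub_of_hasDerivAt (a := p) (b := q) (fun t _ => hd t)
    (((continuous_deriv_ramp τ).comp (continuous_id.sub continuous_const)).intervalIntegrable _ _)
  rw [integral_Icc_eq_integral_Ioc, ← intervalIntegral.integral_of_le (by linarith), h,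
    ramp_of_ge hτ (by linarith), ramp_of_nonpos hτ (by linarith), sub_zero]

theorem setIntegral_deriv_ramp_const_sub {τ : ℝ} (hτ : 0 < τ) {t p q : ℝ} (hp : p ≤ t - τ)
    (hq : t ≤ q) : ∫ s in Icc p q, deriv (ramp τ) (t - s) = 1 := by
  have hd : ∀ s, HasDerivAt (fun s => -ramp τ (t - s)) (deriv (ramp τ) (t - s)) s := fun s => by
    have h2 := (HasDerivAt.comp s (hasDerivAt_ramp τ (t - s)) ((hasDerivAt_id s).const_sub t)).fun_neg
    simpa [Function.comp_def] using h2
  have h := intervalIntegral.integral_eq_sub_of_hasDerivAt (a := p) (b := q) (fun t _ => hd t)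
    (((continuous_deriv_ramp τ).comp (continuous_const.sub continuous_id)).intervalIntegrable _ _)
  rw [integral_Icc_eq_integral_Ioc, ← intervalIntegral.integral_of_le (by linarith), h,
    ramp_of_nonpos hτ (by linarith), ramp_of_ge hτ (by linarith)]
  simp

/-- The averages of `J` near `(b,b)` and `(a,a)` differ by at most the integrated rate. -/
theorem sub_le_of_integral_ramp_nonneg {J : ℝ → ℝ → ℝ} (mJ : Measurable fun q : ℝ × ℝ => J q.1 q.2)
    {j₀ : ℝ} (hj : ∀ t s, |J t s| ≤ j₀) {T C₁ a b a' b' τ p q : ℝ} (hτ : 0 < τ) (hC₁ : 0 ≤ C₁)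
    (hab : a ≤ b) (ha0 : 0 < a) (hbT : b + τ < T) (ha' : a' + τ ≤ a) (hb' : b + τ ≤ b')
    (h : 0 ≤ ∫ t in Ioo 0 T, ∫ s in Icc a' b',
      (deriv (fun t => ramp τ (t - a) - ramp τ (t - b)) t * J t s
        + (ramp τ (t - a) - ramp τ (t - b)) * C₁) * deriv (ramp τ) (t - s))
    (hp : ∀ᵐ t ∂volume.restrict (Ioo 0 T), t ∈ Icc a (a + τ) → ∀ s ∈ Icc (t - τ) t, J t s ≤ p)
    (hq : ∀ᵐ t ∂volume.restrict (Ioo 0 T), t ∈ Icc b (b + τ) → ∀ s ∈ Icc (t - τ) t, q ≤ J t s) :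
    q - p ≤ C₁ * (b - a + τ) := by
  set β := deriv (ramp τ) with hβ
  set α : ℝ → ℝ := fun t => ramp τ (t - a) - ramp τ (t - b) with hα
  have cβ : Continuous β := continuous_deriv_ramp τ
  have cα : Continuous α := by
    have := (contDiff_ramp τ (m := 1)).continuous
    fun_prop
  have β0 : ∀ t, 0 ≤ β t := deriv_ramp_nonneg hτ
  have sβ : ∀ t, t ∉ Icc 0 τ → β t = 0 := deriv_ramp_eq_zero hτ
  -- The weight `α` smooths the indicator of `[a,b]`: its derivative is a unit mass just after `a`
  -- minus a unit mass just after `b`.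
  have dα : ∀ t, deriv α t = β (t - a) - β (t - b) := by
    intro t
    have h1 : ∀ c, HasDerivAt (fun t => ramp τ (t - c)) (β (t - c)) t := fun c => by
      have h2 := HasDerivAt.comp t (hasDerivAt_ramp τ (t - c)) ((hasDerivAt_id t).sub_const c)
      simpa [Function.comp_def] using h2
    exact ((h1 a).sub (h1 b)).deriv
  have α0 : ∀ t, 0 ≤ α t := fun t => sub_nonneg.2 (ramp_mono hτ (by linarith))
  have sα : ∀ t, t ∉ Icc a (b + τ) → α t = 0 := fun t ht => ramp_sub_ramp_eq_zero hτ hab ht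
  have α1 : ∀ t, α t ≤ 1 := fun t => by
    have h1 := ramp_le_one τ (t - a)
    have h2 := ramp_nonneg τ (t - b)
    simp only [hα]; linarith
  obtain ⟨c, hc0, hc⟩ := exists_bound_of_eq_zero_off_Icc cβ sβ
  have habs : ∀ t, |α t| ≤ 1 := fun t => by rw [abs_of_nonneg (α0 t)]; exact α1 t
  have hIoo : Icc a (b + τ) ⊆ Ioo 0 T := fun t ht => ⟨ha0.trans_le ht.1, ht.2.trans_lt hbT⟩
  -- The integrand after replacing `J` by its bounds: `p` where `α'` has its positive part and `q`
  -- where it has its negative part. Its integral is at most `p - q + C₁ (b - a + τ)`.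
  set H : ℝ → ℝ := fun t => β (t - a) * p - β (t - b) * q + α t * C₁ with hH
  have cH : Continuous H := by fun_prop
  have sH : ∀ t, t ∉ Icc a (b + τ) → H t = 0 := by
    intro t ht
    have h1 : β (t - a) = 0 := sβ _ fun h => ht ⟨by linarith [h.1], by linarith [h.2]⟩
    have h2 : β (t - b) = 0 := sβ _ fun h => ht ⟨by linarith [h.1], by linarith [h.2]⟩
    simp only [hH, h1, h2, sα t ht]; ring
  have hcomp : ∫ t in Ioo 0 T, ∫ s in Icc a' b', (deriv α t * J t s + α t * C₁) * β (t - s)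
      ≤ ∫ t in Ioo 0 T, H t := by
    have mβ2 : Measurable fun p : ℝ × ℝ => β (p.1 - p.2) := cβ.measurable.comp (by fun_prop)
    have mdα : Measurable fun p : ℝ × ℝ => deriv α p.1 := by
      simp only [dα]
      exact Continuous.measurable (by fun_prop)
    have mα2 : Measurable fun p : ℝ × ℝ => α p.1 * C₁ := Continuous.measurable (by fun_prop)
    have mF : Measurable fun p : ℝ × ℝ => (deriv α p.1 * J p.1 p.2 + α p.1 * C₁) * β (p.1 - p.2) :=
      ((mdα.mul mJ).add mα2).mul mβ2
    have bF : ∀ t s, |(deriv α t * J t s + α t * C₁) * β (t - s)|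
        ≤ ((c + c) * j₀ + 1 * |C₁|) * c := by
      intro t s
      rw [abs_mul]
      have hj0 : 0 ≤ j₀ := (abs_nonneg _).trans (hj 0 0)
      refine mul_le_mul ((abs_add_le _ _).trans (add_le_add ?_ ?_)) (hc _) (abs_nonneg _)
        (by positivity)
      · rw [abs_mul, dα]
        exact mul_le_mul ((abs_sub _ _).trans (add_le_add (hc _) (hc _))) (hj t s) (abs_nonneg _)
          (by positivity)
      · rw [abs_mul]
        exact mul_le_mul_of_nonneg_right (habs t) (abs_nonneg _)
    refine integral_mono_ae (integrable_of_bounded (measurable_integral_right (F := fun t s =>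
      (deriv α t * J t s + α t * C₁) * β (t - s)) mF) fun t => abs_integral_le_of_bounded (bF t))
      ((cH.integrableOn_Icc (a := 0) (b := T)).mono_set Ioo_subset_Icc_self) ?_
    filter_upwards [hp, hq] with t htp htq
    by_cases ht : t ∈ Icc a (b + τ)
    swap
    · have h1 : β (t - a) = 0 := sβ _ fun h => ht ⟨by linarith [h.1], by linarith [h.2]⟩
      have h2 : β (t - b) = 0 := sβ _ fun h => ht ⟨by linarith [h.1], by linarith [h.2]⟩
      simp [dα, h1, h2, sα t ht, sH t ht]
    -- The window `[a',b']` contains `[t - τ, t]` for all relevant `t`, so the inner weight has its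
    -- full mass.
    have hone : ∫ s in Icc a' b', β (t - s) = 1 :=
      setIntegral_deriv_ramp_const_sub hτ (by linarith [ht.1]) (by linarith [ht.2])
    have hHt : H t = ∫ s in Icc a' b', H t * β (t - s) := by
      rw [integral_const_mul, hone, mul_one]
    rw [hHt]
    refine integral_mono (integrable_of_bounded (mF.comp measurable_prodMk_left) (bF t))
      ((cβ.comp (continuous_const.sub continuous_id)).integrableOn_Icc.const_mul _) fun s => ?_
    simp only
    by_cases hs : t - s ∈ Icc 0 τ
    swap
    · rw [sβ _ hs, mul_zero, mul_zero]
    have hs' : s ∈ Icc (t - τ) t := ⟨by linarith [hs.2], by linarith [hs.1]⟩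
    refine mul_le_mul_of_nonneg_right ?_ (β0 _)
    have h1 : β (t - a) * J t s ≤ β (t - a) * p := by
      by_cases hta : t - a ∈ Icc 0 τ
      · exact mul_le_mul_of_nonneg_left
          (htp ⟨by linarith [hta.1], by linarith [hta.2]⟩ s hs') (β0 _)
      · rw [sβ _ hta, zero_mul, zero_mul]
    have h2 : β (t - b) * q ≤ β (t - b) * J t s := by
      by_cases htb : t - b ∈ Icc 0 τ
      · exact mul_le_mul_of_nonneg_left
          (htq ⟨by linarith [htb.1], by linarith [htb.2]⟩ s hs') (β0 _)
      · rw [sβ _ htb, zero_mul, zero_mul]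
    rw [dα]
    simp only [hH]
    linarith
  have hset : ∫ t in Ioo 0 T, H t = ∫ t in Icc a (b + τ), H t := by
    refine setIntegral_eq_of_subset_of_forall_sdiff_eq_zero measurableSet_Ioo hIoo
      fun t ht => sH t ht.2
  have hval : ∫ t in Icc a (b + τ), H t ≤ p - q + C₁ * (b - a + τ) := by
    have i1 : ∀ c, IntegrableOn (fun t => β (t - c)) (Icc a (b + τ)) := fun c =>
      (cβ.comp (continuous_id.sub continuous_const)).integrableOn_Icc
    have i2 : IntegrableOn α (Icc a (b + τ)) := cα.integrableOn_Icc
    have h3 : ∫ t in Icc a (b + τ), α t ≤ b - a + τ := by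
      refine (integral_mono i2 (integrable_const (1 : ℝ)) α1).trans (le_of_eq ?_)
      rw [integral_const, measureReal_restrict_apply_univ, Real.volume_real_Icc_of_le (by linarith),
        smul_eq_mul, mul_one]
      ring
    simp only [hH]
    rw [integral_add (by exact ((i1 a).mul_const _).sub ((i1 b).mul_const _)) (i2.mul_const _),
      integral_sub ((i1 a).mul_const _) ((i1 b).mul_const _), integral_mul_const,
      integral_mul_const, integral_mul_const, setIntegral_deriv_ramp_sub hτ le_rfl (by linarith),
      setIntegral_deriv_ramp_sub hτ hab le_rfl]
    have := mul_le_mul_of_nonneg_right h3 hC₁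
    linarith
  linarith

/-! ### The doubled distance as a functional of two functions -/

section Smeared

variable {d : ℕ} {Ω g g' h h' : Space d → ℝ}

/-- A continuous nonnegative periodic kernel of mass one, which is even. -/
structure IsPeriodicKernel (Ω : Space d → ℝ) : Prop where
  continuous : Continuous Ω
  periodic : CellPeriodic Ω
  nonneg : ∀ x, 0 ≤ Ω x
  even : ∀ x, Ω (-x) = Ω x
  integral_eq_one : ∫ x in cell d, Ω x = 1

theorem IsPeriodicKernel.integral_sub_right (hΩ : IsPeriodicKernel Ω) (y : Space d) :
    ∫ x in cell d, Ω (x - y) = 1 := by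
  simp only [sub_eq_add_neg]
  rw [setIntegral_cell_add hΩ.periodic, hΩ.integral_eq_one]

theorem IsPeriodicKernel.integral_sub_left (hΩ : IsPeriodicKernel Ω) (x : Space d) :
    ∫ y in cell d, Ω (x - y) = 1 := by
  rw [← hΩ.integral_sub_right x]
  refine integral_congr_ae (ae_of_all _ fun y => ?_)
  simp only
  rw [← hΩ.even, neg_sub]

theorem IsPeriodicKernel.integrable_mul (hΩ : IsPeriodicKernel Ω) {F : Space d × Space d → ℝ}
    (hF : Integrable F ((volume.restrict (cell d)).prod (volume.restrict (cell d)))) :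
    Integrable (fun p => F p * Ω (p.1 - p.2))
      ((volume.restrict (cell d)).prod (volume.restrict (cell d))) := by
  obtain ⟨N, hN⟩ := exists_bound_of_periodic hΩ.periodic hΩ.continuous
  exact hF.mul_bdd (c := N) (hΩ.continuous.comp (by fun_prop)).aestronglyMeasurable
    (ae_of_all _ fun p => hN _)

theorem IsPeriodicKernel.integral_fst (hΩ : IsPeriodicKernel Ω)
    (hg : Integrable g (volume.restrict (cell d))) :
    ∫ p, g p.1 * Ω (p.1 - p.2) ∂(volume.restrict (cell d)).prod (volume.restrict (cell d))
      = ∫ x in cell d, g x := by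
  rw [integral_prod _ (hΩ.integrable_mul (hg.comp_fst _))]
  simp only [integral_const_mul, hΩ.integral_sub_left, mul_one]

theorem IsPeriodicKernel.integral_snd (hΩ : IsPeriodicKernel Ω)
    (hg : Integrable g (volume.restrict (cell d))) :
    ∫ p, g p.2 * Ω (p.1 - p.2) ∂(volume.restrict (cell d)).prod (volume.restrict (cell d))
      = ∫ x in cell d, g x := by
  rw [integral_prod_symm _ (hΩ.integrable_mul (hg.comp_snd _))]
  simp only [integral_const_mul, hΩ.integral_sub_right, mul_one]

/-- The smeared `L¹` distance `∬ |g(x) - h(y)| Ω(x - y) dx dy`. -/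
noncomputable def smearedDist (Ω g h : Space d → ℝ) : ℝ :=
  ∫ x in cell d, ∫ y in cell d, |g x - h y| * Ω (x - y)

theorem integrable_abs_sub_prod (hg : Integrable g (volume.restrict (cell d)))
    (hh : Integrable h (volume.restrict (cell d))) :
    Integrable (fun p : Space d × Space d => |g p.1 - h p.2|)
      ((volume.restrict (cell d)).prod (volume.restrict (cell d))) :=
  ((hg.comp_fst _).sub (hh.comp_snd _)).abs

theorem IsPeriodicKernel.smearedDist_eq (hΩ : IsPeriodicKernel Ω)
    (hg : Integrable g (volume.restrict (cell d))) (hh : Integrable h (volume.restrict (cell d))) :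
    smearedDist Ω g h = ∫ p, |g p.1 - h p.2| * Ω (p.1 - p.2)
      ∂(volume.restrict (cell d)).prod (volume.restrict (cell d)) :=
  (integral_prod _ (hΩ.integrable_mul (integrable_abs_sub_prod hg hh))).symm

/-- Both marginals of `Ω(x - y)` are one, so the smeared distance is nonexpansive in each argument.
-/
theorem IsPeriodicKernel.smearedDist_le_add (hΩ : IsPeriodicKernel Ω)
    (hg : Integrable g (volume.restrict (cell d))) (hg' : Integrable g' (volume.restrict (cell d)))
    (hh : Integrable h (volume.restrict (cell d))) (hh' : Integrable h' (volume.restrict (cell d))) :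
    smearedDist Ω g h ≤ smearedDist Ω g' h' + (∫ x in cell d, |g x - g' x|)
      + ∫ x in cell d, |h x - h' x| := by
  have k1 : Integrable (fun x => |g x - g' x|) (volume.restrict (cell d)) := (hg.sub hg').abs
  have k2 : Integrable (fun x => |h x - h' x|) (volume.restrict (cell d)) := (hh.sub hh').abs
  rw [hΩ.smearedDist_eq hg hh, hΩ.smearedDist_eq hg' hh', ← hΩ.integral_fst k1,
    ← hΩ.integral_snd k2]
  have i1 := hΩ.integrable_mul (integrable_abs_sub_prod hg hh)
  have i2 := hΩ.integrable_mul (integrable_abs_sub_prod hg' hh')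
  have i3 := hΩ.integrable_mul (k1.comp_fst (volume.restrict (cell d)))
  have i4 := hΩ.integrable_mul (k2.comp_snd (volume.restrict (cell d)))
  rw [← integral_add i2 i3, ← integral_add (by exact i2.add i3) i4]
  refine integral_mono i1 (by exact (i2.add i3).add i4) fun p => ?_
  simp only
  rw [← add_mul, ← add_mul]
  refine mul_le_mul_of_nonneg_right ?_ (hΩ.nonneg _)
  have e : g p.1 - h p.2 = (g' p.1 - h' p.2) + (g p.1 - g' p.1) + -(h p.2 - h' p.2) := by ring
  rw [e]
  refine (abs_add_le _ _).trans (add_le_add (abs_add_le _ _) (by rw [abs_neg]))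

theorem IsPeriodicKernel.smearedDist_le (hΩ : IsPeriodicKernel Ω)
    (hg : Integrable g (volume.restrict (cell d))) (hh : Integrable h (volume.restrict (cell d))) :
    smearedDist Ω g h ≤ (∫ x in cell d, |g x - h x|) + smearedDist Ω h h := by
  have h1 := hΩ.smearedDist_le_add hg hh hh hh
  simp only [sub_self, abs_zero, integral_zero, add_zero] at h1
  linarith

/-- The estimate goes from `g(x)` through `h(y)` to `h(x)`. Only the smeared distance of `h` from
itself appears; with the viscous solution as `h`, no regularity of the entropy solution is needed.
-/
theorem IsPeriodicKernel.integral_abs_sub_le (hΩ : IsPeriodicKernel Ω)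
    (hg : Integrable g (volume.restrict (cell d))) (hh : Integrable h (volume.restrict (cell d))) :
    ∫ x in cell d, |g x - h x| ≤ smearedDist Ω g h + smearedDist Ω h h := by
  have k1 : Integrable (fun x => |g x - h x|) (volume.restrict (cell d)) := (hg.sub hh).abs
  rw [hΩ.smearedDist_eq hg hh, hΩ.smearedDist_eq hh hh, ← hΩ.integral_fst k1]
  have i1 := hΩ.integrable_mul (integrable_abs_sub_prod hg hh)
  have i2 := hΩ.integrable_mul (integrable_abs_sub_prod hh hh)
  have i3 := hΩ.integrable_mul (k1.comp_fst (volume.restrict (cell d)))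
  rw [← integral_add i1 i2]
  refine integral_mono i3 (by exact i1.add i2) fun p => ?_
  simp only
  rw [← add_mul]
  refine mul_le_mul_of_nonneg_right ?_ (hΩ.nonneg _)
  rw [abs_sub_comm (h p.1) (h p.2)]
  refine le_trans (le_of_eq ?_) (abs_add_le _ _)
  congr 1; ring

theorem smearedDist_congr (hg : g =ᵐ[volume] g') (hh : ∀ y, h y = h' y) :
    smearedDist Ω g h = smearedDist Ω g' h' := by
  unfold smearedDist
  refine integral_congr_ae (ae_restrict_of_ae ?_)
  filter_upwards [hg] with x hx
  simp only [hx, hh]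

theorem isPeriodicKernel_torusKernel (d n : ℕ) : IsPeriodicKernel (torusKernel (d := d) n) where
  continuous := (contDiff_torusKernel n (m := 0)).continuous
  periodic := cellPeriodic_torusKernel n
  nonneg := torusKernel_nonneg n
  even := torusKernel_neg n
  integral_eq_one := integral_torusKernel n

end Smeared

/-! ### Continuity in time of the smeared distance -/

section Growth

variable {d : ℕ} {f : Fin d → ℝ → ℝ} {μ : Measure (Space d)} {T ε : ℝ} {u₀ : Space d → ℝ}
  {u v : Space d → ℝ → ℝ} {Ω : Space d → ℝ}

theorem IsEntropySolution.integrable_slice (hu : IsEntropySolution f μ T u₀ u) {t : ℝ}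
    (ht : t ∈ Icc 0 T) : Integrable (fun x => u x t) (volume.restrict (cell d)) := by
  obtain ⟨M, hM⟩ := hu.bounded
  exact Integrable.of_bound (hu.measurable_slice t ht).restrict M (ae_restrict_of_ae (hM t ht))

theorem IsViscousSolution.integrable_slice (hv : IsViscousSolution f μ T ε u₀ v) {t : ℝ}
    (ht : t ∈ Ioo 0 T) : Integrable (fun x => v x t) (volume.restrict (cell d)) :=
  integrable_cell_of_continuous (hv.continuous_slice ht) (hv.periodic t ht)

theorem IsEntropySolution.exists_integral_abs_sub_le (hu : IsEntropySolution f μ T u₀ u) {a : ℝ}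
    (ha : a ∈ Ioo 0 T) {δ : ℝ} (hδ : 0 < δ) :
    ∀ᶠ t in 𝓝 a, ∫ x in cell d, |u x t - u x a| ≤ δ := by
  have h := hu.continuous a (Ioo_subset_Icc_self ha)
  rw [nhdsWithin_eq_nhds.2 (Icc_mem_nhds ha.1 ha.2)] at h
  have h2 := h.eventually (gt_mem_nhds (ENNReal.ofReal_pos.2 hδ))
  filter_upwards [h2, isOpen_Ioo.mem_nhds ha] with t ht hmem
  rw [distL1_eq_ofReal ((hu.integrable_slice (Ioo_subset_Icc_self hmem)).sub
    (hu.integrable_slice (Ioo_subset_Icc_self ha))).abs] at ht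
  exact ((ENNReal.ofReal_lt_ofReal_iff hδ).1 ht).le

theorem IsViscousSolution.exists_integral_abs_sub_le (hv : IsViscousSolution f μ T ε u₀ v) {a : ℝ}
    (ha : a ∈ Ioo 0 T) {δ : ℝ} (hδ : 0 < δ) :
    ∀ᶠ t in 𝓝 a, ∫ x in cell d, |v x t - v x a| ≤ δ := by
  obtain ⟨p, hp, hpa⟩ := exists_between ha.1
  obtain ⟨q, haq, hq⟩ := exists_between ha.2
  obtain ⟨L, hL⟩ := hv.exists_bound_deriv hp hq
  have hsub : Icc p q ⊆ Ioo 0 T := fun t ht => ⟨hp.trans_le ht.1, ht.2.trans_lt hq⟩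
  have hlim : Tendsto (fun t => L * |t - a| * (volume.restrict (cell d)).real univ) (𝓝 a) (𝓝 0) := by
    have : Continuous fun t : ℝ => L * |t - a| * (volume.restrict (cell d)).real univ := by fun_prop
    simpa using this.tendsto a
  filter_upwards [hlim.eventually (gt_mem_nhds hδ), Icc_mem_nhds hpa haq] with t ht hmem
  refine le_trans ?_ ht.le
  refine (le_abs_self _).trans (abs_integral_le_of_bounded fun x => ?_)
  rw [abs_abs]
  exact Convex.norm_image_sub_le_of_norm_hasDerivWithin_le (f := v x) (s := Icc p q) (C := L)
    (x := a) (y := t) (fun s hs => (hv.differentiable_time x s (hsub hs)).hasDerivAt.hasDerivWithinAt)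
    (fun s hs => hL x s hs) (convex_Icc p q) ⟨hpa.le, haq.le⟩ hmem

/-- Since the smeared distance is controlled in `L¹`, the time kernel can be shrunk to zero at fixed
`Ω`, leaving no error from the time doubling. -/
theorem IsEntropySolution.exists_smearedDist_close (hΩ : IsPeriodicKernel Ω)
    (hu : IsEntropySolution f μ T u₀ u) (hv : IsViscousSolution f μ T ε u₀ v) {a : ℝ}
    (ha : a ∈ Ioo 0 T) {δ : ℝ} (hδ : 0 < δ) :
    ∃ η > 0, ∀ t s, |t - a| ≤ η → |s - a| ≤ η →
      smearedDist Ω (fun x => u x t) (fun x => v x s)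
          ≤ smearedDist Ω (fun x => u x a) (fun x => v x a) + δ ∧
        smearedDist Ω (fun x => u x a) (fun x => v x a) - δ
          ≤ smearedDist Ω (fun x => u x t) (fun x => v x s) := by
  have h1 := (hu.exists_integral_abs_sub_le ha (half_pos hδ)).and
    ((hv.exists_integral_abs_sub_le ha (half_pos hδ)).and (isOpen_Ioo.mem_nhds ha))
  obtain ⟨η, hη, hball⟩ := Metric.nhds_basis_closedBall.eventually_iff.1 h1
  refine ⟨η, hη, fun t s ht hs => ?_⟩
  obtain ⟨hut, -, htI⟩ := hball (Metric.mem_closedBall.2 ht)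
  obtain ⟨-, hvs, hsI⟩ := hball (Metric.mem_closedBall.2 hs)
  have i1 := hu.integrable_slice (Ioo_subset_Icc_self htI)
  have i2 := hu.integrable_slice (Ioo_subset_Icc_self ha)
  have i3 := hv.integrable_slice hsI
  have i4 := hv.integrable_slice ha
  have k1 := hΩ.smearedDist_le_add i1 i2 i3 i4
  have k2 := hΩ.smearedDist_le_add i2 i1 i4 i3
  simp only [abs_sub_comm (u _ a), abs_sub_comm (v _ a)] at k2
  constructor <;> linarith

end Growth

/-! ### Growth of the smeared distance and the smearing error -/

section Rate

variable {d : ℕ} {f : Fin d → ℝ → ℝ} {μ : Measure (Space d)} {T ε : ℝ} {u₀ : Space d → ℝ}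
  {u v : Space d → ℝ → ℝ}

/-- The growth of the smeared distance between the entropy solution and the viscous solution. -/
theorem IsEntropySolution.smearedDist_le_add (hμ : IsLevyMeasure μ)
    (hf : ∀ j, ContDiff ℝ 1 (f j)) (hε : 0 ≤ ε) (hu : IsEntropySolution f μ T u₀ u)
    (hv : IsViscousSolution f μ T ε u₀ v) {K : ℝ} (K0 : 0 ≤ K)
    (hK : ∀ t ∈ Ioo 0 T, ∀ j, ∫ y in cell d, |partialDeriv j (fun y => v y t) y| ≤ K) (n : ℕ)
    {a b : ℝ} (ha : 0 < a) (hab : a ≤ b) (hb : b < T) :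
    smearedDist (torusKernel n) (fun x => u x b) (fun x => v x b)
      ≤ smearedDist (torusKernel n) (fun x => u x a) (fun x => v x a)
        + ε * (∑ j : Fin d, K * (∫ x in cell d, |partialDeriv j (torusKernel n) x|)) * (b - a) := by
  set Ω : Space d → ℝ := torusKernel n with hΩdef
  have hker : IsPeriodicKernel Ω := isPeriodicKernel_torusKernel d n
  have hΩ : ContDiff ℝ ∞ Ω := contDiff_torusKernel n
  obtain ⟨A', tΩ⟩ := exists_taylorBound_torusKernel d n
  obtain ⟨N, bΩ⟩ := exists_bound_of_periodic hker.periodic hker.continuous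
  have hN0 : 0 ≤ N := (norm_nonneg _).trans (bΩ 0)
  have tΩ' : TaylorBound |A'| Ω := fun y z => (tΩ y z).trans (by gcongr; exact le_abs_self A')
  obtain ⟨M₁, U, hU, hUu⟩ := hu.exists_isBoundedEntropySolution hf hμ
  -- The window `[a/2, (b+T)/2]` contains `[a - τ, b + τ]` once `τ` is small.
  obtain ⟨M₂, A, L, V, D, A0, hV, hVv⟩ := hv.exists_isBoundedClassicalSolution (K := K)
    (a := a / 2) (b := (b + T) / 2) (by linarith) (by linarith) (by linarith) hK
  set M := max M₁ M₂
  replace hU := hU M (le_max_left _ _)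
  replace hV := hV M (le_max_right _ _)
  have hM : 0 ≤ M := (abs_nonneg _).trans (hU.bounded 0 0)
  set S := ε * (∑ j : Fin d, K * (∫ x in cell d, |partialDeriv j Ω x|)) with hS
  have hS0 : 0 ≤ S := mul_nonneg hε (Finset.sum_nonneg fun j _ =>
    mul_nonneg K0 (integral_nonneg fun _ => abs_nonneg _))
  set E := (2 * M * |A'| + A * N) * (volume.restrict (cell d)).real univ ^ 2 with hE
  have hE0 : 0 ≤ E := by positivity
  -- The bounded version agrees with `u` only for almost every `t`; this suffices under the time
  -- integral, and the values at `a` and `b` are recovered from the continuity of `u` itself.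
  have hJ : ∀ᵐ t ∂volume.restrict (Ioo 0 T), ∀ s ∈ Icc (a / 2) ((b + T) / 2),
      doubledDist Ω U V t s = smearedDist Ω (fun x => u x t) (fun x => v x s) := by
    filter_upwards [hUu] with t ht s hs
    exact smearedDist_congr ht.symm fun y => hVv y s hs
  refine le_of_forall_pos_le_add fun δ hδ => ?_
  obtain ⟨η₁, hη₁, h1⟩ := hu.exists_smearedDist_close hker hv ⟨ha, hab.trans_lt hb⟩ (half_pos hδ)
  obtain ⟨η₂, hη₂, h2⟩ := hu.exists_smearedDist_close hker hv ⟨ha.trans_le hab, hb⟩ (half_pos hδ)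
  set pa := smearedDist Ω (fun x => u x a) (fun x => v x a)
  set pb := smearedDist Ω (fun x => u x b) (fun x => v x b)
  have hstep : ∀ τ : ℝ, 0 < τ → τ < η₁ → τ < η₂ → τ < a / 2 → τ < (T - b) / 2 →
      (pb - δ / 2) - (pa + δ / 2) ≤ S * (b - a + τ) := by
    intro τ hτ t1 t2 t3 t4
    -- At fixed `τ` the jump threshold `r = 1/(m+2)` tends to zero first. The constant `E` contains
    -- the second derivative bounds of `V` and `Ω`, but not `r`.
    have hn : ∀ m : ℕ, (pb - δ / 2) - (pa + δ / 2)
        ≤ (S + levyMoment μ (1 / ((m : ℝ) + 2)) * E) * (b - a + τ) := by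
      intro m
      have r0 : (0 : ℝ) < 1 / ((m : ℝ) + 2) := by positivity
      have r1 : 1 / ((m : ℝ) + 2) < 1 := by
        rw [div_lt_one (by positivity)]
        linarith [Nat.cast_nonneg (α := ℝ) m]
      have hd := hU.integral_integral_doubledDist_nonneg hμ hf hε hV (by linarith) hΩ
        hker.periodic hker.nonneg bΩ tΩ' r0 r1
        (α := fun t => ramp τ (t - a) - ramp τ (t - b)) (β := deriv (ramp τ)) (p := a)
        (q := b + τ) (τ := τ)
        (((contDiff_ramp τ).comp (contDiff_id.sub contDiff_const)).sub
          ((contDiff_ramp τ).comp (contDiff_id.sub contDiff_const)))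
        (fun t => sub_nonneg.2 (ramp_mono hτ (by linarith))) ha (by linarith)
        (fun t ht => ramp_sub_ramp_eq_zero hτ hab ht) (contDiff_deriv_ramp τ)
        (deriv_ramp_nonneg hτ) (deriv_ramp_eq_zero hτ) (by linarith) (by linarith)
      refine sub_le_of_integral_ramp_nonneg
        (measurable_doubledDist hU.measurable hV.measurable hΩ.continuous.measurable)
        (abs_doubledDist_le hU.bounded hV.bounded bΩ) hτ ?_ hab ha (by linarith)
        (a' := a / 2) (b' := (b + T) / 2) (by linarith) (by linarith) hd ?_ ?_
      · exact add_nonneg hS0 (mul_nonneg (levyMoment_nonneg _ _) hE0)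
      · filter_upwards [hJ] with t ht htm s hs
        rw [ht s ⟨by linarith [htm.1, hs.1], by linarith [htm.2, hs.2]⟩]
        exact (h1 t s (abs_le.2 ⟨by linarith [htm.1], by linarith [htm.2]⟩)
          (abs_le.2 ⟨by linarith [htm.1, hs.1], by linarith [htm.2, hs.2]⟩)).1
      · filter_upwards [hJ] with t ht htm s hs
        rw [ht s ⟨by linarith [htm.1, hs.1], by linarith [htm.2, hs.2]⟩]
        exact (h2 t s (abs_le.2 ⟨by linarith [htm.1], by linarith [htm.2]⟩)
          (abs_le.2 ⟨by linarith [htm.1, hs.1], by linarith [htm.2, hs.2]⟩)).2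
    have hlim : Tendsto (fun m : ℕ => (S + levyMoment μ (1 / ((m : ℝ) + 2)) * E) * (b - a + τ))
        atTop (𝓝 ((S + 0 * E) * (b - a + τ))) :=
      ((hμ.tendsto_levyMoment.mul_const E).const_add S).mul_const _
    have := ge_of_tendsto' hlim hn
    rwa [zero_mul, add_zero] at this
  -- Next the width `τ` of the time kernel tends to zero; `δ` is arbitrary.
  have hlim : Tendsto (fun τ : ℝ => S * (b - a + τ)) (𝓝[>] 0) (𝓝 (S * (b - a + 0))) :=
    (Continuous.tendsto (by fun_prop) 0).mono_left nhdsWithin_le_nhds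
  have hev : ∀ᶠ τ : ℝ in 𝓝[>] 0, (pb - δ / 2) - (pa + δ / 2) ≤ S * (b - a + τ) := by
    have hlt : ∀ c : ℝ, 0 < c → ∀ᶠ τ : ℝ in 𝓝[>] 0, τ < c := fun c hc =>
      nhdsWithin_le_nhds (gt_mem_nhds hc)
    filter_upwards [self_mem_nhdsWithin, hlt _ hη₁, hlt _ hη₂, hlt (a / 2) (by linarith),
      hlt ((T - b) / 2) (by linarith)] with τ h0 t1 t2 t3 t4 using hstep τ h0 t1 t2 t3 t4
  have := ge_of_tendsto hlim hev
  rw [add_zero] at this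
  linarith

/-- A representative of `s` modulo `2π` which is comparable to `sin(s/2)`. -/
theorem exists_int_abs_sub_le_sin {s : ℝ} (hs : s ∈ Ioo 0 (2 * Real.pi)) :
    ∃ c : ℤ, |s - c * (2 * Real.pi)| ≤ Real.pi * |Real.sin (s / 2)| := by
  have hpi := Real.pi_pos
  -- Jordan's inequality `sin x ≥ 2x/π` on `[0, π/2]`, with `x = t/2`; points beyond `π` are
  -- reflected about `π`.
  have key : ∀ t : ℝ, 0 ≤ t → t ≤ Real.pi → t ≤ Real.pi * Real.sin (t / 2) := by
    intro t h0 h1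
    have h := Real.mul_le_sin (x := t / 2) (by linarith) (by linarith)
    have h2 := mul_le_mul_of_nonneg_left h hpi.le
    have h3 : Real.pi * (2 / Real.pi * (t / 2)) = t := by field_simp
    rwa [h3] at h2
  rcases le_or_gt s Real.pi with h | h
  · refine ⟨0, ?_⟩
    rw [Int.cast_zero, zero_mul, sub_zero, abs_of_pos hs.1]
    exact (key s hs.1.le h).trans (mul_le_mul_of_nonneg_left (le_abs_self _) hpi.le)
  · refine ⟨1, ?_⟩
    rw [Int.cast_one, one_mul, abs_of_neg (by linarith [hs.2]), neg_sub]
    refine (key (2 * Real.pi - s) (by linarith [hs.2]) (by linarith)).trans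
      (mul_le_mul_of_nonneg_left ?_ hpi.le)
    rw [show (2 * Real.pi - s) / 2 = Real.pi - s / 2 by ring, Real.sin_pi_sub]
    exact le_abs_self _

/-- The derivative is integrated along the segment from `y` to `y + w`; by periodicity every
intermediate translate has the same `L¹` norm. -/
theorem integral_abs_add_sub_le {V : Space d → ℝ} (hV : ContDiff ℝ 1 V) (pV : CellPeriodic V)
    (w : Space d) : ∫ y in cell d, |V (y + w) - V y|
      ≤ ∑ j, |w j| * ∫ y in cell d, |partialDeriv j V y| := by
  choose C hC using fun j =>
    exists_bound_of_periodic (pV.partialDeriv j) (continuous_partialDeriv hV j)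
  have cD : ∀ j, Continuous fun p : Space d × ℝ => |partialDeriv j V (p.1 + p.2 • w)| := fun j =>
    ((continuous_partialDeriv hV j).comp (by fun_prop)).abs
  have hline : ∀ y, |V (y + w) - V y|
      ≤ ∫ σ in Icc (0 : ℝ) 1, ∑ j, |w j| * |partialDeriv j V (y + σ • w)| := by
    intro y
    have hd : ∀ σ : ℝ, HasDerivAt (fun σ : ℝ => V (y + σ • w)) (fderiv ℝ V (y + σ • w) w) σ := by
      intro σ
      have h1 := ((hV.differentiable one_ne_zero) (y + σ • w)).hasFDerivAt
      have h2 : HasDerivAt (fun σ : ℝ => y + σ • w) w σ := by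
        simpa using ((hasDerivAt_id σ).smul_const w).const_add y
      exact h1.comp_hasDerivAt σ h2
    have hc : Continuous fun σ : ℝ => fderiv ℝ V (y + σ • w) w :=
      ((hV.continuous_fderiv one_ne_zero).comp (by fun_prop)).clm_apply continuous_const
    have h := intervalIntegral.integral_eq_sub_of_hasDerivAt (a := 0) (b := 1) (fun σ _ => hd σ)
      (hc.intervalIntegrable _ _)
    simp only [one_smul, zero_smul, add_zero] at h
    rw [← h, intervalIntegral.integral_of_le zero_le_one, ← integral_Icc_eq_integral_Ioc,
      ← Real.norm_eq_abs]
    refine norm_integral_le_of_norm_le (Continuous.integrableOn_Icc ?_) (ae_of_all _ fun σ => ?_)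
    · exact continuous_finsetSum _ fun j _ =>
        ((cD j).comp (f := fun σ : ℝ => (y, σ)) (by fun_prop)).const_mul _
    · rw [fderiv_eq_sum_partialDeriv, Real.norm_eq_abs]
      refine (Finset.abs_sum_le_sum_abs _ _).trans (le_of_eq ?_)
      exact Finset.sum_congr rfl fun j _ => abs_mul _ _
  have mF : Measurable (Function.uncurry fun (y : Space d) (σ : ℝ) =>
      ∑ j, |w j| * |partialDeriv j V (y + σ • w)|) :=
    (continuous_finsetSum _ fun j _ => (cD j).const_mul _).measurable
  have bF : ∀ (y : Space d) (σ : ℝ), |(∑ j, |w j| * |partialDeriv j V (y + σ • w)|)|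
      ≤ ∑ j, |w j| * C j := by
    intro y σ
    refine (Finset.abs_sum_le_sum_abs _ _).trans (Finset.sum_le_sum fun j _ => ?_)
    rw [abs_mul, abs_abs, abs_abs]
    exact mul_le_mul_of_nonneg_left (hC j _) (abs_nonneg _)
  have i1 : Integrable (fun y => |V (y + w) - V y|) (volume.restrict (cell d)) := by
    refine integrable_cell_of_continuous ((hV.continuous.comp
      (continuous_id.add continuous_const)).sub hV.continuous).abs fun j y => ?_
    rw [add_right_comm, pV j, pV j]
  refine (integral_mono i1 (integrable_of_bounded (measurable_integral_right mF)
    fun y => abs_integral_le_of_bounded (bF y)) hline).trans ?_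
  rw [integral_swap_of_bounded mF bF]
  have hσ : ∀ σ : ℝ, ∫ y in cell d, ∑ j, |w j| * |partialDeriv j V (y + σ • w)|
      = ∑ j, |w j| * ∫ y in cell d, |partialDeriv j V y| := by
    intro σ
    rw [integral_finsetSum]
    · refine Finset.sum_congr rfl fun j _ => ?_
      rw [integral_const_mul, setIntegral_cell_add ((pV.partialDeriv j).comp (|·|))]
    · intro j _
      refine Integrable.const_mul (integrable_cell_of_continuous
        ((cD j).comp (f := fun y : Space d => (y, σ)) (by fun_prop)) fun i y => ?_) _
      simp only [Function.comp_apply]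
      rw [add_right_comm, pV.partialDeriv j i]
  simp only [hσ, integral_const, measureReal_restrict_apply_univ, Real.volume_real_Icc, smul_eq_mul]
  simp

/-- In the variable `h = x - y` this is the `L¹` translation modulus of `V` averaged against the
kernel, hence at most `K` times the first moments; the constant `π` compares distance with
`|sin(h_j/2)|`. -/
theorem smearedDist_self_le {V : Space d → ℝ} (hV : ContDiff ℝ 1 V) (pV : CellPeriodic V) {K : ℝ}
    (K0 : 0 ≤ K) (hK : ∀ j, ∫ y in cell d, |partialDeriv j V y| ≤ K) (n : ℕ) :
    smearedDist (torusKernel n) V V ≤ d * (K * Real.pi) / Real.sqrt (n + 1) := by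
  set Ω : Space d → ℝ := torusKernel n with hΩdef
  have hker : IsPeriodicKernel Ω := isPeriodicKernel_torusKernel d n
  have cΩ := hker.continuous
  obtain ⟨N, bΩ⟩ := exists_bound_of_periodic hker.periodic cΩ
  obtain ⟨M, bV⟩ := exists_bound_of_periodic pV hV.continuous
  have hM : 0 ≤ M := (norm_nonneg _).trans (bV 0)
  have cV := hV.continuous
  have hb : ∀ a c e : Space d, |(|V a - V c| * Ω e)| ≤ (M + M) * N := by
    intro a c e
    rw [abs_mul, abs_abs]
    exact mul_le_mul ((abs_sub _ _).trans (add_le_add (bV _) (bV _))) (bΩ _) (abs_nonneg _)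
      (by positivity)
  have m1 : Measurable (Function.uncurry fun x y : Space d => |V x - V y| * Ω (x - y)) :=
    Continuous.measurable (by
      simp only [Function.uncurry_def]
      fun_prop)
  have m2 : Measurable (Function.uncurry fun y h : Space d => |V (y + h) - V y| * Ω h) :=
    Continuous.measurable (by
      simp only [Function.uncurry_def]
      fun_prop)
  have e1 : smearedDist Ω V V = ∫ h in cell d, (∫ y in cell d, |V (y + h) - V y|) * Ω h := by
    unfold smearedDist
    rw [integral_swap_of_bounded m1 fun x y => hb x y _]
    have e2 : ∀ y, ∫ x in cell d, |V x - V y| * Ω (x - y)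
        = ∫ h in cell d, |V (y + h) - V y| * Ω h := by
      intro y
      rw [← setIntegral_cell_add (g := fun h => |V (y + h) - V y| * Ω h) ?_ (-y)]
      · simp only [← sub_eq_add_neg, add_sub_cancel]
      · intro j h
        simp only
        rw [← add_assoc, pV j, hker.periodic j]
    simp only [e2]
    rw [integral_swap_of_bounded m2 fun y h => hb _ _ _]
    simp only [integral_mul_const]
  have hpt : ∀ h ∈ cell d, ∫ y in cell d, |V (y + h) - V y|
      ≤ ∑ j, K * Real.pi * |Real.sin (h j / 2)| := by
    intro h hh
    choose c hc using fun j => exists_int_abs_sub_le_sin (hh j)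
    -- The displacement is reduced modulo the lattice to its representative nearest to zero in each
    -- coordinate; otherwise displacements near a far corner of the cell would be charged their full
    -- length.
    set l : Space d := ∑ j, c j • latticeBasis d j with hl
    have hlmem : l ∈ periodLattice d :=
      Submodule.sum_mem _ fun j _ => Submodule.smul_mem _ _ (Submodule.subset_span ⟨j, rfl⟩)
    have hlj : ∀ j, l j = c j * (2 * Real.pi) := by
      intro j
      simp [hl, latticeBasis_apply, Finset.sum_apply, Pi.single_apply]
    have e3 : ∀ y, V (y + h) = V (y + (h - l)) := by
      intro y
      rw [← periodic_add_lattice pV hlmem (y + (h - l))]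
      congr 1; abel
    simp only [e3]
    refine (integral_abs_add_sub_le hV pV (h - l)).trans (Finset.sum_le_sum fun j _ => ?_)
    have h4 : (h - l) j = h j - c j * (2 * Real.pi) := by rw [← hlj]; rfl
    rw [h4, mul_comm K Real.pi, mul_right_comm]
    exact mul_le_mul (hc j) (hK j) (integral_nonneg fun _ => abs_nonneg _) (by positivity)
  have i3 : ∀ j : Fin d, Integrable (fun h : Space d => |Real.sin (h j / 2)| * Ω h)
      (volume.restrict (cell d)) := fun j =>
    Integrable.of_bound (C := 1 * N) (Continuous.aestronglyMeasurable (by fun_prop))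
      (ae_of_all _ fun h => by
        rw [norm_mul, Real.norm_eq_abs, abs_abs]
        exact mul_le_mul (Real.abs_sin_le_one _) (bΩ _) (norm_nonneg _) zero_le_one)
  have m3 : Measurable fun h : Space d => ∫ y in cell d, |V (y + h) - V y| :=
    measurable_integral_right (F := fun h y : Space d => |V (y + h) - V y|)
      (Continuous.measurable (by
        simp only [Function.uncurry_def]
        fun_prop))
  have i4 : Integrable (fun h : Space d => (∫ y in cell d, |V (y + h) - V y|) * Ω h)
      (volume.restrict (cell d)) := by
    refine integrable_of_bounded (m3.mul cΩ.measurable)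
      (C := (M + M) * (volume.restrict (cell d)).real univ * N) fun h => ?_
    rw [abs_mul]
    refine mul_le_mul (abs_integral_le_of_bounded fun y => ?_) (bΩ _) (abs_nonneg _) (by positivity)
    rw [abs_abs]
    exact (abs_sub _ _).trans (add_le_add (bV _) (bV _))
  rw [e1]
  have h5 : ∫ h in cell d, (∫ y in cell d, |V (y + h) - V y|) * Ω h
      ≤ ∫ h in cell d, ∑ j, K * Real.pi * (|Real.sin (h j / 2)| * Ω h) := by
    refine setIntegral_mono_on i4 (integrable_finsetSum _ fun j _ => (i3 j).const_mul _)
      (measurableSet_cell d) fun h hh => ?_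
    refine (mul_le_mul_of_nonneg_right (hpt h hh) (hker.nonneg h)).trans (le_of_eq ?_)
    rw [Finset.sum_mul]
    exact Finset.sum_congr rfl fun j _ => by ring
  refine h5.trans ?_
  rw [integral_finsetSum _ fun j _ => (i3 j).const_mul _]
  refine (Finset.sum_le_sum fun j _ => ?_).trans (le_of_eq (a := ∑ _j : Fin d,
    K * Real.pi * (1 / Real.sqrt (n + 1))) ?_)
  · rw [integral_const_mul]
    exact mul_le_mul_of_nonneg_left (integral_abs_sin_mul_torusKernel_le n j)
      (mul_nonneg K0 Real.pi_pos.le)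
  · rw [Finset.sum_const, Finset.card_univ, Fintype.card_fin, nsmul_eq_mul]
    ring

end Rate

/-- Limits along the filter of the essential limit carry information only if it is nontrivial: each
interval `(0,δ)` has positive measure and so meets every set of full measure. -/
theorem neBot_nhdsGT_inf_ae : (𝓝[>] (0 : ℝ) ⊓ ae volume).NeBot := by
  refine inf_neBot_iff.2 fun {s} hs {s'} hs' => ?_
  obtain ⟨δ, hδ, hsub⟩ := mem_nhdsGT_iff_exists_Ioo_subset.1 hs
  by_contra hcon
  rw [not_nonempty_iff_eq_empty] at hcon
  have h1 : Ioo 0 δ ⊆ s'ᶜ := fun x hx hx' => by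
    have : x ∈ s ∩ s' := ⟨hsub hx, hx'⟩
    rw [hcon] at this
    exact this
  have h2 : volume (Ioo (0 : ℝ) δ) = 0 := measure_mono_null h1 hs'
  rw [Real.volume_Ioo, sub_zero, ENNReal.ofReal_eq_zero] at h2
  exact absurd hδ (not_lt.2 h2)

/-! ### Choice of the kernel width and passage to the initial time -/

section Main

variable {d : ℕ} {f : Fin d → ℝ → ℝ} {μ : Measure (Space d)} {T ε : ℝ} {u₀ : Space d → ℝ}
  {u v : Space d → ℝ → ℝ}

/-- The stability estimate between two positive times. -/
theorem IsEntropySolution.integral_abs_sub_le_add (hμ : IsLevyMeasure μ)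
    (hf : ∀ j, ContDiff ℝ 1 (f j)) (hε : 0 < ε) (hu : IsEntropySolution f μ T u₀ u)
    (hv : IsViscousSolution f μ T ε u₀ v) {K : ℝ} (K0 : 0 ≤ K)
    (hK : ∀ t ∈ Ioo 0 T, ∀ j, ∫ y in cell d, |partialDeriv j (fun y => v y t) y| ≤ K)
    {a b : ℝ} (ha : 0 < a) (hab : a ≤ b) (hb : b < T) :
    ∫ x in cell d, |u x b - v x b|
      ≤ (∫ x in cell d, |u x a - v x a|) + d * K * (T + 2 * Real.pi) * Real.sqrt ε := by
  -- Since `n ≤ 1/ε ≤ n + 1`, both the viscous error `ε √n` and the smearing error `1/√(n+1)` are at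
  -- most `√ε`. Large `ε` gives `n = 0`, the constant kernel, and needs no separate treatment.
  set n : ℕ := ⌊1 / ε⌋₊ with hn
  have haI : a ∈ Ioo 0 T := ⟨ha, hab.trans_lt hb⟩
  have hbI : b ∈ Ioo 0 T := ⟨ha.trans_le hab, hb⟩
  have hker := isPeriodicKernel_torusKernel d n
  have iu : ∀ t ∈ Ioo 0 T, Integrable (fun x => u x t) (volume.restrict (cell d)) := fun t ht =>
    hu.integrable_slice (Ioo_subset_Icc_self ht)
  have h1 := hker.integral_abs_sub_le (iu b hbI) (hv.integrable_slice hbI)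
  have h2 := hker.smearedDist_le (iu a haI) (hv.integrable_slice haI)
  have h3 := hu.smearedDist_le_add hμ hf hε.le hv K0 hK n ha hab hb
  have hs : ∀ t ∈ Ioo 0 T, smearedDist (torusKernel n) (fun x => v x t) (fun x => v x t)
      ≤ d * (K * Real.pi) / Real.sqrt (n + 1) := fun t ht =>
    smearedDist_self_le ((hv.contDiff_space t ht).of_le one_le_two) (hv.periodic t ht) K0 (hK t ht) n
  have hsε : 0 < Real.sqrt ε := Real.sqrt_pos.2 hε
  have hn1 : 1 / Real.sqrt (n + 1) ≤ Real.sqrt ε := by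
    have h4 : 1 / ε ≤ n + 1 := (Nat.lt_floor_add_one _).le
    have h5 : Real.sqrt (1 / ε) ≤ Real.sqrt (n + 1) := Real.sqrt_le_sqrt h4
    rw [Real.sqrt_div zero_le_one, Real.sqrt_one] at h5
    rw [div_le_iff₀ (Real.sqrt_pos.2 (by positivity))]
    rw [div_le_iff₀ hsε] at h5
    linarith
  have hn2 : ε * Real.sqrt n ≤ Real.sqrt ε := by
    have h4 : (n : ℝ) ≤ 1 / ε := Nat.floor_le (by positivity)
    have h5 : Real.sqrt n ≤ Real.sqrt (1 / ε) := Real.sqrt_le_sqrt h4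
    rw [Real.sqrt_div zero_le_one, Real.sqrt_one] at h5
    refine (mul_le_mul_of_nonneg_left h5 hε.le).trans (le_of_eq ?_)
    rw [mul_one_div, Real.div_sqrt]
  have hS : ε * (∑ j : Fin d, K * (∫ x in cell d, |partialDeriv j (torusKernel n) x|)) * (b - a)
      ≤ d * K * T * Real.sqrt ε := by
    have h6 : ∑ j : Fin d, K * (∫ x in cell d, |partialDeriv j (torusKernel n) x|)
        ≤ d * (K * Real.sqrt n) := by
      refine (Finset.sum_le_sum fun j _ => mul_le_mul_of_nonneg_left
        (integral_abs_partialDeriv_torusKernel_le n j) K0).trans (le_of_eq ?_)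
      rw [Finset.sum_const, Finset.card_univ, Fintype.card_fin, nsmul_eq_mul]
    have h7 : 0 ≤ b - a := sub_nonneg.2 hab
    have h8 : b - a ≤ T := by linarith
    calc ε * (∑ j : Fin d, K * (∫ x in cell d, |partialDeriv j (torusKernel n) x|)) * (b - a)
        ≤ ε * (d * (K * Real.sqrt n)) * (b - a) := by gcongr
      _ = d * K * (ε * Real.sqrt n) * (b - a) := by ring
      _ ≤ d * K * Real.sqrt ε * T := by gcongr
      _ = _ := by ring
  have hE : d * (K * Real.pi) / Real.sqrt (n + 1) ≤ d * K * Real.pi * Real.sqrt ε := by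
    calc d * (K * Real.pi) / Real.sqrt (n + 1)
        = d * K * Real.pi * (1 / Real.sqrt (n + 1)) := by ring
      _ ≤ _ := by
        have := Real.pi_pos
        gcongr
  have ha' := hs a haI
  have hb' := hs b hbI
  -- The term with `T` is the viscous growth; `2π` is twice the smearing error, paid once at `a` and
  -- once at `b`.
  have e : d * K * (T + 2 * Real.pi) * Real.sqrt ε
      = d * K * T * Real.sqrt ε + 2 * (d * K * Real.pi * Real.sqrt ε) := by ring
  linarith

theorem IsEntropySolution.distL1_le {B : ℝ≥0} (hμ : IsLevyMeasure μ)
    (hf : ∀ j, ContDiff ℝ 1 (f j)) (hε : 0 < ε) (hu : IsEntropySolution f μ T u₀ u)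
    (hv : IsViscousSolution f μ T ε u₀ v) (hu₀ : EssBounded u₀) (pu : CellPeriodic u₀)
    (hB : variationBV u₀ ≤ (B : ℝ≥0∞)) (hT : 0 ≤ T) {t : ℝ} (ht : t ∈ Ioo 0 T) :
    distL1 (fun x => u x t) (fun x => v x t)
      ≤ ENNReal.ofReal (d * (2 * B) * (T + 2 * Real.pi) * Real.sqrt ε) := by
  set E := d * (2 * (B : ℝ)) * (T + 2 * Real.pi) * Real.sqrt ε with hE
  have hE0 : 0 ≤ E := by have := Real.pi_pos; positivity
  have hK : ∀ s ∈ Ioo 0 T, ∀ j, ∫ y in cell d, |partialDeriv j (fun y => v y s) y| ≤ 2 * B :=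
    fun s hs j => hv.integral_abs_partialDeriv_le hμ hf hε.le hu₀ pu hB hs j
  have iu : ∀ s ∈ Ioo 0 T, Integrable (fun x => u x s) (volume.restrict (cell d)) := fun s hs =>
    hu.integrable_slice (Ioo_subset_Icc_self hs)
  -- At the small time `a` the two solutions are compared through their common initial value; both
  -- distances to it vanish along the essential limit.
  have hle : ∀ a ∈ Ioc 0 t, distL1 (fun x => u x t) (fun x => v x t)
      ≤ distL1 (fun x => u x a) u₀ + distL1 (fun x => v x a) u₀ + ENNReal.ofReal E := by
    intro a ha
    have haI : a ∈ Ioo 0 T := ⟨ha.1, ha.2.trans_lt ht.2⟩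
    have h := hu.integral_abs_sub_le_add hμ hf hε hv (by positivity) hK ha.1 ha.2 ht.2
    have htri := distL1_triangle (iu a haI).aestronglyMeasurable hu₀.1.restrict
      (hv.integrable_slice haI).aestronglyMeasurable
    rw [distL1_comm u₀] at htri
    refine le_trans ?_ (add_le_add htri le_rfl)
    rw [distL1_eq_ofReal ((iu t ht).sub (hv.integrable_slice ht)).abs,
      distL1_eq_ofReal ((iu a haI).sub (hv.integrable_slice haI)).abs,
      ← ENNReal.ofReal_add (integral_nonneg fun _ => abs_nonneg _) hE0]
    exact ENNReal.ofReal_le_ofReal h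
  have := neBot_nhdsGT_inf_ae
  have hlim : Tendsto (fun a => distL1 (fun x => u x a) u₀ + distL1 (fun x => v x a) u₀
      + ENNReal.ofReal E) (𝓝[>] (0 : ℝ) ⊓ ae volume) (𝓝 (0 + 0 + ENNReal.ofReal E)) :=
    (hu.initial.add (hv.initial.mono_left inf_le_left)).add tendsto_const_nhds
  rw [add_zero, zero_add] at hlim
  refine ge_of_tendsto hlim (mem_inf_of_left ?_)
  filter_upwards [Ioc_mem_nhdsGT ht.1] with a ha using hle a ha

end Main

end FracCL

theorem mainTheorem3 (d : ℕ) (T : ℝ) (hT : 0 < T) (B : ℝ≥0) :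
    ∃ C : ℝ, ∀ (f : Fin d → ℝ → ℝ) (μ : Measure (FracCL.Space d)) (u₀ : FracCL.Space d → ℝ),
      (∀ j, ContDiff ℝ 1 (f j)) →
      FracCL.IsLevyMeasure μ →
      FracCL.EssBounded u₀ → FracCL.CellPeriodic u₀ → FracCL.variationBV u₀ ≤ (B : ℝ≥0∞) →
      ∀ u : FracCL.Space d → ℝ → ℝ, FracCL.IsEntropySolution f μ T u₀ u →
      ∀ (ε : ℝ) (v : FracCL.Space d → ℝ → ℝ), 0 < ε → FracCL.IsViscousSolution f μ T ε u₀ v →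
      ∀ t ∈ Ioo 0 T,
        FracCL.distL1 (fun x => u x t) (fun x => v x t) ≤ ENNReal.ofReal (C * Real.sqrt ε) := by
  -- The bound `2B` for the `L¹` norms of the partial derivatives of the viscous solution takes the
  -- place of `K`.
  refine ⟨d * (2 * B) * (T + 2 * Real.pi), ?_⟩
  intro f μ u₀ hf hμ hu₀ pu hB u hu ε v hε hv t ht
  exact hu.distL1_le hμ hf hε hv hu₀ pu hB hT.le ht
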